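/- **Setting.** Let $G$ be a connected semisimple algebraic group of adjoint type over $\mathbb C$, realized as the adjoint group of a complex semisimple Lie algebra. Fix a Cartan subgroup $H$, a Borel subgroup $B^+=HU^+$ containing it (with unipotent radical $U^+$), normalized simple root homomorphisms $x_s,y_s$, and let $\overline w_0=\overline r_{s_1}\cdots\overline r_{s_\ell}$, where $\overline r_s=x_s(-1)y_s(1)x_s(-1)$ and $s_1\cdots s_\ell$ is a reduced word of the longest element of the Weyl group; put $B^-=\overline w_0B^+\overline w_0^{-1}$. A *flag* is a point of $G/B^+$; the flag of $B^-$ is $\overline w_0.B^+$. A *pinning* is a pair $p=(gU^+,F)\in G/U^+\times G/B^+$ such that the pair of flags $(gB^+,F)$ is $G$-equivalent to $(B^+,B^-)$; put $\pi_+(p)=gB^+$, $\pi_-(p)=F$. The set $\mathcal P_G$ of pinnings is a principal homogeneous $G$-space with base point $p_{\rm std}=(U^+,B^-)$, and has the variety structure of $G$. Let $\Sigma$ be a connected compact oriented surface of genus $g$ with boundary components $\partial_1,\dots,\partial_b$ ($b\ge 1$) and with $N_k\ge 1$ marked points $m^{(k)}_1,\dots,m^{(k)}_{N_k}$ on $\partial_k$,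 in this cyclic order, and no punctures. Assume $-3(2-2g-b)+2\sum_kN_k>0$ and that $\Sigma$ is not a disk with at most two marked points. Let $E^{(k)}_j$ be the boundary interval with initial point $m^{(k)}_j$; $\mathbb B$ is the set of boundary intervals and $E_0=E^{(1)}_1$. Fix $x\in\Sigma$ and paths $\epsilon_E$ from $x$ to $E\in\mathbb B$ such that, for $2\le j\le N_k$, $\epsilon_{E_j^{(k)}}^{-1}\ast\epsilon_{E_{j-1}^{(k)}}$ is homotopic to the boundary arc passing exactly the marked point $m^{(k)}_j$. Let $\delta_k\in\pi_1(\Sigma,x)$ be the loop which follows $\epsilon_{E^{(k)}_1}$, goes once around $\partial_k$ and returns, and let $\alpha_i,\beta_i$ $(1\le i\le g)$, $\delta_k$ $(1\le k\le b)$ be a standard generating set of $\pi_1(\Sigma,x)$, with the single defining relation $\prod_i[\alpha_i,\beta_i]\prod_k\delta_k=1$. The atlas $P_{G,\Sigma}$ is the variety of triples $(\rho,\lambda,\phi)$, where $\rho\in{\rm Hom}(\pi_1(\Sigma,x),G)$, $\lambda$ assigns a flag to every marked point, and $\phi$ assigns a pinning to every boundary interval, such that $\pi_+(\phi_{E^{(k)}_j})=\lambda_{m^{(k)}_j}$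 and $\pi_-(\phi_{E^{(k)}_j})=\lambda_{m^{(k)}_{j+1}}$, where $\lambda_{m^{(k)}_{N_k+1}}:=\rho(\delta_k).\lambda_{m^{(k)}_1}$. The group $G$ acts by $(\rho,\lambda,\phi)\mapsto(g\rho g^{-1},g.\lambda,g.\phi)$, and $\mathcal P_{G,\Sigma}=[P_{G,\Sigma}/G]$. Write $\phi_E=g_E.p_{\rm std}$ and $g_0=g_{E_0}$. The *Wilson line* along the arc class $[c]=\epsilon_E^{-1}\ast\gamma\ast\epsilon_{E'}:E\to E'$, $\gamma\in\pi_1(\Sigma,x)$, is $g_{[c]}=g_E^{-1}\rho(\gamma)g_{E'}\overline w_0$. Put $\rho_{E_0}(\gamma)=g_0^{-1}\rho(\gamma)g_0$ (the twisted Wilson line $g_{[c]}\overline w_0$ for $E=E'=E_0$). Let $g^{(k)}$ $(k\ge2)$ be the Wilson line along $\epsilon_{E_0}^{-1}\ast\epsilon_{E^{(k)}_{N_k}}$, and let $g^{(k)}_{j,j-1}$ (index $j-1$ read cyclically, $g^{(k)}_{1,0}=g^{(k)}_{1,N_k}$) be the Wilson line along the boundary arc from $E^{(k)}_j$ to $E^{(k)}_{j-1}$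 passing exactly the marked point $m^{(k)}_j$. **Theorem.** The $g^{(k)}_{j,j-1}$ take values in $B^+$, all Wilson lines are $G$-invariant, and the tuple $$\Phi_{E_0}=\big((\rho_{E_0}(\alpha_i),\rho_{E_0}(\beta_i),\rho_{E_0}(\delta_k))_{i,k},\ (g^{(k)})_{2\le k\le b},\ (g^{(k)}_{j,j-1})_{k,j}\big)$$ defines a closed embedding $\Phi_{E_0}:\mathcal P_{G,\Sigma}\to G^{2g+b}\times G^{b-1}\times (B^+)^{\sum_kN_k}$. More precisely, $(\Phi_{E_0},g_0)$ is a $G$-equivariant closed embedding of $P_{G,\Sigma}$ into $\big(G^{2g+b}\times G^{b-1}\times (B^+)^{\sum_kN_k}\big)\times G$ with image $Z\times G$, where $G$ acts by left multiplication on the last factor only, and the image of $\Phi_{E_0}$ is $Z$. Here $Z$ is the closed subvariety of the tuples satisfying * the monodromy relation $\prod_{i=1}^g[\rho_{E_0}(\alpha_i),\rho_{E_0}(\beta_i)]\cdot\prod_{k=1}^b\rho_{E_0}(\delta_k)=1$; * the boundary relations $$(g^{(1)}_{1,N_1}\overline w_0)(g^{(1)}_{N_1,N_1-1}\overline w_0)\cdots(g^{(1)}_{2,1}\overline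 w_0)=\rho_{E_0}(\delta_1)^{-1},$$ $$(g^{(k)}\overline w_0)\,(g^{(k)}_{N_k,N_k-1}\overline w_0)\cdots(g^{(k)}_{2,1}\overline w_0)(g^{(k)}_{1,N_k}\overline w_0)\,(g^{(k)}\overline w_0)^{-1}=\rho_{E_0}(\delta_k)^{-1}\qquad(2\le k\le b).$$ **Corollary.** $\Phi_{E_0}$ induces an isomorphism of $\mathbb C$-algebras $$\big(\mathcal O(G)^{\otimes(2g+b)}\otimes\mathcal O(G)^{\otimes(b-1)}\otimes\mathcal O(B^+)^{\otimes\sum_kN_k}\big)/\sqrt{\mathscr I}\ \cong\ \mathcal O(\mathcal P_{G,\Sigma}),$$ where $\mathscr I$ is the ideal generated by (the matrix entries of) the monodromy relation and the boundary relations. The algebra $\mathcal O(\mathcal P_{G,\Sigma})$ is generated by the matrix coefficients of all Wilson lines, and already by those of the components of $\Phi_{E_0}$. -/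

import Mathlib

open scoped TensorProduct Manifold Topology

noncomputable section

namespace WilsonLines

/-! ## Varieties as spaces with functions

A complex variety is described by its set of points, its Zariski topology and, for each open set `U`,
the algebra of functions that are regular on `U`.  A function is a total function `X → ℂ`, of which
only the values on `U` matter. -/

/-- A space with functions. -/
structure FunctionSpace (X : Type*) where
  top : TopologicalSpace X
  regular : Set X → Subalgebra ℂ (X → ℂ)
  mono : ∀ U V : Set X, V ⊆ U → regular U ≤ regular V

namespace FunctionSpace

/-- The affine variety with point set `X` and coordinate ring `A`: the topology is generated by the
sets `{h ≠ 0}`, `h ∈ A`, and the regular functions are locally fractions `p / h` with `p, h ∈ A`. -/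
def affine {X : Type*} (A : Subalgebra ℂ (X → ℂ)) : FunctionSpace X where
  top := TopologicalSpace.generateFrom {U | ∃ h ∈ A, U = {x | h x ≠ 0}}
  regular U :=
    { carrier := {f | ∀ x ∈ U, ∃ p ∈ A, ∃ h ∈ A, h x ≠ 0 ∧ ∀ y ∈ U, h y ≠ 0 → f y = p y / h y}
      mul_mem' := by
        intro f f' hf hf' x hx
        obtain ⟨p, hp, h, hh, hx0, e⟩ := hf x hx
        obtain ⟨p', hp', h', hh', hx0', e'⟩ := hf' x hx
        refine ⟨p * p', mul_mem hp hp', h * h', mul_mem hh hh', mul_ne_zero hx0 hx0', ?_⟩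
        intro y hy hy0
        have h1 : h y ≠ 0 := left_ne_zero_of_mul hy0
        have h2 : h' y ≠ 0 := right_ne_zero_of_mul hy0
        simp only [Pi.mul_apply, e y hy h1, e' y hy h2]
        field_simp
      add_mem' := by
        intro f f' hf hf' x hx
        obtain ⟨p, hp, h, hh, hx0, e⟩ := hf x hx
        obtain ⟨p', hp', h', hh', hx0', e'⟩ := hf' x hx
        refine ⟨p * h' + p' * h, add_mem (mul_mem hp hh') (mul_mem hp' hh), h * h',
          mul_mem hh hh', mul_ne_zero hx0 hx0', ?_⟩
        intro y hy hy0
        have h1 : h y ≠ 0 := left_ne_zero_of_mul hy0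
        have h2 : h' y ≠ 0 := right_ne_zero_of_mul hy0
        simp only [Pi.mul_apply, Pi.add_apply, e y hy h1, e' y hy h2]
        field_simp
      algebraMap_mem' := by
        intro r x _
        exact ⟨algebraMap ℂ _ r, A.algebraMap_mem r, 1, one_mem _, one_ne_zero, by simp⟩ }
  mono U V hVU f hf x hx := by
    obtain ⟨p, hp, h, hh, hx0, e⟩ := hf x (hVU hx)
    exact ⟨p, hp, h, hh, hx0, fun y hy => e y (hVU hy)⟩

/-- The structure induced on `X` by a map `φ : X → Y` (for an inclusion: the subvariety structure):
a function is regular if locally it is the restriction of a regular function on an open set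
of `Y`. -/
def induced {X Y : Type*} (𝒴 : FunctionSpace Y) (φ : X → Y) : FunctionSpace X where
  top := 𝒴.top.induced φ
  regular U :=
    { carrier := {f | ∀ x ∈ U, ∃ V : Set Y, IsOpen[𝒴.top] V ∧ φ x ∈ V ∧
        ∃ F ∈ 𝒴.regular V, ∀ z ∈ U, φ z ∈ V → f z = F (φ z)}
      mul_mem' := by
        intro f f' hf hf' x hx
        obtain ⟨V, hV, hxV, F, hF, e⟩ := hf x hx
        obtain ⟨V', hV', hxV', F', hF', e'⟩ := hf' x hx
        refine ⟨V ∩ V', @IsOpen.inter _ 𝒴.top _ _ hV hV', ⟨hxV, hxV'⟩, F * F',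
          mul_mem (𝒴.mono _ _ Set.inter_subset_left hF) (𝒴.mono _ _ Set.inter_subset_right hF'), ?_⟩
        intro z hz hzV
        simp [e z hz hzV.1, e' z hz hzV.2]
      add_mem' := by
        intro f f' hf hf' x hx
        obtain ⟨V, hV, hxV, F, hF, e⟩ := hf x hx
        obtain ⟨V', hV', hxV', F', hF', e'⟩ := hf' x hx
        refine ⟨V ∩ V', @IsOpen.inter _ 𝒴.top _ _ hV hV', ⟨hxV, hxV'⟩, F + F',
          add_mem (𝒴.mono _ _ Set.inter_subset_left hF) (𝒴.mono _ _ Set.inter_subset_right hF'), ?_⟩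
        intro z hz hzV
        simp [e z hz hzV.1, e' z hz hzV.2]
      algebraMap_mem' := by
        intro r x _
        exact ⟨Set.univ, @isOpen_univ _ 𝒴.top, trivial, algebraMap ℂ _ r,
          (𝒴.regular _).algebraMap_mem r, by simp⟩ }
  mono U V hVU f hf x hx := by
    obtain ⟨W, hW, hxW, F, hF, e⟩ := hf x (hVU hx)
    exact ⟨W, hW, hxW, F, hF, fun z hz => e z (hVU hz)⟩

/-- The quotient structure along a map `q : X → Y`: the quotient topology, and the functions whose
pullback to `X` is regular. -/
def coinduced {X Y : Type*} (𝒳 : FunctionSpace X) (q : X → Y) : FunctionSpace Y where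
  top := 𝒳.top.coinduced q
  regular U :=
    { carrier := {F | F ∘ q ∈ 𝒳.regular (q ⁻¹' U)}
      mul_mem' := fun hf hg => mul_mem (S := Subalgebra ℂ (X → ℂ)) hf hg
      add_mem' := fun hf hg => add_mem (S := Subalgebra ℂ (X → ℂ)) hf hg
      algebraMap_mem' := fun r => (𝒳.regular (q ⁻¹' U)).algebraMap_mem r }
  mono _ _ hVU _ hF := 𝒳.mono _ _ (Set.preimage_mono hVU) hF

/-- The algebra of (global) regular functions. -/
def functionAlgebra {X : Type*} (𝒳 : FunctionSpace X) : Subalgebra ℂ (X → ℂ) :=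
  𝒳.regular Set.univ

/-- `φ` is a closed embedding: it is injective with closed image, and it identifies `𝒳` with its
image, regarded as a subvariety of `𝒴`. -/
def IsClosedEmbedding {X Y : Type*} (𝒳 : FunctionSpace X) (𝒴 : FunctionSpace Y) (φ : X → Y) : Prop :=
  Function.Injective φ ∧ IsClosed[𝒴.top] (Set.range φ) ∧ 𝒳.top = 𝒴.top.induced φ ∧
    ∀ U : Set X, IsOpen[𝒳.top] U → 𝒳.regular U = (𝒴.induced φ).regular U

end FunctionSpace

/-! ## The adjoint group and its pinning -/

section Exponential

variable {V : Type*} [AddCommGroup V] [Module ℂ V]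

/-- The exponential of a nilpotent endomorphism. -/
def expEnd (A : Module.End ℂ V) : Module.End ℂ V :=
  ∑ k ∈ Finset.range (nilpotencyClass A), ((k.factorial : ℂ)⁻¹) • A ^ k

theorem expEnd_neg_mul_aux {A : Module.End ℂ V} (hA : IsNilpotent A) :
    expEnd A * expEnd (-A) = 1 ∧ expEnd (-A) * expEnd A = 1 := by
  let _ : Module ℚ (Module.End ℂ V) := Module.compHom _ (algebraMap ℚ ℂ)
  have key : ∀ C : Module.End ℂ V, expEnd C = IsNilpotent.exp C := by
    intro C
    unfold expEnd IsNilpotent.exp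
    refine Finset.sum_congr rfl fun k _ => ?_
    change _ = (algebraMap ℚ ℂ ((k.factorial : ℚ)⁻¹)) • C ^ k
    simp
  rw [key, key]
  exact ⟨hA.exp_mul_exp_neg_self, hA.exp_neg_mul_exp_self⟩

/-- The exponential of a nilpotent endomorphism, as an element of the general linear group. -/
def expUnit (A : Module.End ℂ V) (hA : IsNilpotent A) : (Module.End ℂ V)ˣ :=
  ⟨expEnd A, expEnd (-A), (expEnd_neg_mul_aux hA).1, (expEnd_neg_mul_aux hA).2⟩

end Exponential

section Group

open LieAlgebra LieAlgebra.IsKilling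

variable {𝔤 : Type*} [LieRing 𝔤] [LieAlgebra ℂ 𝔤] [FiniteDimensional ℂ 𝔤]
  [LieAlgebra.IsKilling ℂ 𝔤]

/-- The adjoint group `G` of a complex semisimple Lie algebra `𝔤` with Cartan subalgebra `𝔥`: the
subgroup of `GL(𝔤)` generated by the root subgroups `exp (ad x)`, `x` a root vector.  It is the
image `G̃ / Z(G̃)` of the simply connected group `G̃` of `𝔤` under the adjoint representation. -/
def adjointGroup (𝔥 : LieSubalgebra ℂ 𝔤) [𝔥.IsCartanSubalgebra] : Subgroup (Module.End ℂ 𝔤)ˣ :=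
  Subgroup.closure {g | ∃ α : 𝔥.root, ∃ x ∈ rootSpace 𝔥 (α.1 : 𝔥 → ℂ),
    (g : Module.End ℂ 𝔤) = expEnd (LieAlgebra.ad ℂ 𝔤 x)}

theorem root_ne_zero_aux {𝔥 : LieSubalgebra ℂ 𝔤} [𝔥.IsCartanSubalgebra] (α : 𝔥.root) :
    (α.1 : 𝔥 → ℂ) ≠ 0 := by
  have := α.2
  simp only [LieSubalgebra.root, Finset.mem_filter] at this
  exact this.2

/-- The product of the simple reflections along a word in the simple roots. -/
def weylWord {𝔥 : LieSubalgebra ℂ 𝔤} [𝔥.IsCartanSubalgebra] (b : (rootSystem 𝔥).Base)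
    (l : List b.support) : Module.Dual ℂ 𝔥 ≃ₗ[ℂ] Module.Dual ℂ 𝔥 :=
  (l.map fun s => (rootSystem 𝔥).reflection s.1).prod

/-- Reduced words in the Weyl group. -/
def IsReducedWord {𝔥 : LieSubalgebra ℂ 𝔤} [𝔥.IsCartanSubalgebra] (b : (rootSystem 𝔥).Base)
    (l : List b.support) : Prop :=
  ∀ l' : List b.support, weylWord b l' = weylWord b l → l.length ≤ l'.length

/-- The choices in the construction of `G`: a base of the root system, normalized simple root
vectors `e_s`, `f_s`, and a reduced word of the longest element `w₀` of the Weyl group. -/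
structure Pinned (𝔥 : LieSubalgebra ℂ 𝔤) [𝔥.IsCartanSubalgebra] where
  base : (rootSystem 𝔥).Base
  e : base.support → 𝔤
  f : base.support → 𝔤
  sl2 : ∀ s, IsSl2Triple (((rootSystem 𝔥).coroot s.1 : 𝔥) : 𝔤) (e s) (f s)
  e_mem : ∀ s, e s ∈ rootSpace 𝔥 ((s.1 : 𝔥.root).1 : 𝔥 → ℂ)
  f_mem : ∀ s, f s ∈ rootSpace 𝔥 (-((s.1 : 𝔥.root).1 : 𝔥 → ℂ))
  word : List base.support
  word_reduced : IsReducedWord base word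
  word_longest : ∀ l : List base.support, IsReducedWord base l → l.length ≤ word.length

namespace Pinned

variable {𝔥 : LieSubalgebra ℂ 𝔤} [𝔥.IsCartanSubalgebra] (D : Pinned 𝔥)

/-- The group `G`. -/
abbrev G (_ : Pinned 𝔥) : Type _ := ↥(adjointGroup 𝔥)

/-- The root homomorphism `x_s(t) = exp (t ad e_s)`. -/
def xRoot (s : D.base.support) (t : ℂ) : D.G :=
  ⟨expUnit (LieAlgebra.ad ℂ 𝔤 (t • D.e s))
      (LieAlgebra.isNilpotent_ad_of_mem_rootSpace 𝔥 (root_ne_zero_aux s.1)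
        (Submodule.smul_mem _ t (D.e_mem s))),
    Subgroup.subset_closure ⟨s.1, t • D.e s, Submodule.smul_mem _ t (D.e_mem s), rfl⟩⟩

theorem exists_neg_root_aux (α : 𝔥.root) : ∃ β : 𝔥.root, (β.1 : 𝔥 → ℂ) = -(α.1 : 𝔥 → ℂ) := by
  refine ⟨⟨-α.1, ?_⟩, by simp⟩
  have h := root_ne_zero_aux α
  simp only [LieSubalgebra.root, Finset.mem_filter, Finset.mem_univ, true_and]
  intro h0
  apply h
  have : ((-α.1 : LieModule.Weight ℂ 𝔥 𝔤) : 𝔥 → ℂ) = 0 := h0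
  simpa using this

/-- The root homomorphism `y_s(t) = exp (t ad f_s)`. -/
def yRoot (s : D.base.support) (t : ℂ) : D.G :=
  ⟨expUnit (LieAlgebra.ad ℂ 𝔤 (t • D.f s))
      (LieAlgebra.isNilpotent_ad_of_mem_rootSpace 𝔥 (neg_ne_zero.mpr (root_ne_zero_aux s.1))
        (Submodule.smul_mem _ t (D.f_mem s))),
    Subgroup.subset_closure (by
      obtain ⟨β, hβ⟩ := exists_neg_root_aux s.1
      exact ⟨β, t • D.f s, by rw [hβ]; exact Submodule.smul_mem _ t (D.f_mem s), rfl⟩)⟩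

/-- `r̄_s`, the image of the matrix with rows `(0, -1)`, `(1, 0)` under the homomorphism
`SL₂ → G` given by `x_s` and `y_s`; that matrix is the product of the elementary matrices
`x(-1) y(1) x(-1)`. -/
def rBar (s : D.base.support) : D.G := D.xRoot s (-1) * D.yRoot s 1 * D.xRoot s (-1)

/-- `w̄₀`, the lift of the longest element. -/
def w0 : D.G := (D.word.map D.rBar).prod

/-- The Cartan subgroup `H`: the elements of `G` that fix `𝔥` pointwise. -/
def H : Subgroup D.G where
  carrier := {g | ∀ h : 𝔥, (g.1 : Module.End ℂ 𝔤) (h : 𝔤) = h}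
  mul_mem' := by
    intro a b ha hb h
    change (a.1 : Module.End ℂ 𝔤) ((b.1 : Module.End ℂ 𝔤) (h : 𝔤)) = h
    rw [hb h, ha h]
  one_mem' := by intro h; rfl
  inv_mem' := by
    intro a ha h
    have h1 : ((a⁻¹).1 : Module.End ℂ 𝔤) ((a.1 : Module.End ℂ 𝔤) (h : 𝔤)) = h := by
      change (((a⁻¹).1 * a.1 : (Module.End ℂ 𝔤)ˣ) : Module.End ℂ 𝔤) (h : 𝔤) = h
      simp
    rwa [ha h] at h1

/-- The maximal unipotent subgroup `U⁺`, generated by the positive root subgroups. -/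
def U : Subgroup D.G :=
  Subgroup.closure {g | ∃ α : 𝔥.root, D.base.IsPos α ∧ ∃ x ∈ rootSpace 𝔥 (α.1 : 𝔥 → ℂ),
    (g.1 : Module.End ℂ 𝔤) = expEnd (LieAlgebra.ad ℂ 𝔤 x)}

/-- The Borel subgroup `B⁺ = H U⁺`. -/
def B : Subgroup D.G := D.H ⊔ D.U

/-- The flag variety `G / B⁺`. -/
def Flag : Type _ := D.G ⧸ D.B

instance : MulAction D.G D.Flag := MulAction.quotient D.G D.B

/-- The principal affine space `G / U⁺`. -/
def DecoratedFlag : Type _ := D.G ⧸ D.U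

instance : MulAction D.G D.DecoratedFlag := MulAction.quotient D.G D.U

/-- The projection from decorated flags to flags. -/
def toFlag : D.DecoratedFlag → D.Flag :=
  Subgroup.quotientMapOfLE (le_sup_right : D.U ≤ D.B)

/-- The flag of `B⁺`. -/
def flagPlus : D.Flag := ((1 : D.G) : D.G ⧸ D.B)

/-- The flag of the opposite Borel subgroup `B⁻ = w̄₀ B⁺ w̄₀⁻¹`, that is `w̄₀.B⁺`. -/
def flagMinus : D.Flag := ((D.w0 : D.G) : D.G ⧸ D.B)

/-- Generic pairs of flags. -/
def IsGeneric (F₁ F₂ : D.Flag) : Prop := ∃ g : D.G, g • F₁ = D.flagPlus ∧ g • F₂ = D.flagMinus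

/-- Pinnings. -/
def Pinning : Type _ := {p : D.DecoratedFlag × D.Flag // D.IsGeneric (D.toFlag p.1) p.2}

theorem toFlag_smul_aux (g : D.G) (A : D.DecoratedFlag) : D.toFlag (g • A) = g • D.toFlag A := by
  refine QuotientGroup.induction_on A fun a => ?_
  rfl

theorem isGeneric_smul_aux (g : D.G) {F₁ F₂ : D.Flag} (h : D.IsGeneric F₁ F₂) :
    D.IsGeneric (g • F₁) (g • F₂) := by
  obtain ⟨k, h1, h2⟩ := h
  exact ⟨k * g⁻¹, by simp [mul_smul, h1], by simp [mul_smul, h2]⟩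

instance : MulAction D.G D.Pinning where
  smul g p := ⟨(g • p.1.1, g • p.1.2), by
    rw [toFlag_smul_aux]; exact D.isGeneric_smul_aux g p.2⟩
  one_smul p := Subtype.ext (Prod.ext (one_smul D.G p.1.1) (one_smul D.G p.1.2))
  mul_smul g h p := Subtype.ext (Prod.ext (mul_smul g h p.1.1) (mul_smul g h p.1.2))

/-- The projection `π₊` from pinnings to flags. -/
def piPlus (p : D.Pinning) : D.Flag := D.toFlag p.1.1

/-- The projection `π₋` from pinnings to flags. -/
def piMinus (p : D.Pinning) : D.Flag := p.1.2

/-- The standard pinning `p_std = ([U⁺], B⁻)`. -/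
def pStd : D.Pinning :=
  ⟨(((1 : D.G) : D.G ⧸ D.U), D.flagMinus), 1, one_smul _ _, one_smul _ _⟩

open Classical in
/-- The element `g ∈ G` with `p = g.p_std`. -/
def elt (p : D.Pinning) : D.G := if h : ∃ g : D.G, g • D.pStd = p then h.choose else 1

/-! ### Coordinate rings -/

/-- The algebra of functions on `Y` generated by the matrix entries of `F i` and of its inverse,
for a family of maps `F i : Y → G ⊆ GL(𝔤)`. -/
def coordAlg {Y ι : Type*} (F : ι → Y → D.G) : Subalgebra ℂ (Y → ℂ) :=
  Algebra.adjoin ℂ {φ | ∃ (i : ι) (ℓ : Module.Dual ℂ 𝔤) (v : 𝔤),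
    φ = (fun y => ℓ (((F i y).1 : Module.End ℂ 𝔤) v)) ∨
    φ = (fun y => ℓ (((F i y)⁻¹.1 : Module.End ℂ 𝔤) v))}

/-- The coordinate ring `𝒪(G)`. -/
abbrev OG : Subalgebra ℂ (D.G → ℂ) := D.coordAlg fun (_ : Unit) g => g

/-- The coordinate ring `𝒪(B⁺)`. -/
abbrev OB : Subalgebra ℂ (D.B → ℂ) := D.coordAlg fun (_ : Unit) g => g.1

/-- A matrix coefficient `g ↦ ⟨f, g.v⟩` of a finite-dimensional rational representation of `G`. -/
def IsMatrixCoefficient (m : D.G → ℂ) : Prop :=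
  ∃ (n : ℕ) (π : D.G →* Matrix (Fin n) (Fin n) ℂ) (f v : Fin n → ℂ),
    (∀ i j, (fun g => π g i j) ∈ D.OG) ∧ m = fun g => dotProduct f ((π g).mulVec v)

/-- The dimension of `𝔤`. -/
abbrev dim (_ : Pinned 𝔥) : ℕ := Module.finrank ℂ 𝔤

/-- The `(i, j)` matrix entry of `g ∈ G` in a fixed basis of `𝔤`. -/
def entry (i j : Fin D.dim) (g : D.G) : ℂ :=
  (Module.finBasis ℂ 𝔤).coord i ((g.1 : Module.End ℂ 𝔤) (Module.finBasis ℂ 𝔤 j))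

/-- The matrix entries as elements of `𝒪(G)`. -/
def entryG (i j : Fin D.dim) : D.OG :=
  ⟨fun g => D.entry i j g, Algebra.subset_adjoin ⟨(), _, _, Or.inl rfl⟩⟩

/-- The matrix entries of the inverse as elements of `𝒪(G)`. -/
def entryInvG (i j : Fin D.dim) : D.OG :=
  ⟨fun g => D.entry i j g⁻¹, Algebra.subset_adjoin ⟨(), _, _, Or.inr rfl⟩⟩

/-- The matrix entries as elements of `𝒪(B⁺)`. -/
def entryB (i j : Fin D.dim) : D.OB :=
  ⟨fun g => D.entry i j g.1, Algebra.subset_adjoin ⟨(), _, _, Or.inl rfl⟩⟩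

end Pinned

end Group

/-! ## Marked surfaces without punctures -/

section Surface

variable {S : Type*} [TopologicalSpace S]

/-- A marking on a surface `S` with boundary, all marked points lying on the boundary.  The boundary
components `∂_k` are parametrized by disjoint simple closed curves `C k : ℝ / ℤ → S`, and carry the
marked points `C k (mark k j)`, `j = 1, …, N k`, in this cyclic order. -/
structure MarkedSurface (S : Type*) [TopologicalSpace S] [ChartedSpace (EuclideanHalfSpace 2) S] where
  /-- the number of boundary components -/
  b : ℕ
  b_pos : 0 < b
  C : Fin b → ℝ → S
  continuous_C : ∀ k, Continuous (C k)
  periodic_C : ∀ k t, C k (t + 1) = C k t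
  injective_C : ∀ k k', ∀ t ∈ Set.Ico (0 : ℝ) 1, ∀ t' ∈ Set.Ico (0 : ℝ) 1,
    C k t = C k' t' → k = k' ∧ t = t'
  range_C : ⋃ k, Set.range (C k) = (𝓡∂ 2).boundary S
  /-- the number of marked points on each boundary component -/
  N : Fin b → ℕ
  N_pos : ∀ k, 0 < N k
  mark : ∀ k, Fin (N k) → ℝ
  mark_mem : ∀ k j, mark k j ∈ Set.Ico (0 : ℝ) 1
  strictMono_mark : ∀ k, StrictMono (mark k)

/-- The fundamental group of `S` at `x`, with `γ * γ'` meaning `γ` followed by `γ'` (this is the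
opposite of Mathlib's multiplication). -/
abbrev LoopGroup (x : S) : Type _ := (FundamentalGroup S x)ᵐᵒᵖ

/-- The class of a loop in the fundamental group. -/
def toLoop {x : S} (γ : Path.Homotopic.Quotient x x) : LoopGroup x :=
  MulOpposite.op (FundamentalGroup.fromPath γ)

namespace MarkedSurface

variable [ChartedSpace (EuclideanHalfSpace 2) S] (Sig : MarkedSurface S)

/-- The index set of the boundary intervals.  The boundary interval `E = ⟨k, j⟩` is the piece of `∂_k`
between the `j`-th marked point, its initial point, and the next one; so this is also the index
set of the marked points. -/
abbrev Ival : Type := Σ k : Fin Sig.b, Fin (Sig.N k)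

/-- The first boundary component. -/
def k0 : Fin Sig.b := ⟨0, Sig.b_pos⟩

/-- The first boundary interval `E_1^{(k)}` of `∂_k`. -/
def firstIval (k : Fin Sig.b) : Sig.Ival := ⟨k, ⟨0, Sig.N_pos k⟩⟩

/-- The last boundary interval `E_{N_k}^{(k)}` of `∂_k`. -/
def lastIval (k : Fin Sig.b) : Sig.Ival :=
  ⟨k, ⟨Sig.N k - 1, Nat.sub_lt (Sig.N_pos k) Nat.one_pos⟩⟩

/-- The distinguished boundary interval `E_0 = E_1^{(1)}`. -/
def E0 : Sig.Ival := Sig.firstIval Sig.k0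

/-- The parameter of the terminal marked point of a boundary interval. -/
def nextMark (E : Sig.Ival) : ℝ :=
  if h : (E.2 : ℕ) + 1 < Sig.N E.1 then Sig.mark E.1 ⟨E.2 + 1, h⟩
  else Sig.mark E.1 ⟨0, Sig.N_pos E.1⟩ + 1

/-- The homotopy class of the boundary path `C k` from the parameter `s` to the parameter `t`. -/
def arc (k : Fin Sig.b) (s t : ℝ) : Path.Homotopic.Quotient (Sig.C k s) (Sig.C k t) :=
  Path.Homotopic.Quotient.mk
    { toFun := fun u => Sig.C k (s + (u : ℝ) * (t - s))
      continuous_toFun := (Sig.continuous_C k).comp (by fun_prop)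
      source' := by simp
      target' := by simp }

end MarkedSurface

/-- The curves used to present the moduli space: a standard generating set `α_i`, `β_i`, `δ_k` of the
fundamental group and the paths `ε_E` from the base point `x` to the boundary intervals `E`. -/
structure CurveSystem [ChartedSpace (EuclideanHalfSpace 2) S] (Sig : MarkedSurface S) (x : S) where
  /-- the genus -/
  genus : ℕ
  α : Fin genus → LoopGroup x
  β : Fin genus → LoopGroup x
  /-- the parameter of the end point of `ε_E` -/
  pos : Sig.Ival → ℝ
  pos_mem : ∀ E, pos E ∈ Set.Ioo (Sig.mark E.1 E.2) (Sig.nextMark E)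
  ε : ∀ E : Sig.Ival, Path.Homotopic.Quotient x (Sig.C E.1 (pos E))
  /-- for two consecutive boundary intervals `E_{j-1}`, `E_j` with `j ≥ 2`, the path `ε_j⁻¹ ε_{j-1}` is
  homotopic to the boundary arc that passes exactly the marked point between them -/
  ε_succ : ∀ (k : Fin Sig.b) (j : ℕ) (h : j + 1 < Sig.N k),
    (ε ⟨k, ⟨j + 1, h⟩⟩).symm.trans (ε ⟨k, ⟨j, Nat.lt_of_succ_lt h⟩⟩) =
      Sig.arc k (pos ⟨k, ⟨j + 1, h⟩⟩) (pos ⟨k, ⟨j, Nat.lt_of_succ_lt h⟩⟩)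
  δ : Fin Sig.b → LoopGroup x
  /-- `δ_k` goes along `ε_1^{(k)}`, once around `∂_k`, and back -/
  δ_eq : ∀ k, δ k = toLoop (((ε (Sig.firstIval k)).trans
    ((Sig.arc k (pos (Sig.firstIval k)) (pos (Sig.firstIval k) + 1)).cast rfl
      (Sig.periodic_C k (pos (Sig.firstIval k))).symm)).trans (ε (Sig.firstIval k)).symm)
  /-- the `α_i`, `β_i`, `δ_k` generate the fundamental group, -/
  generate : Function.Surjective
    (FreeGroup.lift (Sum.elim α (Sum.elim β δ)) :
      FreeGroup (Fin genus ⊕ Fin genus ⊕ Fin Sig.b) →* LoopGroup x)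
  /-- and their relations are the consequences of `[α_1, β_1] ⋯ [α_g, β_g] δ_1 ⋯ δ_b = 1` -/
  relations : (FreeGroup.lift (Sum.elim α (Sum.elim β δ)) :
      FreeGroup (Fin genus ⊕ Fin genus ⊕ Fin Sig.b) →* LoopGroup x).ker =
    Subgroup.normalClosure
      {(List.ofFn fun i : Fin genus =>
          (FreeGroup.of (Sum.inl i) : FreeGroup (Fin genus ⊕ Fin genus ⊕ Fin Sig.b)) *
            FreeGroup.of (Sum.inr (Sum.inl i)) * (FreeGroup.of (Sum.inl i))⁻¹ *
            (FreeGroup.of (Sum.inr (Sum.inl i)))⁻¹).prod *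
        (List.ofFn fun k : Fin Sig.b => FreeGroup.of (Sum.inr (Sum.inr k))).prod}

namespace CurveSystem

variable [ChartedSpace (EuclideanHalfSpace 2) S] {Sig : MarkedSurface S} {x : S}
  (c : CurveSystem Sig x)

/-- Arc classes from `E` to `E'`.  As the boundary intervals are contractible, we may fix the end points
of the arcs to be those of the `ε_E`. -/
abbrev ArcClass (E E' : Sig.Ival) : Type _ :=
  Path.Homotopic.Quotient (Sig.C E.1 (c.pos E)) (Sig.C E'.1 (c.pos E'))

/-- The loop `γ` at `x` with `[c] = ε_E⁻¹ γ ε_{E'}`. -/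
def loopOfArc {E E' : Sig.Ival} (a : c.ArcClass E E') : LoopGroup x :=
  toLoop (((c.ε E).trans a).trans (c.ε E').symm)

/-- The arc class `ε_E⁻¹ ε_{E'}`. -/
def arcEps (E E' : Sig.Ival) : c.ArcClass E E' := (c.ε E).symm.trans (c.ε E')

/-- The boundary interval preceding `E` in the cyclic order of its boundary component. -/
def pred (_ : CurveSystem Sig x) (E : Sig.Ival) : Sig.Ival :=
  if (E.2 : ℕ) = 0 then Sig.lastIval E.1
  else ⟨E.1, ⟨E.2 - 1, lt_of_le_of_lt (Nat.sub_le _ _) E.2.2⟩⟩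

/-- The parameter to which the boundary arc from `E` to its predecessor runs. -/
def predPos (E : Sig.Ival) : ℝ :=
  if (E.2 : ℕ) = 0 then c.pos (Sig.lastIval E.1) - 1
  else c.pos ⟨E.1, ⟨E.2 - 1, lt_of_le_of_lt (Nat.sub_le _ _) E.2.2⟩⟩

theorem predPos_aux (E : Sig.Ival) :
    Sig.C (c.pred E).1 (c.pos (c.pred E)) = Sig.C E.1 (c.predPos E) := by
  unfold pred predPos
  split_ifs with h
  · have := Sig.periodic_C E.1 (c.pos (Sig.lastIval E.1) - 1)
    rw [sub_add_cancel] at this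
    exact this
  · rfl

/-- The class of the boundary arc from `E` to its predecessor, which passes exactly one marked point,
namely the initial point of `E`. -/
def bdryArc (E : Sig.Ival) : c.ArcClass E (c.pred E) :=
  (Sig.arc E.1 (c.pos E) (c.predPos E)).cast rfl (c.predPos_aux E)

end CurveSystem

end Surface

/-! ## The moduli space -/

section Moduli

variable {𝔤 : Type*} [LieRing 𝔤] [LieAlgebra ℂ 𝔤] [FiniteDimensional ℂ 𝔤]
  [LieAlgebra.IsKilling ℂ 𝔤] {𝔥 : LieSubalgebra ℂ 𝔤} [𝔥.IsCartanSubalgebra] (D : Pinned 𝔥)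
  {S : Type*} [TopologicalSpace S] [ChartedSpace (EuclideanHalfSpace 2) S]
  {Sig : MarkedSurface S} {x : S} (c : CurveSystem Sig x)

/-- `Hom(π₁, G) × (G/B⁺)^𝕄 × 𝒫_G^𝔹`. -/
abbrev Ambient (_ : CurveSystem Sig x) : Type _ :=
  (LoopGroup x →* D.G) × (Sig.Ival → D.Flag) × (Sig.Ival → D.Pinning)

/-- `Hom(π₁, G) × G^𝕄 × G^𝔹`, of which the ambient variety is a quotient. -/
abbrev AmbientCover (_ : CurveSystem Sig x) : Type _ :=
  (LoopGroup x →* D.G) × (Sig.Ival → D.G) × (Sig.Ival → D.G)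

/-- The coordinate ring of the affine variety `Hom(π₁, G) × G^𝕄 × G^𝔹`, generated by the matrix entries
of all `ρ(γ)`, of the factors in `G^𝕄`, and of the factors in `G^𝔹`. -/
def coverAlg : Subalgebra ℂ (AmbientCover D c → ℂ) :=
  D.coordAlg (ι := LoopGroup x ⊕ Sig.Ival ⊕ Sig.Ival) fun i y =>
    match i with
    | .inl γ => y.1 γ
    | .inr (.inl m) => y.2.1 m
    | .inr (.inr E) => y.2.2 E

/-- The quotient map, given by `G → G/B⁺` and by the orbit map `G → 𝒫_G`, `g ↦ g.p_std`. -/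
def coverMap (y : AmbientCover D c) : Ambient D c :=
  (y.1, fun m => (y.2.1 m : D.G ⧸ D.B), fun E => y.2.2 E • D.pStd)

/-- The variety structure on `Hom(π₁, G) × (G/B⁺)^𝕄 × 𝒫_G^𝔹`. -/
def ambientSpace : FunctionSpace (Ambient D c) :=
  (FunctionSpace.affine (coverAlg D c)).coinduced (coverMap D c)

/-- The triples `(ρ, λ, φ)` parametrizing the rigidified framed local systems with pinnings: the flags of
the pinning `φ_E` are the flags `λ` at the end points of `E`, where the terminal point of the last
interval of `∂_k` carries the flag `ρ(δ_k).λ` of the first marked point. -/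
def atlasSet : Set (Ambient D c) :=
  {y | ∀ E : Sig.Ival, D.piPlus (y.2.2 E) = y.2.1 E ∧
    D.piMinus (y.2.2 E) =
      if h : (E.2 : ℕ) + 1 < Sig.N E.1 then y.2.1 ⟨E.1, ⟨E.2 + 1, h⟩⟩
      else y.1 (c.δ E.1) • y.2.1 (Sig.firstIval E.1)}

/-- The atlas `P_{G,Σ}`. -/
abbrev Atlas : Type _ := ↥(atlasSet D c)

/-- The variety structure on the atlas. -/
def atlasSpace : FunctionSpace (Atlas D c) := (ambientSpace D c).induced Subtype.val

theorem conj_smul_aux (g h : D.G) (F : D.Flag) : (g * h * g⁻¹) • g • F = g • h • F := by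
  simp [mul_smul]

/-- `G` acts on the atlas by `(ρ, λ, φ) ↦ (g ρ g⁻¹, g.λ, g.φ)`. -/
instance : MulAction D.G (Atlas D c) where
  smul g y := ⟨((MulAut.conj g).toMonoidHom.comp y.1.1, fun m => g • y.1.2.1 m,
      fun E => g • y.1.2.2 E), by
    intro E
    have h := y.2 E
    have h1 : D.piPlus (g • y.1.2.2 E) = g • D.piPlus (y.1.2.2 E) := D.toFlag_smul_aux g _
    have h2 : D.piMinus (g • y.1.2.2 E) = g • D.piMinus (y.1.2.2 E) := rfl
    refine ⟨?_, ?_⟩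
    · change D.piPlus (g • y.1.2.2 E) = _
      rw [h1, h.1]
    · change D.piMinus (g • y.1.2.2 E) = _
      rw [h2, h.2]
      split_ifs
      · rfl
      · exact (conj_smul_aux D g _ _).symm⟩
  one_smul y := by
    refine Subtype.ext (Prod.ext ?_ (Prod.ext ?_ ?_))
    · ext γ : 1
      change (1 : D.G) * y.1.1 γ * (1 : D.G)⁻¹ = y.1.1 γ
      simp
    · funext m
      exact one_smul D.G (y.1.2.1 m)
    · funext E
      exact one_smul D.G (y.1.2.2 E)
  mul_smul g h y := by
    refine Subtype.ext (Prod.ext ?_ (Prod.ext ?_ ?_))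
    · ext γ : 1
      change (g * h) * y.1.1 γ * (g * h)⁻¹ = g * (h * y.1.1 γ * h⁻¹) * g⁻¹
      group
    · funext m
      exact mul_smul g h (y.1.2.1 m)
    · funext E
      exact mul_smul g h (y.1.2.2 E)

/-- The moduli space `𝒫_{G,Σ}`, the quotient of the atlas by `G`. -/
abbrev Moduli : Type _ := MulAction.orbitRel.Quotient D.G (Atlas D c)

/-- The projection from the atlas to the moduli space. -/
def toModuli (y : Atlas D c) : Moduli D c := Quotient.mk _ y

/-- The structure of the moduli space as a quotient; its regular functions are the invariant regular
functions on the atlas. -/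
def moduliSpace : FunctionSpace (Moduli D c) := (atlasSpace D c).coinduced (toModuli D c)

/-! ### Wilson lines -/

variable {D c}

/-- The element `g_E` with `φ_E = g_E.p_std`. -/
def gE (y : Atlas D c) (E : Sig.Ival) : D.G := D.elt (y.1.2.2 E)

/-- The Wilson line `g_E⁻¹ ρ(γ) g_{E'} w̄₀` along the arc class `ε_E⁻¹ γ ε_{E'}`. -/
def wilsonLine {E E' : Sig.Ival} (a : c.ArcClass E E') (y : Atlas D c) : D.G :=
  (gE y E)⁻¹ * y.1.1 (c.loopOfArc a) * gE y E' * D.w0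

/-- The monodromy `ρ_{E_0}(γ) = g_0⁻¹ ρ(γ) g_0`. -/
def monodromy (γ : LoopGroup x) (y : Atlas D c) : D.G :=
  (gE y Sig.E0)⁻¹ * y.1.1 γ * gE y Sig.E0

variable (D c)

/-- The index set of the monodromies: `α_i`, `β_i`, `δ_k`. -/
abbrev GenIndex : Type := Fin c.genus ⊕ Fin c.genus ⊕ Fin Sig.b

/-- The boundary components other than the first one. -/
abbrev OtherIndex (_ : CurveSystem Sig x) : Type := {k : Fin Sig.b // k ≠ Sig.k0}

/-- The target `G^{2g+b} × G^{b-1} × (B⁺)^{∑ N_k}`. -/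
abbrev Target : Type _ :=
  (GenIndex c → D.G) × (OtherIndex c → D.G) × (Sig.Ival → D.B)

/-- The coordinate ring of the target, generated by the matrix entries of all factors. -/
def targetAlg : Subalgebra ℂ (Target D c → ℂ) :=
  D.coordAlg (ι := GenIndex c ⊕ OtherIndex c ⊕ Sig.Ival) fun i z =>
    match i with
    | .inl i => z.1 i
    | .inr (.inl k) => z.2.1 k
    | .inr (.inr E) => (z.2.2 E).1

/-- The coordinate ring of `Target × G`. -/
def targetProdAlg : Subalgebra ℂ (Target D c × D.G → ℂ) :=
  D.coordAlg (ι := (GenIndex c ⊕ OtherIndex c ⊕ Sig.Ival) ⊕ Unit) fun i z =>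
    match i with
    | .inl (.inl i) => z.1.1 i
    | .inl (.inr (.inl k)) => z.1.2.1 k
    | .inl (.inr (.inr E)) => (z.1.2.2 E).1
    | .inr _ => z.2

/-- The generators `α_i`, `β_i`, `δ_k`. -/
def genLoop : GenIndex c → LoopGroup x := Sum.elim c.α (Sum.elim c.β c.δ)

variable {D c}

open Classical in
/-- The tuple of monodromies `ρ_{E_0}(α_i)`, `ρ_{E_0}(β_i)`, `ρ_{E_0}(δ_k)`, of Wilson lines
`g^{(k)}` from `E_0` to `E_{N_k}^{(k)}`, `k ≥ 2`, and of boundary Wilson lines `g_{j,j-1}^{(k)}`.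
(The latter lie in `B⁺`; this is a part of the theorem, and `1` is a dummy value.) -/
def phiTuple (y : Atlas D c) : Target D c :=
  (fun i => monodromy (genLoop c i) y,
   fun k => wilsonLine (c.arcEps Sig.E0 (Sig.lastIval k.1)) y,
   fun E => if h : wilsonLine (c.bdryArc E) y ∈ D.B then ⟨wilsonLine (c.bdryArc E) y, h⟩ else 1)

/-- The presentation `Φ̃_{E_0}` of `Φ_{E_0}`, with the last component `g_0`. -/
def phiTilde (y : Atlas D c) : Target D c × D.G := (phiTuple y, gE y Sig.E0)

variable (D c)

/-- The map `Φ_{E_0}` on the moduli space, computed on representatives. -/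
def phi (P : Moduli D c) : Target D c := phiTuple (Quotient.out P)

/-! ### The relations -/

/-- `∏ a_i b_i a_i' b_i' · ∏ d_k`, where `a'`, `b'` stand for the inverses of `a`, `b`. -/
def monodromyWord {M : Type*} [Monoid M] {g b : ℕ} (a a' β β' : Fin g → M) (d : Fin b → M) : M :=
  (List.ofFn fun i => a i * β i * a' i * β' i).prod * (List.ofFn d).prod

/-- `(u_N w) (u_{N-1} w) ⋯ (u_2 w) (u_1 w)`. -/
def bdryWord {M : Type*} [Monoid M] {N : ℕ} (w : M) (u : Fin N → M) : M :=
  (List.ofFn fun j => u j * w).reverse.prod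

/-- `(u_1 w) (u_N w) (u_{N-1} w) ⋯ (u_2 w)`. -/
def bdryWordFirst {M : Type*} [Monoid M] {N : ℕ} (w : M) (u : Fin N → M) : M :=
  ((List.ofFn fun j => u j * w).rotate 1).reverse.prod

/-- The locus in the target cut out by
* the monodromy relation `∏ [ρ(α_i), ρ(β_i)] ∏ ρ(δ_k) = 1`;
* the boundary relation of the first boundary component,
  `(g_{1,N} w̄₀) (g_{N,N-1} w̄₀) ⋯ (g_{2,1} w̄₀) = ρ(δ_1)⁻¹`;
* the boundary relations of the other boundary components,
  `(g^{(k)} w̄₀) · (g_{N,N-1} w̄₀) ⋯ (g_{2,1} w̄₀) (g_{1,N} w̄₀) · (g^{(k)} w̄₀)⁻¹ = ρ(δ_k)⁻¹`. -/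
def relationLocus : Set (Target D c) :=
  {z | monodromyWord (fun i => z.1 (.inl i)) (fun i => (z.1 (.inl i))⁻¹)
        (fun i => z.1 (.inr (.inl i))) (fun i => (z.1 (.inr (.inl i)))⁻¹)
        (fun k => z.1 (.inr (.inr k))) = 1 ∧
      bdryWordFirst D.w0 (fun j => (z.2.2 ⟨Sig.k0, j⟩).1) = (z.1 (.inr (.inr Sig.k0)))⁻¹ ∧
      ∀ k : OtherIndex c,
        (z.2.1 k * D.w0) * bdryWord D.w0 (fun j => (z.2.2 ⟨k.1, j⟩).1) * (z.2.1 k * D.w0)⁻¹ =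
          (z.1 (.inr (.inr k.1)))⁻¹}

/-- `𝒪(G)^{⊗(2g+b)}`. -/
def GenTensor : Type _ := ⨂[ℂ] _ : GenIndex c, D.OG

/-- `𝒪(G)^{⊗(b-1)}`. -/
def OtherTensor : Type _ := ⨂[ℂ] _ : OtherIndex c, D.OG

/-- `𝒪(B⁺)^{⊗ ∑ N_k}`. -/
def IvalTensor (_ : CurveSystem Sig x) : Type _ := ⨂[ℂ] _ : Sig.Ival, D.OB

instance : CommRing (GenTensor D c) := inferInstanceAs (CommRing (⨂[ℂ] _ : GenIndex c, D.OG))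
instance : Algebra ℂ (GenTensor D c) := inferInstanceAs (Algebra ℂ (⨂[ℂ] _ : GenIndex c, D.OG))
instance : CommRing (OtherTensor D c) := inferInstanceAs (CommRing (⨂[ℂ] _ : OtherIndex c, D.OG))
instance : Algebra ℂ (OtherTensor D c) :=
  inferInstanceAs (Algebra ℂ (⨂[ℂ] _ : OtherIndex c, D.OG))
instance : CommRing (IvalTensor D c) := inferInstanceAs (CommRing (⨂[ℂ] _ : Sig.Ival, D.OB))
instance : Algebra ℂ (IvalTensor D c) := inferInstanceAs (Algebra ℂ (⨂[ℂ] _ : Sig.Ival, D.OB))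

/-- The algebra `𝒪(G)^{⊗(2g+b)} ⊗ 𝒪(G)^{⊗(b-1)} ⊗ 𝒪(B⁺)^{⊗ ∑ N_k}`. -/
abbrev TensorAlg : Type _ := GenTensor D c ⊗[ℂ] OtherTensor D c ⊗[ℂ] IvalTensor D c

/-- The inclusion of a tensor factor of the first group. -/
def inclGen (i : GenIndex c) : D.OG →ₐ[ℂ] TensorAlg D c :=
  let h : D.OG →ₐ[ℂ] GenTensor D c :=
    PiTensorProduct.singleAlgHom (R := ℂ) (A := fun _ : GenIndex c => D.OG) i
  (Algebra.TensorProduct.includeLeft.comp Algebra.TensorProduct.includeLeft).comp h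

/-- The inclusion of a tensor factor of the second group. -/
def inclOther (k : OtherIndex c) : D.OG →ₐ[ℂ] TensorAlg D c :=
  let h : D.OG →ₐ[ℂ] OtherTensor D c :=
    PiTensorProduct.singleAlgHom (R := ℂ) (A := fun _ : OtherIndex c => D.OG) k
  (Algebra.TensorProduct.includeLeft.comp Algebra.TensorProduct.includeRight).comp h

/-- The inclusion of a tensor factor of the third group. -/
def inclIval (E : Sig.Ival) : D.OB →ₐ[ℂ] TensorAlg D c :=
  let h : D.OB →ₐ[ℂ] IvalTensor D c :=
    PiTensorProduct.singleAlgHom (R := ℂ) (A := fun _ : Sig.Ival => D.OB) E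
  Algebra.TensorProduct.includeRight.comp h

/-- Matrices over the tensor product algebra. -/
abbrev TMat : Type _ := Matrix (Fin D.dim) (Fin D.dim) (TensorAlg D c)

/-- The universal element of a factor of the first group, as a matrix. -/
def uGen (i : GenIndex c) : TMat D c := Matrix.of fun p q => inclGen D c i (D.entryG p q)

/-- The inverse of `uGen`. -/
def uGenInv (i : GenIndex c) : TMat D c := Matrix.of fun p q => inclGen D c i (D.entryInvG p q)

/-- The universal element of a factor of the second group, as a matrix. -/
def uOther (k : OtherIndex c) : TMat D c := Matrix.of fun p q => inclOther D c k (D.entryG p q)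

/-- The inverse of `uOther`. -/
def uOtherInv (k : OtherIndex c) : TMat D c :=
  Matrix.of fun p q => inclOther D c k (D.entryInvG p q)

/-- The universal element of a factor of the third group, as a matrix. -/
def uIval (E : Sig.Ival) : TMat D c := Matrix.of fun p q => inclIval D c E (D.entryB p q)

/-- A fixed element of `G` as a constant matrix. -/
def constMat (g : D.G) : TMat D c := Matrix.of fun p q => algebraMap ℂ _ (D.entry p q g)

/-- The ideal generated by the monodromy relation and the boundary relations, that is by the matrix
entries of the differences of their two sides. -/
def relationIdeal : Ideal (TensorAlg D c) :=
  Ideal.span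
    ({t | ∃ p q, t = (monodromyWord (fun i => uGen D c (.inl i)) (fun i => uGenInv D c (.inl i))
          (fun i => uGen D c (.inr (.inl i))) (fun i => uGenInv D c (.inr (.inl i)))
          (fun k => uGen D c (.inr (.inr k))) - 1) p q} ∪
     {t | ∃ p q, t = (bdryWordFirst (constMat D c D.w0) (fun j => uIval D c ⟨Sig.k0, j⟩) -
          uGenInv D c (.inr (.inr Sig.k0))) p q} ∪
     {t | ∃ (k : OtherIndex c) (p q : Fin D.dim),
        t = ((uOther D c k * constMat D c D.w0) *
          bdryWord (constMat D c D.w0) (fun j => uIval D c ⟨k.1, j⟩) *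
          (constMat D c D.w0⁻¹ * uOtherInv D c k) - uGenInv D c (.inr (.inr k.1))) p q})

/-- The matrix coefficients of all Wilson lines, as functions on the moduli space. -/
def wilsonCoefficients : Set (Moduli D c → ℂ) :=
  {F | ∃ (E E' : Sig.Ival) (a : c.ArcClass E E') (m : D.G → ℂ), D.IsMatrixCoefficient m ∧
    F = fun P => m (wilsonLine a (Quotient.out P))}

/-- The matrix coefficients of the components of `Φ_{E_0}`, as functions on the moduli space. -/
def phiCoefficients : Set (Moduli D c → ℂ) :=
  {F | ∃ m : D.G → ℂ, D.IsMatrixCoefficient m ∧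
    ((∃ i, F = fun P => m ((phi D c P).1 i)) ∨ (∃ k, F = fun P => m ((phi D c P).2.1 k)) ∨
      ∃ E, F = fun P => m ((phi D c P).2.2 E).1)}

end Moduli

end WilsonLines

end

/-! Everything is expressed through frames. Since `G` acts simply transitively on pinnings, a
pinning `φ_E` is the same as an element `g_E`, and the flag at the initial point of `E` is then
`g_E.B⁺`. So a point of the atlas amounts to `ρ` and the `g_E`, subject to the incidence conditions
at the terminal points, and each of these conditions says exactly that one boundary Wilson line lies
in `B⁺`.

Because `w̄₀² = 1`, the element `g_{j,j-1} w̄₀` is `g_j⁻¹ g_{j-1}`, with a factor `ρ(δ_k)⁻¹` in the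
middle when the arc closes up at the first marked point. Products of Wilson lines therefore
telescope. They recover every `g_E` from `g_0` and the tuple (`gE_eq_frame`), and one full turn
around `∂_k` is the boundary relation. The loops `α_i`, `β_i`, `δ_k` present the fundamental group
by a single relation, so the monodromies only have to satisfy the monodromy relation. Conversely, a
tuple in the locus and any `g_0` define frames and a homomorphism that satisfy all incidence
conditions (`exists_of_mem_relationLocus`). Both directions consist of products and inverses in `G`,
so the coordinate rings match as well. This gives the closed embedding of the atlas, and the slice
`g_0 = 1` gives that of the quotient.

Two facts about `G` carry the argument. Simple transitivity (`existsUnique_smul_pStd`) follows from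
`B⁺ = H U⁺` and from `U⁺ ∩ B⁻ = 1`, which is read off the grading of the Lie algebra by root height.
For `w̄₀² = 1` (`w0_mul_w0`), the braid relations for the `r̄_s` and Matsumoto's theorem make `w̄₀`
independent of the reduced word. Comparing a word with its reverse shows that `w̄₀²` is `exp (2πi ad
ρ^∨)`, where every simple root is `1` on `ρ^∨`, and this is trivial in the adjoint group.

The corollary is the Nullstellensatz. It needs that every point of `𝒪(G)` or `𝒪(B⁺)` is an actual
group element (`exists_point`); this is obtained from Chevalley's theorem, since both groups are
covered by images of tori. A regular function on the moduli space is only locally a fraction, but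
its ideal of denominators has no common zero, hence is the whole ring (`exists_tensor_eq`). -/

noncomputable section

set_option linter.unusedSectionVars false

namespace WilsonLines

open LieAlgebra LieAlgebra.IsKilling

/-! ### Exponentials of nilpotent endomorphisms and the action of the adjoint group -/

section Exponential

variable {V : Type*} [AddCommGroup V] [Module ℂ V]

theorem expEnd_eq_exp [Module ℚ (Module.End ℂ V)] (A : Module.End ℂ V) :
    expEnd A = IsNilpotent.exp A := by
  unfold expEnd IsNilpotent.exp
  refine Finset.sum_congr rfl fun k _ => ?_
  have := inv_natCast_smul_eq (R := ℂ) (S := ℚ) (E := Module.End ℂ V) k.factorial (A ^ k)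
  exact this

/-- Beyond the smaller of `n` and the nilpotency class all terms vanish on `v`, so both truncations
agree. This permits computing with the length of the string through `v` alone. -/
theorem expEnd_apply {A : Module.End ℂ V} (hA : IsNilpotent A) {n : ℕ} {v : V}
    (h : (A ^ n) v = 0) :
    expEnd A v = ∑ k ∈ Finset.range n, ((k.factorial : ℂ)⁻¹) • (A ^ k) v := by
  have hz : ∀ k, min n (nilpotencyClass A) ≤ k → (A ^ k) v = 0 := by
    intro k hk
    rcases min_le_iff.1 hk with hk | hk
    · exact Module.End.pow_map_zero_of_le hk h
    · rw [pow_eq_zero_of_le hk (pow_nilpotencyClass hA)]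
      rfl
  have hs : ∀ m, min n (nilpotencyClass A) ≤ m →
      ∑ k ∈ Finset.range m, ((k.factorial : ℂ)⁻¹) • (A ^ k) v =
        ∑ k ∈ Finset.range (min n (nilpotencyClass A)), ((k.factorial : ℂ)⁻¹) • (A ^ k) v := by
    intro m hm
    refine (Finset.sum_subset (Finset.range_mono hm) fun k _ hk => ?_).symm
    rw [hz k (by simpa only [Finset.mem_range, not_lt] using hk), smul_zero]
  rw [hs n (min_le_left _ _), ← hs _ (min_le_right _ _), expEnd, LinearMap.sum_apply]
  rfl

theorem expEnd_zero : expEnd (0 : Module.End ℂ V) = 1 := by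
  ext v
  rw [expEnd_apply (n := 1) IsNilpotent.zero (by simp)]
  simp

theorem expEnd_add {A B : Module.End ℂ V} (h : Commute A B) (hA : IsNilpotent A)
    (hB : IsNilpotent B) : expEnd (A + B) = expEnd A * expEnd B := by
  let _ : Module ℚ (Module.End ℂ V) := Module.compHom _ (algebraMap ℚ ℂ)
  rw [expEnd_eq_exp, expEnd_eq_exp, expEnd_eq_exp, IsNilpotent.exp_add_of_commute h hA hB]

end Exponential

section LieHom

variable {𝔤 : Type*} [LieRing 𝔤] [LieAlgebra ℂ 𝔤] [FiniteDimensional ℂ 𝔤]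

theorem expEnd_ad_lie {x : 𝔤} (hx : IsNilpotent (ad ℂ 𝔤 x)) (y z : 𝔤) :
    expEnd (ad ℂ 𝔤 x) ⁅y, z⁆ = ⁅expEnd (ad ℂ 𝔤 x) y, expEnd (ad ℂ 𝔤 x) z⁆ := by
  let _ : Module ℚ 𝔤 := Module.compHom _ (algebraMap ℚ ℂ)
  let _ : LieAlgebra ℚ 𝔤 := { lie_smul := fun t y z => lie_smul (algebraMap ℚ ℂ t) y z }
  have e : (LieDerivation.ad ℂ 𝔤 x).toLinearMap = ad ℂ 𝔤 x :=
    LieDerivation.coe_ad_apply_eq_ad_apply x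
  have h : IsNilpotent (LieDerivation.ad ℂ 𝔤 x).toLinearMap := by rwa [e]
  rw [expEnd_eq_exp, ← e]
  exact ((LieDerivation.ad ℂ 𝔤 x).exp h).map_lie y z

end LieHom

section Cartan

variable {𝔤 : Type*} [LieRing 𝔤] [LieAlgebra ℂ 𝔤] [FiniteDimensional ℂ 𝔤]
  [LieAlgebra.IsKilling ℂ 𝔤] {𝔥 : LieSubalgebra ℂ 𝔤} [𝔥.IsCartanSubalgebra]

/-- For a nondegenerate Killing form the Cartan subalgebra acts semisimply, so generalized weight
vectors are honest eigenvectors. -/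
theorem mem_rootSpace_iff {χ : 𝔥 → ℂ} {x : 𝔤} :
    x ∈ rootSpace 𝔥 χ ↔ ∀ h : 𝔥, ⁅(h : 𝔤), x⁆ = χ h • x := by
  refine ⟨fun hx h => lie_eq_smul_of_mem_rootSpace hx h, fun hx => ?_⟩
  exact LieModule.weightSpace_le_genWeightSpace 𝔤 χ ((LieModule.mem_weightSpace χ x).2 hx)

theorem cartan_lie_cartan (h h' : 𝔥) : ⁅(h : 𝔤), (h' : 𝔤)⁆ = 0 := by
  have := trivial_lie_zero 𝔥 𝔥 h h'
  exact congrArg Subtype.val this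

theorem lie_mem_rootSpace {χ ψ : 𝔥 → ℂ} {x y : 𝔤} (hx : x ∈ rootSpace 𝔥 χ)
    (hy : y ∈ rootSpace 𝔥 ψ) : ⁅x, y⁆ ∈ rootSpace 𝔥 (χ + ψ) :=
  lie_mem_genWeightSpace_of_mem_genWeightSpace hx hy

/-- A linear property that holds on the Cartan subalgebra and on the root spaces holds everywhere. -/
theorem forall_of_rootSpaces (p : Submodule ℂ 𝔤) (h0 : ∀ h : 𝔥, (h : 𝔤) ∈ p)
    (h1 : ∀ α : 𝔥.root, ∀ x ∈ rootSpace 𝔥 (α.1 : 𝔥 → ℂ), x ∈ p) (x : 𝔤) : x ∈ p := by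
  have hx : x ∈ ⨆ χ : LieModule.Weight ℂ 𝔥 𝔤, (rootSpace 𝔥 (χ : 𝔥 → ℂ)).toSubmodule := by
    have := LieModule.iSup_genWeightSpace_eq_top' ℂ 𝔥 𝔤
    rw [← LieSubmodule.toSubmodule_inj, LieSubmodule.iSup_toSubmodule] at this
    rw [this]
    trivial
  refine (iSup_le fun χ => ?_ : _ ≤ p) hx
  intro y hy
  by_cases hχ : χ.IsZero
  · have : y ∈ rootSpace 𝔥 (0 : 𝔥 → ℂ) := by rw [← hχ.eq]; exact hy
    rw [rootSpace_zero_eq] at this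
    exact h0 ⟨y, this⟩
  · exact h1 ⟨χ, by simpa using hχ⟩ y hy

/-- The elements of the adjoint group act by automorphisms of the Lie algebra. -/
theorem adjointGroup_smul_lie (g : adjointGroup 𝔥) (x y : 𝔤) : g • ⁅x, y⁆ = ⁅g • x, g • y⁆ := by
  obtain ⟨g, hg⟩ := g
  change g • ⁅x, y⁆ = ⁅g • x, g • y⁆
  induction hg using Subgroup.closure_induction generalizing x y with
  | mem g hg =>
    obtain ⟨α, z, hz, e⟩ := hg
    have := expEnd_ad_lie (LieAlgebra.isNilpotent_ad_of_mem_rootSpace 𝔥 (root_ne_zero_aux α) hz) x y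
    rw [← e] at this
    exact this
  | one => simp
  | mul a b _ _ ha hb => rw [mul_smul, hb, ha, mul_smul, mul_smul]
  | inv a _ ha => rw [inv_smul_eq_iff, ha, smul_inv_smul, smul_inv_smul]

theorem adjointGroup_smul_add (g : adjointGroup 𝔥) (x y : 𝔤) : g • (x + y) = g • x + g • y :=
  smul_add g x y

theorem adjointGroup_smul_smul (g : adjointGroup 𝔥) (c : ℂ) (x : 𝔤) : g • (c • x) = c • g • x :=
  smul_comm g c x

theorem adjointGroup_ext {g g' : adjointGroup 𝔥} (h : ∀ x : 𝔤, g • x = g' • x) : g = g' := by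
  refine Subtype.ext (Units.ext (LinearMap.ext fun x => ?_))
  exact h x

theorem isNilpotent_ad_smul (g : adjointGroup 𝔥) {x : 𝔤} (hx : IsNilpotent (ad ℂ 𝔤 x)) :
    IsNilpotent (ad ℂ 𝔤 (g • x)) ∧ ∀ (k : ℕ) (v : 𝔤),
      (ad ℂ 𝔤 (g • x) ^ k) (g • v) = g • (ad ℂ 𝔤 x ^ k) v := by
  have key : ∀ (k : ℕ) (v : 𝔤), (ad ℂ 𝔤 (g • x) ^ k) (g • v) = g • (ad ℂ 𝔤 x ^ k) v := by
    intro k v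
    induction k with
    | zero => rfl
    | succ k ih =>
      rw [pow_succ', pow_succ', Module.End.mul_apply, Module.End.mul_apply, ih, ad_apply, ad_apply,
        adjointGroup_smul_lie]
  refine ⟨?_, key⟩
  obtain ⟨n, hn⟩ := hx
  refine ⟨n, LinearMap.ext fun v => ?_⟩
  rw [← smul_inv_smul g v, key, hn]
  simp

theorem expEnd_ad_smul (g : adjointGroup 𝔥) {x : 𝔤} (hx : IsNilpotent (ad ℂ 𝔤 x)) (v : 𝔤) :
    expEnd (ad ℂ 𝔤 (g • x)) (g • v) = g • expEnd (ad ℂ 𝔤 x) v := by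
  obtain ⟨h1, h2⟩ := isNilpotent_ad_smul g hx
  obtain ⟨n, hn⟩ := hx
  have h3 : (ad ℂ 𝔤 x ^ n) v = 0 := by rw [hn]; rfl
  rw [expEnd_apply ⟨n, hn⟩ h3, expEnd_apply h1 (by rw [h2, h3, smul_zero]), Finset.smul_sum]
  refine Finset.sum_congr rfl fun k _ => ?_
  rw [h2, adjointGroup_smul_smul]

/-- The one-parameter element `exp (ad x)` for a root vector `x`. -/
def rootExp {α : 𝔥.root} {x : 𝔤} (hx : x ∈ rootSpace 𝔥 (α.1 : 𝔥 → ℂ)) : adjointGroup 𝔥 :=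
  ⟨expUnit (ad ℂ 𝔤 x) (LieAlgebra.isNilpotent_ad_of_mem_rootSpace 𝔥 (root_ne_zero_aux α) hx),
    Subgroup.subset_closure ⟨α, x, hx, rfl⟩⟩

end Cartan

end WilsonLines

end

/-! ### Action of a simple `SL₂` on strings of root vectors -/

noncomputable section

set_option linter.unusedSectionVars false

namespace WilsonLines

open LieAlgebra LieAlgebra.IsKilling

section Sl2

variable {𝔤 : Type*} [LieRing 𝔤] [LieAlgebra ℂ 𝔤] [FiniteDimensional ℂ 𝔤]

theorem expEnd_ad_smul_apply {x : 𝔤} (hx : IsNilpotent (ad ℂ 𝔤 x)) (c : ℂ) {n : ℕ} {v : 𝔤}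
    (h : (ad ℂ 𝔤 x ^ n) v = 0) :
    expEnd (ad ℂ 𝔤 (c • x)) v =
      ∑ k ∈ Finset.range n, (c ^ k * (k.factorial : ℂ)⁻¹) • (ad ℂ 𝔤 x ^ k) v := by
  have hp : ∀ k : ℕ, (ad ℂ 𝔤 (c • x)) ^ k = c ^ k • (ad ℂ 𝔤 x) ^ k := by
    intro k
    rw [map_smul, smul_pow]
  have hn : IsNilpotent (ad ℂ 𝔤 (c • x)) := by
    obtain ⟨m, hm⟩ := hx
    exact ⟨m, by rw [hp, hm, smul_zero]⟩
  rw [expEnd_apply hn (n := n) (by rw [hp, LinearMap.smul_apply, h, smul_zero])]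
  refine Finset.sum_congr rfl fun k _ => ?_
  rw [hp, LinearMap.smul_apply, smul_smul, mul_comm]

variable {h e f : 𝔤}

/-- A lowest weight vector is primitive for the reversed triple `t.symm`, in which `e` and `f` trade
places. -/
theorem pow_ad_lowest_eq_zero (t : IsSl2Triple h e f) {v : 𝔤} {a : ℕ} (hf : ⁅f, v⁆ = 0)
    (hv : ⁅h, v⁆ = -(a : ℂ) • v) : (ad ℂ 𝔤 e ^ (a + 1)) v = 0 := by
  by_cases h0 : v = 0
  · simp [h0]
  have P : t.symm.HasPrimitiveVectorWith v (a : ℂ) := ⟨h0, by rw [neg_lie, hv]; simp, hf⟩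
  exact P.pow_toEnd_f_eq_zero_of_eq_nat rfl

theorem pow_ad_lowest_descend (t : IsSl2Triple h e f) {v : 𝔤} {a : ℕ} (hf : ⁅f, v⁆ = 0)
    (hv : ⁅h, v⁆ = -(a : ℂ) • v) (j : ℕ) (hj : j ≤ a) :
    (ad ℂ 𝔤 f ^ j) ((ad ℂ 𝔤 e ^ a) v) =
      ((j.factorial : ℂ) * a.factorial * ((a - j).factorial : ℂ)⁻¹) • (ad ℂ 𝔤 e ^ (a - j)) v := by
  by_cases h0 : v = 0
  · simp [h0]
  have P : t.symm.HasPrimitiveVectorWith v (a : ℂ) := ⟨h0, by rw [neg_lie, hv]; simp, hf⟩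
  induction j with
  | zero =>
    have : (a.factorial : ℂ) ≠ 0 := by exact_mod_cast a.factorial_ne_zero
    simp [this]
  | succ j ih =>
    obtain ⟨m, rfl⟩ := Nat.exists_eq_add_of_le hj
    have e1 : j + 1 + m - j = m + 1 := by omega
    have e2 : j + 1 + m - (j + 1) = m := by omega
    have key := P.lie_e_pow_succ_toEnd_f m
    change ⁅f, (ad ℂ 𝔤 e ^ (m + 1)) v⁆ = _ • (ad ℂ 𝔤 e ^ m) v at key
    rw [pow_succ', Module.End.mul_apply, ih (by omega), map_smul, e1, e2, ad_apply, key, smul_smul]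
    congr 1
    have : (m.factorial : ℂ) ≠ 0 := by exact_mod_cast m.factorial_ne_zero
    have : (m + 1 : ℂ) ≠ 0 := by exact_mod_cast m.succ_ne_zero
    rw [Nat.factorial_succ j, Nat.factorial_succ m]
    push_cast
    field_simp
    ring

/-- In the string through a lowest weight vector, the two root homomorphisms meet. -/
theorem expEnd_lowest (t : IsSl2Triple h e f) (he : IsNilpotent (ad ℂ 𝔤 e))
    (hfn : IsNilpotent (ad ℂ 𝔤 f)) {v : 𝔤} {a : ℕ} (hf : ⁅f, v⁆ = 0)
    (hv : ⁅h, v⁆ = -(a : ℂ) • v) (τ : ℂ) (hτ : τ ≠ 0) :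
    expEnd (ad ℂ 𝔤 (τ • e)) v =
      (τ ^ a * (a.factorial : ℂ)⁻¹) • expEnd (ad ℂ 𝔤 (τ⁻¹ • f)) ((ad ℂ 𝔤 e ^ a) v) := by
  have h0 : (ad ℂ 𝔤 f ^ (a + 1)) ((ad ℂ 𝔤 e ^ a) v) = 0 := by
    rw [pow_succ', Module.End.mul_apply, pow_ad_lowest_descend t hf hv a le_rfl]
    simp [hf]
  -- The power `f ^ j` applied to the top vector is a multiple of `e ^ (a - j)` applied to `v`, so
  -- the two series match after one of them is read backwards.
  rw [expEnd_ad_smul_apply he _ (pow_ad_lowest_eq_zero t hf hv), expEnd_ad_smul_apply hfn _ h0,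
    ← Finset.sum_range_reflect, Finset.smul_sum]
  refine Finset.sum_congr rfl fun j hj => ?_
  have hj' : j ≤ a := by simpa [Nat.lt_succ_iff] using hj
  obtain ⟨m, rfl⟩ := Nat.exists_eq_add_of_le hj'
  rw [pow_ad_lowest_descend t hf hv j hj', smul_smul, smul_smul]
  have e1 : j + m + 1 - 1 - j = m := by omega
  have e2 : j + m - j = m := by omega
  rw [e1, e2]
  congr 1
  have : (m.factorial : ℂ) ≠ 0 := by exact_mod_cast m.factorial_ne_zero
  have : (j.factorial : ℂ) ≠ 0 := by exact_mod_cast j.factorial_ne_zero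
  have : ((j + m).factorial : ℂ) ≠ 0 := by exact_mod_cast (j + m).factorial_ne_zero
  field_simp
  rw [pow_add]
  field_simp
  rw [← mul_pow, mul_one_div_cancel hτ, one_pow]

theorem expEnd_ad_of_lie_eq_zero {x v : 𝔤} (hx : IsNilpotent (ad ℂ 𝔤 x)) (c : ℂ)
    (h : ⁅x, v⁆ = 0) : expEnd (ad ℂ 𝔤 (c • x)) v = v := by
  rw [expEnd_ad_smul_apply hx c (n := 1) (by simpa using h)]
  simp

end Sl2

namespace Pinned

variable {𝔤 : Type*} [LieRing 𝔤] [LieAlgebra ℂ 𝔤] [FiniteDimensional ℂ 𝔤]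
  [LieAlgebra.IsKilling ℂ 𝔤] {𝔥 : LieSubalgebra ℂ 𝔤} [𝔥.IsCartanSubalgebra] (D : Pinned 𝔥)

/-- The simple coroot. -/
def hRoot (s : D.base.support) : 𝔥 := (rootSystem 𝔥).coroot s.1

/-- The simple root. -/
def aRoot (s : D.base.support) : Module.Dual ℂ 𝔥 := (rootSystem 𝔥).root s.1

theorem aRoot_apply (s : D.base.support) (h : 𝔥) : D.aRoot s h = (s.1 : 𝔥.root).1 h := rfl

theorem sl2' (s : D.base.support) : IsSl2Triple (D.hRoot s : 𝔤) (D.e s) (D.f s) := D.sl2 s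

theorem aRoot_hRoot (s : D.base.support) : D.aRoot s (D.hRoot s) = 2 :=
  (rootSystem 𝔥).root_coroot_two s.1

theorem nil_e (s : D.base.support) : IsNilpotent (ad ℂ 𝔤 (D.e s)) :=
  LieAlgebra.isNilpotent_ad_of_mem_rootSpace 𝔥 (root_ne_zero_aux s.1) (D.e_mem s)

theorem nil_f (s : D.base.support) : IsNilpotent (ad ℂ 𝔤 (D.f s)) :=
  LieAlgebra.isNilpotent_ad_of_mem_rootSpace 𝔥 (neg_ne_zero.mpr (root_ne_zero_aux s.1)) (D.f_mem s)

theorem xRoot_smul (s : D.base.support) (t : ℂ) (v : 𝔤) :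
    D.xRoot s t • v = expEnd (ad ℂ 𝔤 (t • D.e s)) v := rfl

theorem yRoot_smul (s : D.base.support) (t : ℂ) (v : 𝔤) :
    D.yRoot s t • v = expEnd (ad ℂ 𝔤 (t • D.f s)) v := rfl

theorem xRoot_zero (s : D.base.support) : D.xRoot s 0 = 1 := by
  refine adjointGroup_ext fun v => ?_
  rw [xRoot_smul, zero_smul, map_zero, expEnd_zero, one_smul]
  rfl

theorem yRoot_zero (s : D.base.support) : D.yRoot s 0 = 1 := by
  refine adjointGroup_ext fun v => ?_
  rw [yRoot_smul, zero_smul, map_zero, expEnd_zero, one_smul]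
  rfl

theorem isNilpotent_smul' {x : 𝔤} (hx : IsNilpotent (ad ℂ 𝔤 x)) (c : ℂ) :
    IsNilpotent (ad ℂ 𝔤 (c • x)) := by
  rw [map_smul]
  obtain ⟨m, hm⟩ := hx
  exact ⟨m, by rw [smul_pow, hm, smul_zero]⟩

theorem expEnd_ad_add_smul {x : 𝔤} (hx : IsNilpotent (ad ℂ 𝔤 x)) (c d : ℂ) :
    expEnd (ad ℂ 𝔤 ((c + d) • x)) = expEnd (ad ℂ 𝔤 (c • x)) * expEnd (ad ℂ 𝔤 (d • x)) := by
  rw [add_smul, map_add, expEnd_add _ (isNilpotent_smul' hx c) (isNilpotent_smul' hx d)]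
  rw [map_smul, map_smul]
  exact ((Commute.refl _).smul_left _).smul_right _

theorem xRoot_add (s : D.base.support) (c d : ℂ) :
    D.xRoot s (c + d) = D.xRoot s c * D.xRoot s d := by
  refine adjointGroup_ext fun v => ?_
  rw [mul_smul, xRoot_smul, xRoot_smul, xRoot_smul, expEnd_ad_add_smul (D.nil_e s)]
  rfl

theorem yRoot_add (s : D.base.support) (c d : ℂ) :
    D.yRoot s (c + d) = D.yRoot s c * D.yRoot s d := by
  refine adjointGroup_ext fun v => ?_
  rw [mul_smul, yRoot_smul, yRoot_smul, yRoot_smul, expEnd_ad_add_smul (D.nil_f s)]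
  rfl

/-- The image of the matrix with rows `(0, -t)`, `(t⁻¹, 0)`. -/
def rTor (s : D.base.support) (t : ℂ) : D.G :=
  D.xRoot s (-t) * D.yRoot s t⁻¹ * D.xRoot s (-t)

theorem rBar_eq_rTor (s : D.base.support) : D.rBar s = D.rTor s 1 := by
  rw [rBar, rTor, inv_one]

/-- The first factor `x(-t)` turns `v` into a multiple of `y(-t⁻¹)` applied to the top of its
string. The middle factor cancels this `y`, and the last `x(-t)` fixes the top. -/
theorem rTor_lowest (s : D.base.support) {t : ℂ} (ht : t ≠ 0) {v : 𝔤} {a : ℕ}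
    (hf : ⁅D.f s, v⁆ = 0) (hv : ⁅(D.hRoot s : 𝔤), v⁆ = -(a : ℂ) • v) :
    D.rTor s t • v = ((-t) ^ a * (a.factorial : ℂ)⁻¹) • (ad ℂ 𝔤 (D.e s) ^ a) v := by
  have h1 := pow_ad_lowest_eq_zero (D.sl2' s) hf hv
  rw [rTor, mul_smul, mul_smul, D.xRoot_smul s (-t) v,
    expEnd_lowest (D.sl2' s) (D.nil_e s) (D.nil_f s) hf hv (-t) (neg_ne_zero.2 ht), ← D.yRoot_smul,
    adjointGroup_smul_smul, adjointGroup_smul_smul, ← mul_smul (D.yRoot s t⁻¹), ← yRoot_add]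
  rw [show t⁻¹ + (-t)⁻¹ = 0 by rw [inv_neg, add_neg_cancel], yRoot_zero, one_smul, xRoot_smul,
    expEnd_ad_of_lie_eq_zero (D.nil_e s)]
  rwa [← ad_apply ℂ, ← Module.End.mul_apply, ← pow_succ']

/-- The mirror case: the first `x(-t)` fixes `v`, then `y(t⁻¹)` produces `x(t)` applied to the
bottom of the string, and the last factor cancels it. -/
theorem rTor_highest (s : D.base.support) {t : ℂ} (ht : t ≠ 0) {v : 𝔤} {a : ℕ}
    (he : ⁅D.e s, v⁆ = 0) (hv : ⁅(D.hRoot s : 𝔤), v⁆ = (a : ℂ) • v) :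
    D.rTor s t • v = ((t⁻¹) ^ a * (a.factorial : ℂ)⁻¹) • (ad ℂ 𝔤 (D.f s) ^ a) v := by
  have hv' : ⁅-(D.hRoot s : 𝔤), v⁆ = -(a : ℂ) • v := by rw [neg_lie, hv, neg_smul]
  have := expEnd_lowest (D.sl2' s).symm (D.nil_f s) (D.nil_e s) he hv' t⁻¹ (inv_ne_zero ht)
  rw [rTor, mul_smul, mul_smul, D.xRoot_smul s (-t) v, expEnd_ad_of_lie_eq_zero (D.nil_e s) _ he,
    D.yRoot_smul, this, inv_inv, ← D.xRoot_smul, adjointGroup_smul_smul, ← mul_smul (D.xRoot s (-t)),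
    ← xRoot_add, neg_add_cancel, xRoot_zero, one_smul]

theorem lie_cartan_e (s : D.base.support) (h : 𝔥) : ⁅(h : 𝔤), D.e s⁆ = D.aRoot s h • D.e s :=
  mem_rootSpace_iff.1 (D.e_mem s) h

theorem lie_cartan_f (s : D.base.support) (h : 𝔥) : ⁅(h : 𝔤), D.f s⁆ = -D.aRoot s h • D.f s :=
  mem_rootSpace_iff.1 (D.f_mem s) h

theorem rTor_e (s : D.base.support) {t : ℂ} (ht : t ≠ 0) :
    D.rTor s t • D.e s = -(t⁻¹) ^ 2 • D.f s := by
  have h1 : ⁅D.f s, D.e s⁆ = -(D.hRoot s : 𝔤) := by rw [← lie_skew, (D.sl2' s).lie_e_f]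
  have h2 : ⁅D.f s, (D.hRoot s : 𝔤)⁆ = (2 : ℂ) • D.f s := by
    rw [← lie_skew, D.lie_cartan_f, D.aRoot_hRoot]; simp
  rw [D.rTor_highest s ht (a := 2) (lie_self _) (by rw [D.lie_cartan_e, D.aRoot_hRoot]; norm_num),
    pow_two (ad ℂ 𝔤 (D.f s)), Module.End.mul_apply, ad_apply, ad_apply, h1, lie_neg, h2, smul_neg,
    smul_smul, neg_smul]
  congr 2
  norm_num [Nat.factorial]
  ring

/-- The action on the Cartan subalgebra is the simple reflection. -/
theorem rTor_cartan (s : D.base.support) {t : ℂ} (ht : t ≠ 0) (h : 𝔥) :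
    D.rTor s t • (h : 𝔤) = ((h - D.aRoot s h • D.hRoot s : 𝔥) : 𝔤) := by
  have hes : ∀ c : ℂ, ∀ k : 𝔥, D.xRoot s c • (k : 𝔤) = k - (c * D.aRoot s k) • D.e s := by
    intro c k
    have h1 : ⁅D.e s, (k : 𝔤)⁆ = -(D.aRoot s k • D.e s) := by rw [← lie_skew, D.lie_cartan_e]
    have h2 : (ad ℂ 𝔤 (D.e s) ^ 2) (k : 𝔤) = 0 := by
      rw [pow_two, Module.End.mul_apply, ad_apply, ad_apply, h1]; simp
    rw [xRoot_smul, expEnd_ad_smul_apply (D.nil_e s) c h2]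
    simp only [Finset.sum_range_succ, Finset.range_zero, Finset.sum_empty, pow_zero, pow_one,
      Nat.factorial, Module.End.one_apply, ad_apply, h1]
    simp [mul_smul, sub_eq_add_neg]
  have hfs : ∀ c : ℂ, ∀ k : 𝔥, D.yRoot s c • (k : 𝔤) = k + (c * D.aRoot s k) • D.f s := by
    intro c k
    have h1 : ⁅D.f s, (k : 𝔤)⁆ = D.aRoot s k • D.f s := by rw [← lie_skew, D.lie_cartan_f]; simp
    have h2 : (ad ℂ 𝔤 (D.f s) ^ 2) (k : 𝔤) = 0 := by
      rw [pow_two, Module.End.mul_apply, ad_apply, ad_apply, h1]; simp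
    rw [yRoot_smul, expEnd_ad_smul_apply (D.nil_f s) c h2]
    simp only [Finset.sum_range_succ, Finset.range_zero, Finset.sum_empty, pow_zero, pow_one,
      Nat.factorial, Module.End.one_apply, ad_apply, h1]
    simp [mul_smul]
  -- `x(-t) y(1/t) x(-t) = y(1/t) x(-t) y(1/t)` on `e`
  have hye : D.xRoot s (-t) • D.yRoot s t⁻¹ • D.e s = -(t⁻¹) ^ 2 • D.f s := by
    rw [← D.rTor_e s ht, rTor, mul_smul, mul_smul, D.xRoot_smul s (-t) (D.e s),
      expEnd_ad_of_lie_eq_zero (D.nil_e s) _ (lie_self _)]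
  have hxf : D.xRoot s (-t) • D.f s = D.f s - t • (D.hRoot s : 𝔤) - t ^ 2 • D.e s := by
    have h1 : ⁅D.e s, D.f s⁆ = (D.hRoot s : 𝔤) := (D.sl2' s).lie_e_f
    have h2 : ⁅D.e s, (D.hRoot s : 𝔤)⁆ = -(2 : ℂ) • D.e s := by
      rw [← lie_skew, D.lie_cartan_e, D.aRoot_hRoot]; simp
    have h3 : (ad ℂ 𝔤 (D.e s) ^ 3) (D.f s) = 0 := by
      rw [pow_succ', pow_two, Module.End.mul_apply, Module.End.mul_apply, ad_apply, ad_apply,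
        ad_apply, h1, h2]
      simp
    rw [xRoot_smul, expEnd_ad_smul_apply (D.nil_e s) _ h3]
    simp only [Finset.sum_range_succ, Finset.range_zero, Finset.sum_empty, pow_zero, pow_one,
      Nat.factorial, Module.End.one_apply, ad_apply, h1, pow_two (ad ℂ 𝔤 (D.e s)),
      Module.End.mul_apply, h2]
    norm_num
    module
  rw [rTor, mul_smul, mul_smul, hes, smul_sub, adjointGroup_smul_smul, hfs, smul_sub,
    adjointGroup_smul_smul, hye, adjointGroup_smul_add, adjointGroup_smul_smul, hxf, hes]
  have e : ((h - D.aRoot s h • D.hRoot s : 𝔥) : 𝔤) = (h : 𝔤) - D.aRoot s h • (D.hRoot s : 𝔤) := rfl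
  rw [e]
  match_scalars <;> field_simp <;> ring

end Pinned

end WilsonLines

end

/-! ### The Cartan subgroup as exponentials of the Cartan subalgebra -/

noncomputable section

set_option linter.unusedSectionVars false

namespace WilsonLines

open LieAlgebra LieAlgebra.IsKilling

section RootSpaces

variable {𝔤 : Type*} [LieRing 𝔤] [LieAlgebra ℂ 𝔤] [FiniteDimensional ℂ 𝔤]
  [LieAlgebra.IsKilling ℂ 𝔤] {𝔥 : LieSubalgebra ℂ 𝔤} [𝔥.IsCartanSubalgebra]

theorem isNonZero_root (α : 𝔥.root) : (α.1).IsNonZero :=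
  fun h => root_ne_zero_aux α h

theorem exists_smul_eq_of_mem_rootSpace (α : 𝔥.root) {x y : 𝔤}
    (hx : x ∈ rootSpace 𝔥 (α.1 : 𝔥 → ℂ)) (hy : y ∈ rootSpace 𝔥 (α.1 : 𝔥 → ℂ)) (hx0 : x ≠ 0) :
    ∃ c : ℂ, c • x = y := by
  have h1 := finrank_rootSpace_eq_one α.1 (isNonZero_root α)
  obtain ⟨c, hc⟩ := (finrank_eq_one_iff_of_nonzero'
    (⟨x, hx⟩ : rootSpace 𝔥 (α.1 : 𝔥 → ℂ)) (by simpa using hx0)).1 h1 ⟨y, hy⟩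
  exact ⟨c, congrArg Subtype.val hc⟩

/-- If `α`, `β` and `α + β` are roots then the bracket of the root spaces does not vanish. -/
theorem lie_ne_zero_of_add_root {α β γ : 𝔥.root} (hγ : (γ.1 : 𝔥 → ℂ) = α.1 + β.1) {x y : 𝔤}
    (hx : x ∈ rootSpace 𝔥 (α.1 : 𝔥 → ℂ)) (hy : y ∈ rootSpace 𝔥 (β.1 : 𝔥 → ℂ)) (hx0 : x ≠ 0)
    (hy0 : y ≠ 0) : ⁅x, y⁆ ≠ 0 := by
  obtain ⟨h, e, f, t, he, hf⟩ := exists_isSl2Triple_of_weight_isNonZero (isNonZero_root α)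
  have hh : h = coroot α.1 := t.h_eq_coroot (isNonZero_root α) he hf
  -- Here `v` spans the top of the `α`-string through `β`. The root `β` sits `n ≥ 1` steps below it,
  -- because `α + β` is a root.
  obtain ⟨v, hv, hv0⟩ := (LieModule.chainTop α.1 β.1).exists_ne_zero
  have hlen : ⁅h, v⁆ = (chainLength α.1 β.1 : ℂ) • v := by
    rw [chainLength_smul α.1 β.1 hv, hh]
    rfl
  have P : t.HasPrimitiveVectorWith v (chainLength α.1 β.1 : ℂ) := by
    refine ⟨hv0, hlen, ?_⟩
    have := lie_mem_genWeightSpace_of_mem_genWeightSpace he hv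
    rwa [LieModule.genWeightSpace_add_chainTop α.1 β.1 (isNonZero_root α)] at this
  set n := LieModule.chainTopCoeff α.1 β.1 with hn
  have hn1 : 1 ≤ n := by
    have := ((rootSpace_zsmul_add_ne_bot_iff α.1 β.1 (isNonZero_root α) 1).1 (by
      rw [one_smul, ← hγ]; exact γ.1.2)).1
    exact_mod_cast this
  have hnl : n ≤ chainLength α.1 β.1 := chainTopCoeff_le_chainLength α.1 β.1
  have hmem : ∀ k : ℕ, ((LieModule.toEnd ℂ 𝔤 𝔤 f) ^ k) v ∈
      rootSpace 𝔥 (-(k : ℤ) • (α.1 : 𝔥 → ℂ) + LieModule.chainTop α.1 β.1) := by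
    intro k
    induction k with
    | zero => simpa using hv
    | succ k ih =>
      rw [pow_succ', Module.End.mul_apply]
      have := lie_mem_rootSpace hf ih
      have e1 : -((k + 1 : ℕ) : ℤ) • (α.1 : 𝔥 → ℂ) + LieModule.chainTop α.1 β.1 =
          -(α.1 : 𝔥 → ℂ) + (-(k : ℤ) • (α.1 : 𝔥 → ℂ) + LieModule.chainTop α.1 β.1) := by
        push_cast
        module
      rw [e1]
      exact this
  have hb : ((LieModule.toEnd ℂ 𝔤 𝔤 f) ^ n) v ∈ rootSpace 𝔥 (β.1 : 𝔥 → ℂ) := by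
    convert hmem n using 2
    rw [LieModule.coe_chainTop]
    module
  have hb0 : ((LieModule.toEnd ℂ 𝔤 𝔤 f) ^ n) v ≠ 0 := P.pow_toEnd_f_ne_zero_of_eq_nat rfl hnl
  obtain ⟨m, hm⟩ : ∃ m, n = m + 1 := ⟨n - 1, by omega⟩
  have hb1 : ((LieModule.toEnd ℂ 𝔤 𝔤 f) ^ m) v ≠ 0 :=
    P.pow_toEnd_f_ne_zero_of_eq_nat rfl (by omega)
  have hl := P.lie_e_pow_succ_toEnd_f m
  rw [← hm] at hl
  obtain ⟨c, hc⟩ := exists_smul_eq_of_mem_rootSpace α hx he hx0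
  obtain ⟨d, hd⟩ := exists_smul_eq_of_mem_rootSpace β hy hb hy0
  intro h0
  rw [← hc, ← hd, smul_lie, lie_smul, h0, smul_zero, smul_zero, eq_comm, smul_eq_zero] at hl
  refine hl.elim (fun h1 => ?_) hb1
  -- By the `sl₂` formula, `e` lifts the vector of weight `β` to the next one with factor `(m +
  -- 1)(length - m)`, which is nonzero since `m < n ≤ length`.
  have h2 : (m + 1 : ℂ) ≠ 0 := by exact_mod_cast m.succ_ne_zero
  rcases mul_eq_zero.1 h1 with h1 | h1
  · exact h2 h1
  · rw [sub_eq_zero] at h1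
    have : chainLength α.1 β.1 = m := by exact_mod_cast h1
    omega

/-- `g` acts as the exponential of `ad η`, for `η` in the Cartan subalgebra. -/
def IsTorusExp (g : adjointGroup 𝔥) (η : 𝔥) : Prop :=
  (∀ h : 𝔥, g • (h : 𝔤) = h) ∧ ∀ α : 𝔥.root, ∀ x ∈ rootSpace 𝔥 (α.1 : 𝔥 → ℂ),
    g • x = Complex.exp (α.1 η) • x

namespace IsTorusExp

theorem unique {g g' : adjointGroup 𝔥} {η : 𝔥} (h : IsTorusExp g η) (h' : IsTorusExp g' η) :
    g = g' := by
  refine adjointGroup_ext fun x => ?_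
  have := forall_of_rootSpaces (𝔥 := 𝔥)
    (LinearMap.eqLocus (g.1 : Module.End ℂ 𝔤) (g'.1 : Module.End ℂ 𝔤))
    (fun k => (h.1 k).trans (h'.1 k).symm) (fun α y hy => (h.2 α y hy).trans (h'.2 α y hy).symm) x
  exact this

theorem one : IsTorusExp (1 : adjointGroup 𝔥) 0 :=
  ⟨fun h => one_smul _ _, fun α x _ => by rw [one_smul]; simp⟩

theorem mul {g g' : adjointGroup 𝔥} {η η' : 𝔥} (h : IsTorusExp g η) (h' : IsTorusExp g' η') :
    IsTorusExp (g * g') (η + η') := by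
  refine ⟨fun k => by rw [mul_smul, h'.1, h.1], fun α x hx => ?_⟩
  have : α.1 (η + η') = α.1 η + α.1 η' := α.1.toLinear.map_add η η'
  rw [mul_smul, h'.2 α x hx, adjointGroup_smul_smul, h.2 α x hx, smul_smul, this, Complex.exp_add,
    mul_comm]

end IsTorusExp

end RootSpaces

namespace Pinned

variable {𝔤 : Type*} [LieRing 𝔤] [LieAlgebra ℂ 𝔤] [FiniteDimensional ℂ 𝔤]
  [LieAlgebra.IsKilling ℂ 𝔤] {𝔥 : LieSubalgebra ℂ 𝔤} [𝔥.IsCartanSubalgebra] (D : Pinned 𝔥)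

theorem mem_H_iff {g : D.G} : g ∈ D.H ↔ ∀ h : 𝔥, g • (h : 𝔤) = h := Iff.rfl

theorem smul_mem_rootSpace_of_mem_H {g : D.G} (hg : g ∈ D.H) {χ : 𝔥 → ℂ} {x : 𝔤}
    (hx : x ∈ rootSpace 𝔥 χ) : g • x ∈ rootSpace 𝔥 χ := by
  refine mem_rootSpace_iff.2 fun h => ?_
  rw [← adjointGroup_smul_smul, ← mem_rootSpace_iff.1 hx h, adjointGroup_smul_lie, D.mem_H_iff.1 hg h]

/-- An element of the Cartan subgroup that acts on the simple root vectors as the exponential of `η`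
acts as the exponential of `η` everywhere. -/
theorem isTorusExp_of_simple {g : D.G} (hg : g ∈ D.H) {η : 𝔥}
    (h : ∀ s, g • D.e s = Complex.exp (D.aRoot s η) • D.e s) : IsTorusExp g η := by
  refine ⟨hg, fun α => ?_⟩
  -- All roots arise from simple ones by negation and by adding a simple root. Negation is
  -- controlled by the coroot `⁅e, f⁆`, which `g` fixes, and addition by `lie_ne_zero_of_add_root`.
  refine D.base.induction_add (P := rootSystem 𝔥) α
    (p := fun α : 𝔥.root => ∀ x ∈ rootSpace 𝔥 (α.1 : 𝔥 → ℂ), g • x = Complex.exp (α.1 η) • x) ?_ ?_ ?_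
  · intro α hα x hx
    have hneg : (((rootSystem 𝔥).reflectionPerm α α).1 : 𝔥 → ℂ) = -(α.1 : 𝔥 → ℂ) := by
      have := (rootSystem 𝔥).root_reflectionPerm α α
      rw [RootPairing.reflection_apply_self] at this
      funext k
      exact congrArg (fun χ : Module.Dual ℂ 𝔥 => χ k) this
    rw [hneg] at hx ⊢
    obtain ⟨k, e, f, t, he, hf⟩ := exists_isSl2Triple_of_weight_isNonZero (isNonZero_root α)
    have hk : k = coroot α.1 := t.h_eq_coroot (isNonZero_root α) he hf
    have hgf := D.smul_mem_rootSpace_of_mem_H hg hf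
    rw [← hneg] at hgf hf hx
    obtain ⟨c, hc⟩ := exists_smul_eq_of_mem_rootSpace _ hf hgf t.f_ne_zero
    obtain ⟨d, rfl⟩ := exists_smul_eq_of_mem_rootSpace _ hf hx t.f_ne_zero
    have h1 : g • ⁅e, f⁆ = ⁅e, f⁆ := by rw [t.lie_e_f, hk]; exact hg _
    rw [adjointGroup_smul_lie, hα e he, ← hc, smul_lie, lie_smul, t.lie_e_f, smul_smul] at h1
    have h2 : Complex.exp (α.1 η) * c = 1 := by
      by_contra hne
      have h3 : (Complex.exp (α.1 η) * c - 1) • k = 0 := by rw [sub_smul, h1, one_smul, sub_self]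
      exact (smul_eq_zero.1 h3).elim (sub_ne_zero.2 hne) t.h_ne_zero
    have h3 : c = Complex.exp ((-(α.1 : 𝔥 → ℂ)) η) := by
      rw [Pi.neg_apply, Complex.exp_neg]
      exact eq_inv_of_mul_eq_one_right h2
    rw [adjointGroup_smul_smul, ← hc, h3, smul_comm]
  · intro s hs x hx
    obtain ⟨d, rfl⟩ := exists_smul_eq_of_mem_rootSpace _ (D.e_mem ⟨s, hs⟩) hx
      (D.sl2 ⟨s, hs⟩).e_ne_zero
    rw [adjointGroup_smul_smul, h, smul_comm]
    rfl
  · intro α β γ hγ hα hβ x hx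
    have hγ' : (γ.1 : 𝔥 → ℂ) = α.1 + β.1 := by
      funext k
      exact congrArg (fun χ : Module.Dual ℂ 𝔥 => χ k) hγ
    obtain ⟨y, hy, hy0⟩ := α.1.exists_ne_zero
    set z := D.e ⟨β, hβ⟩ with hz
    have hz0 : z ≠ 0 := (D.sl2 ⟨β, hβ⟩).e_ne_zero
    have h1 := lie_ne_zero_of_add_root hγ' hy (D.e_mem ⟨β, hβ⟩) hy0 hz0
    have h2 := lie_mem_rootSpace hy (D.e_mem ⟨β, hβ⟩)
    rw [← hγ'] at h2
    obtain ⟨d, rfl⟩ := exists_smul_eq_of_mem_rootSpace γ h2 hx h1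
    rw [adjointGroup_smul_smul, adjointGroup_smul_lie, hα y hy, ← hz, h ⟨β, hβ⟩, smul_lie, lie_smul,
      smul_smul, smul_smul, smul_smul, mul_assoc, ← Complex.exp_add, mul_comm d, hγ']
    rfl

theorem eq_one_of_mem_H {g : D.G} (hg : g ∈ D.H) (h : ∀ s, g • D.e s = D.e s) : g = 1 := by
  refine IsTorusExp.unique (D.isTorusExp_of_simple hg (η := 0) fun s => ?_) IsTorusExp.one
  rw [h, map_zero, Complex.exp_zero, one_smul]

/-- The eigenvalues on simple root vectors are nonzero and have logarithms. Simple roots form a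
basis of the dual of `𝔥`, so some `η` takes these logarithms as its values. -/
theorem exists_isTorusExp {g : D.G} (hg : g ∈ D.H) : ∃ η, IsTorusExp g η := by
  have h1 : ∀ s, ∃ z : ℂ, g • D.e s = Complex.exp z • D.e s := by
    intro s
    obtain ⟨c, hc⟩ := exists_smul_eq_of_mem_rootSpace s.1 (D.e_mem s)
      (D.smul_mem_rootSpace_of_mem_H hg (D.e_mem s)) (D.sl2 s).e_ne_zero
    have hc0 : c ≠ 0 := by
      rintro rfl
      rw [zero_smul] at hc
      have : D.e s = 0 := by rw [← inv_smul_smul g (D.e s), ← hc, smul_zero]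
      exact (D.sl2 s).e_ne_zero this
    exact ⟨Complex.log c, by rw [Complex.exp_log hc0, hc]⟩
  choose z hz using h1
  let φ : Module.Dual ℂ (Module.Dual ℂ 𝔥) := D.base.toWeightBasis.constr ℂ z
  refine ⟨(Module.evalEquiv ℂ 𝔥).symm φ, D.isTorusExp_of_simple hg fun s => ?_⟩
  have : D.aRoot s ((Module.evalEquiv ℂ 𝔥).symm φ) = z s := by
    rw [Module.apply_evalEquiv_symm_apply]
    have := D.base.toWeightBasis.constr_basis ℂ z s
    rw [RootPairing.Base.toWeightBasis_apply] at this
    exact this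
  rw [this, hz]

theorem rTor_mem_rootSpace (s : D.base.support) {t : ℂ} (ht : t ≠ 0) {χ : Module.Dual ℂ 𝔥} {x : 𝔤}
    (hx : x ∈ rootSpace 𝔥 (χ : 𝔥 → ℂ)) :
    D.rTor s t • x ∈ rootSpace 𝔥 ((rootSystem 𝔥).reflection s.1 χ : 𝔥 → ℂ) := by
  refine mem_rootSpace_iff.2 fun h => ?_
  set k : 𝔥 := h - D.aRoot s h • D.hRoot s with hk
  have h1 : D.rTor s t • (k : 𝔤) = h := by
    rw [D.rTor_cartan s ht]
    congr 1
    rw [hk, map_sub, map_smul, D.aRoot_hRoot]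
    module
  have h2 : (rootSystem 𝔥).reflection s.1 χ h = χ k := by
    rw [RootPairing.reflection_apply, hk, map_sub, map_smul]
    change χ h - (χ (D.hRoot s) • D.aRoot s) h = _
    simp [mul_comm]
  rw [h2, ← adjointGroup_smul_smul, ← mem_rootSpace_iff.1 hx k, adjointGroup_smul_lie, h1]

theorem rTor_inv (s : D.base.support) (t : ℂ) : (D.rTor s t)⁻¹ = D.rTor s (-t) := by
  refine inv_eq_of_mul_eq_one_right ?_
  have hx : D.xRoot s (-t) * D.xRoot s t = 1 := by rw [← xRoot_add, neg_add_cancel, xRoot_zero]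
  have hy : D.yRoot s t⁻¹ * D.yRoot s (-t)⁻¹ = 1 := by
    rw [← yRoot_add, inv_neg, add_neg_cancel, yRoot_zero]
  rw [rTor, rTor, neg_neg]
  calc _ = D.xRoot s (-t) * (D.yRoot s t⁻¹ * (D.xRoot s (-t) * D.xRoot s t) * D.yRoot s (-t)⁻¹) *
        D.xRoot s t := by simp only [mul_assoc]
    _ = 1 := by rw [hx, mul_one, hy, mul_one, hx]

theorem mem_H_conj_rTor (s : D.base.support) {t : ℂ} (ht : t ≠ 0) {g : D.G} {η : 𝔥}
    (h : IsTorusExp g η) :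
    IsTorusExp (D.rTor s t * g * (D.rTor s t)⁻¹) (η - D.aRoot s η • D.hRoot s) := by
  have ht' : -t ≠ 0 := neg_ne_zero.2 ht
  refine ⟨fun k => ?_, fun α x hx => ?_⟩
  · rw [mul_smul, mul_smul, rTor_inv, D.rTor_cartan s ht', h.1, ← D.rTor_cartan s ht', ← rTor_inv,
      smul_inv_smul]
  · have h1 := D.rTor_mem_rootSpace s ht' (χ := (rootSystem 𝔥).root α) hx
    have h2 : (rootSystem 𝔥).reflection s.1 ((rootSystem 𝔥).root α) =
        (rootSystem 𝔥).root ((rootSystem 𝔥).reflectionPerm s.1 α) :=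
      ((rootSystem 𝔥).root_reflectionPerm s.1 α).symm
    have h3 : ((rootSystem 𝔥).reflectionPerm s.1 α).1 η =
        α.1 (η - D.aRoot s η • D.hRoot s) := by
      change (rootSystem 𝔥).root ((rootSystem 𝔥).reflectionPerm s.1 α) η = (rootSystem 𝔥).root α _
      rw [← h2, map_sub, map_smul, RootPairing.reflection_apply]
      change (rootSystem 𝔥).root α η - ((rootSystem 𝔥).root α (D.hRoot s) • D.aRoot s) η = _
      simp [mul_comm]
    rw [h2] at h1
    rw [mul_smul, mul_smul, rTor_inv, h.2 _ _ h1, h3, adjointGroup_smul_smul, ← rTor_inv,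
      smul_inv_smul]

theorem pairing_nonpos {s u : D.base.support} (h : s ≠ u) :
    ∃ a : ℕ, D.aRoot s (D.hRoot u) = -(a : ℂ) := by
  have h1 := D.base.pairingIn_le_zero_of_ne (fun e => h (Subtype.ext e)) s.2 u.2
  obtain ⟨a, ha⟩ := Int.exists_eq_neg_ofNat h1
  refine ⟨a, ?_⟩
  have h2 := (rootSystem 𝔥).algebraMap_pairingIn ℤ s.1 u.1
  rw [ha] at h2
  change (rootSystem 𝔥).pairing s.1 u.1 = _
  rw [← h2]
  simp

/-- A difference of two distinct simple roots is neither zero nor a root. Hence `e_s` is a lowest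
weight vector for the `sl₂` of `u`. -/
theorem lie_f_e {s u : D.base.support} (h : s ≠ u) : ⁅D.f u, D.e s⁆ = 0 := by
  by_contra hne
  have h1 := lie_mem_rootSpace (D.f_mem u) (D.e_mem s)
  have h2 : (-(((u.1 : 𝔥.root).1 : LieModule.Weight ℂ 𝔥 𝔤) : 𝔥 → ℂ) +
      (((s.1 : 𝔥.root).1 : LieModule.Weight ℂ 𝔥 𝔤) : 𝔥 → ℂ)) ≠ 0 := by
    intro h0
    apply h
    have : ((s.1 : 𝔥.root).1 : 𝔥 → ℂ) = (u.1 : 𝔥.root).1 := by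
      rw [neg_add_eq_zero] at h0
      exact h0.symm
    exact Subtype.ext (Subtype.ext (DFunLike.coe_injective this))
  let w : LieModule.Weight ℂ 𝔥 𝔤 := ⟨-(((u.1 : 𝔥.root).1 : LieModule.Weight ℂ 𝔥 𝔤) : 𝔥 → ℂ) +
      (((s.1 : 𝔥.root).1 : LieModule.Weight ℂ 𝔥 𝔤) : 𝔥 → ℂ), fun hb => hne (by
    have h3 : ⁅D.f u, D.e s⁆ ∈ (⊥ : LieSubmodule ℂ 𝔥 𝔤) := hb ▸ h1
    simpa using h3)⟩
  have hw : w.IsNonZero := fun h0 => h2 h0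
  refine D.base.sub_notMem_range_root s.2 u.2 ⟨⟨w, by simpa using hw⟩, ?_⟩
  ext k
  change -(((u.1 : 𝔥.root).1 : LieModule.Weight ℂ 𝔥 𝔤) : 𝔥 → ℂ) k +
      (((s.1 : 𝔥.root).1 : LieModule.Weight ℂ 𝔥 𝔤) : 𝔥 → ℂ) k = 
      (((s.1 : 𝔥.root).1 : LieModule.Weight ℂ 𝔥 𝔤) : 𝔥 → ℂ) k - 
      (((u.1 : 𝔥.root).1 : LieModule.Weight ℂ 𝔥 𝔤) : 𝔥 → ℂ) k
  ring

theorem rTor_e_of_ne {s u : D.base.support} (h : s ≠ u) {t : ℂ} (ht : t ≠ 0) {a : ℕ}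
    (ha : D.aRoot s (D.hRoot u) = -(a : ℂ)) :
    D.rTor u t • D.e s =
      ((-t) ^ a * (a.factorial : ℂ)⁻¹) • (ad ℂ 𝔤 (D.e u) ^ a) (D.e s) :=
  D.rTor_lowest u ht (D.lie_f_e h) (by rw [lie_cartan_e, ha])

/-- The simple coroot as a cocharacter. -/
def hTor (s : D.base.support) (t : ℂ) : D.G := (D.rBar s)⁻¹ * D.rTor s t

theorem hTor_mem_H (s : D.base.support) {t : ℂ} (ht : t ≠ 0) : D.hTor s t ∈ D.H := by
  intro k
  change D.hTor s t • (k : 𝔤) = k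
  rw [hTor, mul_smul, D.rTor_cartan s ht, ← D.rTor_cartan s one_ne_zero, ← rBar_eq_rTor,
    inv_smul_smul]

/-- On each simple root vector `rTor s t` and `r̄_s` produce the same vector up to a power of `t`:
the exponent is `-2` for `s` itself and minus the Cartan integer otherwise. -/
theorem hTor_isTorusExp (s : D.base.support) (z : ℂ) :
    IsTorusExp (D.hTor s (Complex.exp z)) (-z • D.hRoot s) := by
  have ht := Complex.exp_ne_zero z
  refine D.isTorusExp_of_simple (D.hTor_mem_H s ht) fun u => ?_
  rw [hTor, mul_smul, inv_smul_eq_iff, adjointGroup_smul_smul, rBar_eq_rTor]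
  by_cases h : u = s
  · subst h
    rw [D.rTor_e _ ht, D.rTor_e _ one_ne_zero, map_smul, D.aRoot_hRoot, smul_smul, ← Complex.exp_neg,
      ← Complex.exp_nat_mul, smul_eq_mul]
    congr 1
    push_cast
    rw [mul_comm (-z)]
    ring
  · obtain ⟨a, ha⟩ := D.pairing_nonpos h
    rw [D.rTor_e_of_ne h ht ha, D.rTor_e_of_ne h one_ne_zero ha, map_smul, ha, smul_smul,
      neg_pow, neg_pow, ← Complex.exp_nat_mul, smul_eq_mul, neg_mul_neg, mul_comm z, one_pow]
    congr 1
    ring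

/-- Since `-1 = exp (±πi)`, the element `r̄_s⁻² = hTor s (-1)` is the exponential of both `πi h_s`
and `-πi h_s`. Multiplying the two gives `r̄_s⁴ = 1`, so `r̄_s²` equals its inverse. -/
theorem rBar_sq_isTorusExp (s : D.base.support) :
    IsTorusExp (D.rBar s * D.rBar s) ((Real.pi * Complex.I : ℂ) • D.hRoot s) := by
  have h1 := D.hTor_isTorusExp s (-(Real.pi * Complex.I))
  have h2 : D.hTor s (Complex.exp (-(Real.pi * Complex.I))) = (D.rBar s * D.rBar s)⁻¹ := by
    rw [Complex.exp_neg, Complex.exp_pi_mul_I, hTor, mul_inv_rev, rBar_eq_rTor]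
    congr 1
    rw [rTor_inv]
    norm_num
  rw [h2, neg_neg] at h1
  have h3 := D.hTor_isTorusExp s (Real.pi * Complex.I)
  have h4 : D.hTor s (Complex.exp (Real.pi * Complex.I)) = (D.rBar s * D.rBar s)⁻¹ := by
    rw [Complex.exp_pi_mul_I, hTor, mul_inv_rev, rBar_eq_rTor]
    congr 1
    rw [rTor_inv]
  rw [h4] at h3
  have h5 := h3.mul h1
  rw [neg_smul, neg_add_cancel] at h5
  have h6 := h5.unique IsTorusExp.one
  have h7 : (D.rBar s * D.rBar s) = (D.rBar s * D.rBar s)⁻¹ := by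
    have := eq_inv_of_mul_eq_one_left h6
    rw [inv_inv] at this
    exact this.symm
  rw [h7]
  exact h1

/-- The Cartan subgroup is generated by the cocharacters `hTor`. -/
theorem mem_closure_hTor {g : D.G} (hg : g ∈ D.H) :
    g ∈ Subgroup.closure {g : D.G | ∃ s, ∃ t : ℂ, t ≠ 0 ∧ g = D.hTor s t} := by
  classical
  obtain ⟨η, hη⟩ := D.exists_isTorusExp hg
  -- The simple coroots are a basis of `𝔥`, so the exponential of `η` is built one coordinate at a
  -- time.
  have key : ∀ T : Finset D.base.support, ∃ g' ∈ Subgroup.closure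
      {g : D.G | ∃ s, ∃ t : ℂ, t ≠ 0 ∧ g = D.hTor s t},
      IsTorusExp g' (∑ s ∈ T, D.base.toCoweightBasis.repr η s • D.hRoot s) := by
    intro T
    induction T using Finset.induction_on with
    | empty => exact ⟨1, one_mem _, by simpa using IsTorusExp.one⟩
    | insert s T hs ih =>
      obtain ⟨g', hg', h'⟩ := ih
      refine ⟨D.hTor s (Complex.exp (-D.base.toCoweightBasis.repr η s)) * g', mul_mem
        (Subgroup.subset_closure ⟨s, _, Complex.exp_ne_zero _, rfl⟩) hg', ?_⟩
      rw [Finset.sum_insert hs]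
      have := D.hTor_isTorusExp s (-D.base.toCoweightBasis.repr η s)
      rw [neg_neg] at this
      exact this.mul h'
  obtain ⟨g', hg', h'⟩ := key Finset.univ
  have e : ∑ s, D.base.toCoweightBasis.repr η s • D.hRoot s = η := by
    conv_rhs => rw [← D.base.toCoweightBasis.sum_repr η]
    refine Finset.sum_congr rfl fun s _ => ?_
    rw [RootPairing.Base.toCoweightBasis_apply]
    rfl
  rw [e] at h'
  rw [hη.unique h']
  exact hg'

end Pinned

end WilsonLines

end

/-! ### Combinatorics of reduced words: exchange condition, longest element, Matsumoto's theorem -/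

noncomputable section

set_option linter.unusedSectionVars false

namespace WilsonLines

section Words

variable {ι R M N : Type*} [CommRing R] [CharZero R] [IsDomain R] [AddCommGroup M] [Module R M]
  [AddCommGroup N] [Module R N] {P : RootPairing ι R M N} (b : P.Base)

/-- The product of the simple reflections along a word in the simple roots. -/
def wordMap (l : List b.support) : M ≃ₗ[R] M := (l.map fun s => P.reflection s.1).prod

@[simp] theorem wordMap_nil : wordMap b [] = 1 := rfl

@[simp] theorem wordMap_cons (s : b.support) (l : List b.support) :
    wordMap b (s :: l) = P.reflection s.1 * wordMap b l := List.prod_cons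

@[simp] theorem wordMap_append (l l' : List b.support) :
    wordMap b (l ++ l') = wordMap b l * wordMap b l' := by
  simp [wordMap]

theorem reflection_mul_self (i : ι) : P.reflection i * P.reflection i = 1 :=
  LinearEquiv.ext fun x => P.reflection_same i x

theorem wordMap_reverse (l : List b.support) : wordMap b l.reverse = (wordMap b l)⁻¹ := by
  induction l with
  | nil => simp
  | cons s l ih =>
    have : (P.reflection s.1)⁻¹ = P.reflection s.1 :=
      inv_eq_of_mul_eq_one_right (reflection_mul_self _)
    simp [ih, this]

/-- A word of minimal length among those with the same product. -/
def IsReduced (l : List b.support) : Prop :=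
  ∀ l' : List b.support, wordMap b l' = wordMap b l → l.length ≤ l'.length

theorem exists_reduced (l : List b.support) :
    ∃ l', IsReduced b l' ∧ wordMap b l' = wordMap b l := by
  classical
  have h : ∃ n, ∃ l' : List b.support, l'.length = n ∧ wordMap b l' = wordMap b l :=
    ⟨_, l, rfl, rfl⟩
  obtain ⟨l', h1, h2⟩ := Nat.find_spec h
  refine ⟨l', fun l'' h3 => ?_, h2⟩
  rw [h1]
  exact Nat.find_min' h ⟨l'', rfl, h3.trans h2⟩

/-- The second part, `w s_i w⁻¹ = s_{w(i)}`, is what turns statements on roots into the deletion of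
letters. -/
theorem wordMap_root (l : List b.support) (i : ι) :
    ∃ j, wordMap b l (P.root i) = P.root j ∧
      wordMap b l * P.reflection i = P.reflection j * wordMap b l := by
  induction l with
  | nil => exact ⟨i, rfl, by simp⟩
  | cons s l ih =>
    obtain ⟨j, h1, h2⟩ := ih
    refine ⟨P.reflectionPerm s.1 j, ?_, ?_⟩
    · rw [wordMap_cons, LinearEquiv.mul_apply, h1, P.root_reflectionPerm]
    · rw [wordMap_cons, mul_assoc, h2, RootPairing.reflection_reflectionPerm]
      simp only [mul_assoc]
      rw [← mul_assoc (P.reflection s.1) (P.reflection s.1) (wordMap b l), reflection_mul_self,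
        one_mul]

theorem wordMap_mul_reflection {l : List b.support} {i j : ι}
    (h : wordMap b l (P.root i) = P.root j) :
    wordMap b l * P.reflection i = P.reflection j * wordMap b l := by
  obtain ⟨j', h1, h2⟩ := wordMap_root b l i
  rw [h] at h1
  rw [P.root.injective h1, h2]

variable [Finite ι] [P.IsCrystallographic] [P.IsReduced]

/-- `w` sends `i` to a negative root. -/
def SendsNeg (w : M ≃ₗ[R] M) (i : ι) : Prop := ∃ j, w (P.root i) = P.root j ∧ ¬ b.IsPos j

/-- The exchange condition. -/
theorem exchange (l : List b.support) (s : b.support) (h : SendsNeg b (wordMap b l) s.1) :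
    ∃ l' : List b.support, l'.length + 1 = l.length ∧
      wordMap b l' = wordMap b l * P.reflection s.1 := by
  induction l with
  | nil =>
    obtain ⟨j, h1, h2⟩ := h
    have : s.1 = j := P.root.injective h1
    exact absurd (RootPairing.Base.isPos_of_mem_support s.2) (this ▸ h2)
  | cons u l ih =>
    obtain ⟨j, h1, h2⟩ := wordMap_root b l s.1
    by_cases hj : b.IsPos j
    · by_cases hju : j = u.1
      · refine ⟨l, rfl, ?_⟩
        rw [wordMap_cons, mul_assoc, h2, hju, ← mul_assoc, reflection_mul_self, one_mul]
      · exfalso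
        obtain ⟨k, h3, h4⟩ := h
        rw [wordMap_cons, LinearEquiv.mul_apply, h1, ← P.root_reflectionPerm] at h3
        exact h4 (P.root.injective h3 ▸ hj.reflectionPerm u.2 hju)
    · obtain ⟨l', h3, h4⟩ := ih ⟨j, h1, hj⟩
      exact ⟨u :: l', by simp [h3], by rw [wordMap_cons, wordMap_cons, h4, mul_assoc]⟩

/-- A reduced word that ends in `s` sends the simple root `s` to a negative root. -/
theorem sendsNeg_of_reduced {l : List b.support} {s : b.support} (h : IsReduced b (l ++ [s])) :
    SendsNeg b (wordMap b (l ++ [s])) s.1 := by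
  obtain ⟨j, h1, h2⟩ := wordMap_root b l s.1
  have hj : b.IsPos j := by
    by_contra hj
    obtain ⟨l', h3, h4⟩ := exchange b l s ⟨j, h1, hj⟩
    have := h l' (by rw [h4]; simp)
    simp at this
    omega
  let _ := P.indexNeg
  refine ⟨-j, ?_, ?_⟩
  · rw [wordMap_append, LinearEquiv.mul_apply]
    simp [h1]
  · rw [RootPairing.Base.IsPos.neg_iff_not]
    exact not_not.2 hj

/-- An element of the Weyl group that makes no simple root negative is trivial. -/
theorem wordMap_eq_one {l : List b.support} (h : ∀ s : b.support, ¬ SendsNeg b (wordMap b l) s.1) :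
    wordMap b l = 1 := by
  obtain ⟨l', h1, h2⟩ := exists_reduced b l
  rcases List.eq_nil_or_concat l' with rfl | ⟨l'', s, rfl⟩
  · rw [← h2, wordMap_nil]
  · rw [List.concat_eq_append] at h1 h2
    exact absurd (h2 ▸ sendsNeg_of_reduced b h1) (h s)

/-- If a reduced word cannot be made longer then it makes all positive roots negative. -/
theorem sendsNeg_of_longest {l : List b.support} (h : IsReduced b l)
    (hmax : ∀ l' : List b.support, IsReduced b l' → l'.length ≤ l.length) (s : b.support) :
    SendsNeg b (wordMap b l) s.1 := by
  by_contra hs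
  obtain ⟨j, h1, h2⟩ := wordMap_root b l s.1
  have hj : b.IsPos j := by
    by_contra hj
    exact hs ⟨j, h1, hj⟩
  -- A word for `w s` sends `s` to a negative root, so exchange removes a letter from it and leaves
  -- a word for `w`. It is therefore longer than `l`, and appending `s` contradicts maximality.
  have key : IsReduced b (l ++ [s]) := by
    intro l' hl'
    obtain ⟨l2, h3, h4⟩ := exists_reduced b l'
    have hneg : SendsNeg b (wordMap b l2) s.1 := by
      let _ := P.indexNeg
      refine ⟨-j, ?_, ?_⟩
      · rw [h4, hl', wordMap_append, LinearEquiv.mul_apply]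
        simp [h1]
      · rw [RootPairing.Base.IsPos.neg_iff_not]
        exact not_not.2 hj
    obtain ⟨l3, h5, h6⟩ := exchange b l2 s hneg
    have h7 : wordMap b l3 = wordMap b l := by
      rw [h6, h4, hl', wordMap_append]
      simp [mul_assoc, reflection_mul_self]
    have h8 := h l3 h7
    have h9 := h3 l' h4.symm
    simp
    omega
  have := hmax _ key
  simp at this

/-- Positive roots are reached from simple ones by adding simple roots, and the image of a sum is a
root whose height is a sum of negative heights. -/
theorem SendsNeg.of_isPos {w : M ≃ₗ[R] M} (hw : ∀ i, ∃ j, w (P.root i) = P.root j)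
    (h : ∀ s : b.support, SendsNeg b w s.1) {i : ι} (hi : b.IsPos i) : SendsNeg b w i := by
  refine hi.induction_on_add (p := fun i => SendsNeg b w i) (fun i hi => h ⟨i, hi⟩) ?_
  rintro i j k hk ⟨i', h1, h2⟩ hj
  obtain ⟨j', h3, h4⟩ := h ⟨j, hj⟩
  obtain ⟨k', h5⟩ := hw k
  refine ⟨k', h5, fun hk' => ?_⟩
  have e : P.root k' = P.root i' + P.root j' := by rw [← h5, hk, map_add, h1, h3]
  have := b.height_add e
  rw [RootPairing.Base.isPos_iff] at h2 h4 hk'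
  omega

theorem not_sendsNeg_of_sendsNeg {w : M ≃ₗ[R] M} (hw : ∀ i, ∃ j, w (P.root i) = P.root j)
    (h : ∀ s : b.support, SendsNeg b w s.1) {i j : ι} (hi : ¬ b.IsPos i)
    (hj : w (P.root i) = P.root j) : b.IsPos j := by
  let _ := P.indexNeg
  have hi' : b.IsPos (-i) := (RootPairing.Base.IsPos.neg_iff_not b i).2 hi
  obtain ⟨k, h1, h2⟩ := SendsNeg.of_isPos b hw h hi'
  have : P.root k = P.root (-j) := by rw [← h1]; simp [hj]
  rw [P.root.injective this, RootPairing.Base.IsPos.neg_iff_not] at h2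
  exact not_not.1 h2

/-- The longest element is an involution. -/
theorem wordMap_longest_sq {l : List b.support}
    (h : ∀ s : b.support, SendsNeg b (wordMap b l) s.1) : wordMap b l * wordMap b l = 1 := by
  rw [← wordMap_append]
  refine wordMap_eq_one b fun s hs => ?_
  obtain ⟨j, h1, h2⟩ := h s
  obtain ⟨k, h3, h4⟩ := hs
  rw [wordMap_append, LinearEquiv.mul_apply, h1] at h3
  exact h4 (not_sendsNeg_of_sendsNeg b
    (fun i => (wordMap_root b l i).imp fun _ h => h.1) h h2 h3)

/-- The longest element maps simple roots to negatives of simple roots. -/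
theorem height_longest {l : List b.support}
    (h : ∀ s : b.support, SendsNeg b (wordMap b l) s.1) (s : b.support) {j : ι}
    (hj : wordMap b l (P.root s.1) = P.root j) : b.height j = -1 := by
  let _ := P.indexNeg
  have hw : ∀ i, ∃ j, wordMap b l (P.root i) = P.root j :=
    fun i => (wordMap_root b l i).imp fun _ h => h.1
  have hsq : ∀ x, wordMap b l (wordMap b l x) = x := fun x => by
    rw [← LinearEquiv.mul_apply, wordMap_longest_sq b h]; rfl
  have hneg : b.IsPos (-j) := by
    obtain ⟨j', h1, h2⟩ := h s
    rw [RootPairing.Base.IsPos.neg_iff_not, ← P.root.injective (h1.symm.trans hj)]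
    exact h2
  -- a positive root which `w` sends to minus a simple root is simple
  have key : ∀ i, b.IsPos i → b.IsPos i ∧ (wordMap b l (P.root i) = -P.root s.1 → b.height i = 1) := by
    intro i hi
    refine hi.induction_on_add
      (p := fun i => b.IsPos i ∧ (wordMap b l (P.root i) = -P.root s.1 → b.height i = 1)) ?_ ?_
    · intro i hi
      exact ⟨RootPairing.Base.isPos_of_mem_support hi,
        fun _ => RootPairing.Base.height_one_of_mem_support hi⟩
    · intro i k m hm hi hk
      have hkp := RootPairing.Base.isPos_of_mem_support hk
      refine ⟨hi.1.add hkp hm, fun hms => ?_⟩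
      -- A decomposable positive root is sent to a sum of two negative roots, of height at most
      -- `-2`, whereas minus a simple root has height `-1`.
      exfalso
      obtain ⟨i', h1, h2⟩ := SendsNeg.of_isPos b hw h hi.1
      obtain ⟨k', h3, h4⟩ := SendsNeg.of_isPos b hw h hkp
      have e : P.root (-s.1) = P.root i' + P.root k' := by
        rw [← h1, ← h3, ← map_add, ← hm, hms]
        simp
      have h5 := b.height_add e
      rw [RootPairing.Base.height_reflectionPerm_self,
        RootPairing.Base.height_one_of_mem_support s.2] at h5
      rw [RootPairing.Base.isPos_iff] at h2 h4
      have h6 := b.height_ne_zero i'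
      have h7 := b.height_ne_zero k'
      omega
  have := (key (-j) hneg).2 (by rw [show P.root (-j) = -P.root j by simp, map_neg, ← hj, hsq])
  rw [RootPairing.Base.height_reflectionPerm_self] at this
  omega

/-- The alternating word `s u s u ⋯` with `n` letters. -/
def altWord (s u : b.support) : ℕ → List b.support
  | 0 => []
  | n + 1 => s :: altWord u s n

/-- The letter that follows the alternating word with `n` letters. -/
def altNext (s u : b.support) : ℕ → b.support
  | 0 => s
  | n + 1 => altNext u s n

theorem altWord_succ (s u : b.support) (n : ℕ) :
    altWord b s u (n + 1) = altWord b s u n ++ [altNext b s u n] := by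
  induction n generalizing s u with
  | zero => rfl
  | succ n ih =>
    rw [altWord, ih u s]
    rfl

@[simp] theorem length_altWord (s u : b.support) (n : ℕ) : (altWord b s u n).length = n := by
  induction n generalizing s u with
  | zero => rfl
  | succ n ih => simp [altWord, ih]

theorem height_combination {i j k : ι} {x y : ℕ} (hk : P.root k = x • P.root i + y • P.root j) :
    b.height k = x * b.height i + y * b.height j := by
  obtain ⟨f, -, -, hf⟩ := b.exists_root_eq_sum_int i
  obtain ⟨g, -, -, hg⟩ := b.exists_root_eq_sum_int j
  have hfg : P.root k = ∑ l ∈ b.support, ((x : ℤ) • f + (y : ℤ) • g) l • P.root l := by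
    simp only [Pi.add_apply, Pi.smul_apply, add_smul, smul_assoc, Finset.sum_add_distrib,
      ← Finset.smul_sum, ← hf, ← hg, hk, natCast_zsmul]
  rw [RootPairing.Base.height_eq_sum hf, RootPairing.Base.height_eq_sum hg,
    RootPairing.Base.height_eq_sum hfg]
  simp [Finset.sum_add_distrib, Finset.mul_sum]

/-- The first `m` prefixes of the alternating word keep the next letter in the cone of `s` and `u`. -/
def AltPositive (s u : b.support) (m : ℕ) : Prop :=
  ∀ k < m, ∃ x y : ℕ, wordMap b (altWord b s u k) (P.root (altNext b s u k).1) =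
    x • P.root s.1 + y • P.root u.1

/-- If `w` makes both `s` and `u` negative, then `w` times a prefix of the alternating word sends
the next letter to a nonnegative combination of `w(s)` and `w(u)`, which is negative. The exchange
condition thus splits off one alternating letter after another, so that `w` has a word ending in the
full braid word. -/
theorem exists_peel {l : List b.support} {s u : b.support} {m : ℕ} (hm : AltPositive b s u m)
    (hs : SendsNeg b (wordMap b l) s.1) (hu : SendsNeg b (wordMap b l) u.1) (k : ℕ) (hk : k ≤ m) :
    ∃ l' : List b.support, l'.length + k = l.length ∧
      wordMap b (l' ++ (altWord b s u k).reverse) = wordMap b l := by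
  induction k with
  | zero => exact ⟨l, rfl, by simp [altWord]⟩
  | succ k ih =>
    obtain ⟨l1, h1, h2⟩ := ih (by omega)
    obtain ⟨x, y, hxy⟩ := hm k (by omega)
    obtain ⟨i, hi, hi'⟩ := hs
    obtain ⟨j, hj, hj'⟩ := hu
    set r := altNext b s u k
    have h3 : wordMap b l1 = wordMap b l * wordMap b (altWord b s u k) := by
      rw [← h2, wordMap_append, wordMap_reverse]
      simp
    have hneg : SendsNeg b (wordMap b l1) r.1 := by
      obtain ⟨q, hq, -⟩ := wordMap_root b l1 r.1
      refine ⟨q, hq, fun hpos => ?_⟩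
      have e : P.root q = x • P.root i + y • P.root j := by
        rw [← hq, h3, LinearEquiv.mul_apply, hxy, map_add, map_nsmul, map_nsmul, hi, hj]
      have h4 := height_combination b e
      rw [RootPairing.Base.isPos_iff] at hi' hj' hpos
      have h5 : (x : ℤ) * b.height i ≤ 0 :=
        mul_nonpos_of_nonneg_of_nonpos (Int.natCast_nonneg _) (by omega)
      have h6 : (y : ℤ) * b.height j ≤ 0 :=
        mul_nonpos_of_nonneg_of_nonpos (Int.natCast_nonneg _) (by omega)
      omega
    obtain ⟨l2, h4, h5⟩ := exchange b l1 r hneg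
    refine ⟨l2, by omega, ?_⟩
    rw [altWord_succ, wordMap_append, h5, List.reverse_append, wordMap_append, ← h2, wordMap_append]
    simp only [List.reverse_cons, List.reverse_nil, List.nil_append, wordMap_cons, wordMap_nil,
      mul_one]
    rw [mul_assoc, ← mul_assoc (P.reflection r.1), reflection_mul_self, one_mul]

/-- Matsumoto's theorem: if `f` satisfies the braid relations, then its product along a reduced word
only depends on the element of the Weyl group. -/
theorem prod_eq_of_reduced {G : Type*} [Monoid G] (f : b.support → G)
    (hf : ∀ s u : b.support, s ≠ u → ∃ m, 0 < m ∧ AltPositive b s u m ∧ AltPositive b u s m ∧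
      wordMap b (altWord b s u m).reverse = wordMap b (altWord b u s m).reverse ∧
      ((altWord b s u m).reverse.map f).prod = ((altWord b u s m).reverse.map f).prod)
    {l l' : List b.support} (hl : IsReduced b l) (hl' : IsReduced b l')
    (h : wordMap b l = wordMap b l') : (l.map f).prod = (l'.map f).prod := by
  generalize hn : l.length = n
  induction n using Nat.strong_induction_on generalizing l l' with
  | _ n ih =>
    have hlen : l.length = l'.length := le_antisymm (hl _ h.symm) (hl' _ h)
    -- Words with the same last letter reduce to the shorter words in front of it.
    have hcancel : ∀ {p q : List b.support} {s : b.support}, IsReduced b (p ++ [s]) →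
        IsReduced b (q ++ [s]) → wordMap b (p ++ [s]) = wordMap b (q ++ [s]) →
        p.length < n → ((p ++ [s]).map f).prod = ((q ++ [s]).map f).prod := by
      intro p q s hp hq hpq hpn
      have hred : ∀ {p : List b.support}, IsReduced b (p ++ [s]) → IsReduced b p := by
        intro p hp p' hp'
        have := hp (p' ++ [s]) (by rw [wordMap_append, wordMap_append, hp'])
        simpa using this
      have e : wordMap b p = wordMap b q := by
        rw [wordMap_append, wordMap_append] at hpq
        exact mul_right_cancel hpq
      simp only [List.map_append, List.prod_append]
      rw [ih p.length hpn (hred hp) (hred hq) e rfl]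
    rcases List.eq_nil_or_concat l with rfl | ⟨p, s, rfl⟩
    · have : l' = [] := List.length_eq_zero_iff.1 (by simpa using hlen.symm)
      rw [this]
    rcases List.eq_nil_or_concat l' with rfl | ⟨q, u, rfl⟩
    · simp at hlen
    rw [List.concat_eq_append] at hl hn hlen h ⊢
    rw [List.concat_eq_append] at hl' hlen h ⊢
    have hpn : p.length + 1 = n := by simpa using hn
    have hqn : q.length + 1 = n := by rw [← hpn]; simpa using hlen.symm
    by_cases hsu : s = u
    · subst hsu
      exact hcancel hl hl' h (by omega)
    obtain ⟨m, hm, hA, hA', hW, hP⟩ := hf s u hsu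
    have hs := sendsNeg_of_reduced b hl
    have hu := sendsNeg_of_reduced b hl'
    rw [← h] at hu
    -- For distinct last letters, the element has two further reduced words, `k` followed by either
    -- side of the braid relation. Each of them shares its last letter with one of the given words.
    obtain ⟨k, h1, h2⟩ := exists_peel b hA hs hu m le_rfl
    have hlast : ∀ s u : b.support, ∃ r, (altWord b s u m).reverse = r ++ [s] := by
      intro s u
      obtain ⟨m', rfl⟩ : ∃ m', m = m' + 1 := ⟨m - 1, by omega⟩
      exact ⟨(altWord b u s m').reverse, by simp [altWord]⟩
    obtain ⟨r, hr⟩ := hlast s u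
    obtain ⟨r', hr'⟩ := hlast u s
    have hlr : r.length + 1 = m := by
      have := congrArg List.length hr
      simpa using this.symm
    have hlr' : r'.length + 1 = m := by
      have := congrArg List.length hr'
      simpa using this.symm
    have h3 : wordMap b (k ++ (altWord b u s m).reverse) = wordMap b (p ++ [s]) := by
      rw [← h2, wordMap_append, wordMap_append, hW]
    have red : ∀ {t t' : List b.support}, IsReduced b t → wordMap b t' = wordMap b t →
        t'.length = t.length → IsReduced b t' := by
      intro t t' ht e el t'' ht''
      rw [el]
      exact ht t'' (ht''.trans e)
    have h1' : k.length + m = p.length + 1 := by simpa using h1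
    have e1 : ((p ++ [s]).map f).prod = ((k ++ (altWord b s u m).reverse).map f).prod := by
      have hr1 := red hl h2 (by simp; omega)
      rw [hr, ← List.append_assoc] at h2 hr1 ⊢
      exact hcancel hl hr1 h2.symm (by omega)
    have e2 : ((q ++ [u]).map f).prod = ((k ++ (altWord b u s m).reverse).map f).prod := by
      have hr1 := red hl h3 (by simp; omega)
      rw [hr', ← List.append_assoc] at h3 hr1 ⊢
      exact hcancel hl' hr1 (h.symm.trans h3.symm) (by omega)
    rw [e1, e2]
    simp only [List.map_append, List.prod_append]
    rw [hP]

end Words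

end WilsonLines

end

/-! ### Lifts of Weyl group elements and their action on root vectors -/

noncomputable section

set_option linter.unusedSectionVars false

namespace WilsonLines

open LieAlgebra LieAlgebra.IsKilling

namespace Pinned

variable {𝔤 : Type*} [LieRing 𝔤] [LieAlgebra ℂ 𝔤] [FiniteDimensional ℂ 𝔤]
  [LieAlgebra.IsKilling ℂ 𝔤] {𝔥 : LieSubalgebra ℂ 𝔤} [𝔥.IsCartanSubalgebra] (D : Pinned 𝔥)

/-- The product of the `r̄_s` along a word. -/
def wBar (l : List D.base.support) : D.G := (l.map D.rBar).prod

@[simp] theorem wBar_nil : D.wBar [] = 1 := rfl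

@[simp] theorem wBar_cons (s : D.base.support) (l : List D.base.support) :
    D.wBar (s :: l) = D.rBar s * D.wBar l := List.prod_cons

theorem rBar_mem_rootSpace (s : D.base.support) {χ : Module.Dual ℂ 𝔥} {x : 𝔤}
    (hx : x ∈ rootSpace 𝔥 (χ : 𝔥 → ℂ)) :
    D.rBar s • x ∈ rootSpace 𝔥 ((rootSystem 𝔥).reflection s.1 χ : 𝔥 → ℂ) := by
  rw [rBar_eq_rTor]
  exact D.rTor_mem_rootSpace s one_ne_zero hx

theorem wBar_mem_rootSpace (l : List D.base.support) {χ : Module.Dual ℂ 𝔥} {x : 𝔤}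
    (hx : x ∈ rootSpace 𝔥 (χ : 𝔥 → ℂ)) :
    D.wBar l • x ∈ rootSpace 𝔥 (wordMap D.base l χ : 𝔥 → ℂ) := by
  induction l with
  | nil => simpa using hx
  | cons s l ih =>
    rw [wBar_cons, wordMap_cons, mul_smul, LinearEquiv.mul_apply]
    exact D.rBar_mem_rootSpace s ih

theorem reflection_apply_apply (s : D.base.support) (χ : Module.Dual ℂ 𝔥) (h : 𝔥) :
    (rootSystem 𝔥).reflection s.1 χ h = χ h - χ (D.hRoot s) * D.aRoot s h := rfl

theorem wBar_cartan (l : List D.base.support) (h : 𝔥) :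
    ∃ h' : 𝔥, D.wBar l • (h : 𝔤) = h' ∧ ∀ χ : Module.Dual ℂ 𝔥, wordMap D.base l χ h' = χ h := by
  induction l with
  | nil => exact ⟨h, by simp, fun χ => rfl⟩
  | cons s l ih =>
    obtain ⟨k, h1, h2⟩ := ih
    refine ⟨k - D.aRoot s k • D.hRoot s, ?_, fun χ => ?_⟩
    · rw [wBar_cons, mul_smul, h1, rBar_eq_rTor, D.rTor_cartan s one_ne_zero]
    · rw [wordMap_cons, LinearEquiv.mul_apply, ← h2, reflection_apply_apply, map_sub, map_smul,
        map_sub, map_smul, D.aRoot_hRoot, smul_eq_mul, smul_eq_mul]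
      ring

theorem xRoot_conj {g : D.G} {s u : D.base.support} (h : g • D.e s = D.e u) (t : ℂ) :
    g * D.xRoot s t = D.xRoot u t * g := by
  refine adjointGroup_ext fun v => ?_
  rw [mul_smul, mul_smul, xRoot_smul, xRoot_smul, ← h, ← adjointGroup_smul_smul,
    expEnd_ad_smul g (isNilpotent_smul' (D.nil_e s) t)]

theorem yRoot_conj {g : D.G} {s u : D.base.support} (h : g • D.f s = D.f u) (t : ℂ) :
    g * D.yRoot s t = D.yRoot u t * g := by
  refine adjointGroup_ext fun v => ?_
  rw [mul_smul, mul_smul, yRoot_smul, yRoot_smul, ← h, ← adjointGroup_smul_smul,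
    expEnd_ad_smul g (isNilpotent_smul' (D.nil_f s) t)]

/-- If `w̄` sends `e_s` to `e_u` then it conjugates `r̄_s` to `r̄_u`. -/
theorem wBar_mul_rBar {l : List D.base.support} {s u : D.base.support}
    (hw : wordMap D.base l (D.aRoot s) = D.aRoot u) (h : D.wBar l • D.e s = D.e u) :
    D.wBar l * D.rBar s = D.rBar u * D.wBar l := by
  have hf : D.wBar l • D.f s = D.f u := by
    obtain ⟨β, hβ⟩ := exists_neg_root_aux u.1
    have h1 : D.wBar l • D.f s ∈ rootSpace 𝔥 (β.1 : 𝔥 → ℂ) := by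
      have := D.wBar_mem_rootSpace l (χ := -D.aRoot s) (D.f_mem s)
      rw [map_neg, hw] at this
      rw [hβ]
      exact this
    have h2 : D.f u ∈ rootSpace 𝔥 (β.1 : 𝔥 → ℂ) := by
      rw [hβ]
      exact D.f_mem u
    -- The image of `f_s` is a multiple `c` of `f_u`. Bracketing with the image of `e_s` shows that
    -- `h_s` goes to `c h_u`, and a root is `2` on its coroot, so `c = 1`.
    obtain ⟨c, hc⟩ := exists_smul_eq_of_mem_rootSpace β h2 h1 (D.sl2' u).f_ne_zero
    obtain ⟨h', h3, h4⟩ := D.wBar_cartan l (D.hRoot s)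
    have h5 : h' = c • D.hRoot u := by
      refine Subtype.ext ?_
      rw [← h3, ← (D.sl2' s).lie_e_f, adjointGroup_smul_lie, h, ← hc, lie_smul,
        (D.sl2' u).lie_e_f]
      rfl
    have h6 := h4 (D.aRoot s)
    rw [hw, h5, map_smul, D.aRoot_hRoot, D.aRoot_hRoot, smul_eq_mul] at h6
    have h7 : c = 1 := mul_right_cancel₀ two_ne_zero (h6.trans (one_mul _).symm)
    rw [← hc, h7, one_smul]
  simp only [rBar]
  rw [← mul_assoc, ← mul_assoc, D.xRoot_conj h, mul_assoc _ _ (D.yRoot s 1), D.yRoot_conj hf,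
    ← mul_assoc, mul_assoc _ _ (D.xRoot s (-1)), D.xRoot_conj h, ← mul_assoc]

theorem rBar_rBar_smul (s : D.base.support) {α : 𝔥.root} {x : 𝔤}
    (hx : x ∈ rootSpace 𝔥 (α.1 : 𝔥 → ℂ)) {n : ℤ} (hn : α.1 (D.hRoot s) = n) :
    D.rBar s • D.rBar s • x = (-1 : ℂ) ^ n • x := by
  have h : α.1 ((Real.pi * Complex.I : ℂ) • D.hRoot s) = n * (Real.pi * Complex.I) := by
    have := ((rootSystem 𝔥).root α).map_smul (Real.pi * Complex.I : ℂ) (D.hRoot s)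
    change (rootSystem 𝔥).root α _ = _
    rw [this]
    change _ • α.1 (D.hRoot s) = _
    rw [hn, smul_eq_mul, mul_comm]
  rw [← mul_smul, (D.rBar_sq_isTorusExp s).2 α x hx, h, Complex.exp_int_mul, Complex.exp_pi_mul_I]

/-- Twice a root is not a root. This is how brackets are seen to vanish in the rank two
computations. -/
theorem eq_zero_of_mem_two (u : D.base.support) {χ : 𝔥 → ℂ} {x : 𝔤} (hx : x ∈ rootSpace 𝔥 χ)
    (hχ : χ = (2 : ℂ) • (D.aRoot u : 𝔥 → ℂ)) : x = 0 := by
  have h1 := rootSpace_two_smul (u.1 : 𝔥.root).1 (isNonZero_root u.1)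
  have h2 : χ = 2 • (((u.1 : 𝔥.root).1 : LieModule.Weight ℂ 𝔥 𝔤) : 𝔥 → ℂ) := by
    rw [hχ, two_smul, two_smul]
    rfl
  rw [h2, h1] at hx
  simpa using hx

theorem rBar_fix (s : D.base.support) {v : 𝔤} (hf : ⁅D.f s, v⁆ = 0)
    (hv : ⁅(D.hRoot s : 𝔤), v⁆ = 0) : D.rBar s • v = v := by
  rw [rBar_eq_rTor, D.rTor_lowest s one_ne_zero (a := 0) hf (by simp [hv])]
  simp

/-! ### Rank two: alternating lifts send simple root vectors to simple root vectors -/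

section RankTwo

variable {s u : D.base.support} (hsu : s ≠ u)

include hsu

theorem rBar_e {q : ℕ} (hq : D.aRoot s (D.hRoot u) = -(q : ℂ)) :
    D.rBar u • D.e s = ((-1) ^ q * (q.factorial : ℂ)⁻¹) • (ad ℂ 𝔤 (D.e u) ^ q) (D.e s) := by
  rw [rBar_eq_rTor, D.rTor_e_of_ne hsu one_ne_zero hq]

theorem braid_two (hq : D.aRoot s (D.hRoot u) = 0) : D.wBar [u] • D.e s = D.e s := by
  have := D.rBar_e hsu (q := 0) (by simp [hq])
  simp [this]

/-- Both `r̄_u e_s` and `r̄_s e_u` are brackets of `e_s` and `e_u`, with opposite signs, and `r̄_s²`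
acts on `e_u` by `-1`. -/
theorem braid_three (hq : D.aRoot s (D.hRoot u) = -1) (hp : D.aRoot u (D.hRoot s) = -1) :
    D.wBar [s, u] • D.e s = D.e u := by
  have h1 := D.rBar_e hsu (q := 1) (by simp [hq])
  have h2 := D.rBar_e hsu.symm (q := 1) (by simp [hp])
  have h3 : D.rBar u • D.e s = -(D.rBar s • D.e u) := by
    rw [h1, h2]
    simp only [pow_one, ad_apply, Nat.factorial, Nat.cast_one, inv_one, mul_one, neg_smul, one_smul,
      neg_neg, ← lie_skew (D.e s)]
  have h4 := D.rBar_rBar_smul s (D.e_mem u) (n := -1) (by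
    rw [← D.aRoot_apply, hp]
    simp)
  simp only [wBar_cons, wBar_nil, mul_one, mul_smul, h3, smul_neg, h4]
  norm_num

/-- The vector `r̄_u e_s` has weight `s + 2u`, which vanishes on `h_s`, and `f_s` would lower it to
weight `2u`. So `r̄_s` fixes it, and `r̄_u²` acts trivially on `e_s`. -/
theorem braid_four_long (hq : D.aRoot s (D.hRoot u) = -2) (hp : D.aRoot u (D.hRoot s) = -1) :
    D.wBar [u, s, u] • D.e s = D.e s := by
  have h0 : D.e s ∈ rootSpace 𝔥 (D.aRoot s : 𝔥 → ℂ) := D.e_mem s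
  have h1 := D.rBar_mem_rootSpace u h0
  have h2 : D.rBar s • D.rBar u • D.e s = D.rBar u • D.e s := by
    refine D.rBar_fix s ?_ ?_
    · refine D.eq_zero_of_mem_two u (lie_mem_rootSpace (D.f_mem s) h1) ?_
      funext k
      change -D.aRoot s k + (D.aRoot s k - D.aRoot s (D.hRoot u) * D.aRoot u k) = 2 * D.aRoot u k
      rw [hq]
      ring
    · rw [mem_rootSpace_iff.1 h1, reflection_apply_apply, D.aRoot_hRoot, hq, hp]
      norm_num
  have h4 := D.rBar_rBar_smul u (D.e_mem s) (n := -2) (by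
    rw [← D.aRoot_apply, hq]
    simp)
  simp only [wBar_cons, wBar_nil, mul_one, mul_smul, h2, h4]
  norm_num

/-- Now `⁅e_s, e_u⁆` is the middle of the string `u`, `u + s`, `u + 2s`, where `r̄_s` acts by `-1`;
this is computed by applying `r̄_s` to both factors of the bracket. The sign cancels that of `r̄_u²`
on `e_s`. -/
theorem braid_four_short (hq : D.aRoot s (D.hRoot u) = -1) (hp : D.aRoot u (D.hRoot s) = -2) :
    D.wBar [u, s, u] • D.e s = D.e s := by
  have h1 : D.rBar u • D.e s = ⁅D.e s, D.e u⁆ := by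
    rw [D.rBar_e hsu (q := 1) (by simp [hq]), ← lie_skew (D.e s)]
    simp
  have h3 := pow_ad_lowest_descend (D.sl2' s) (a := 2) (D.lie_f_e hsu.symm)
    (by rw [lie_cartan_e, hp]; norm_num) 1 (by norm_num)
  have h2 : D.rBar s • ⁅D.e s, D.e u⁆ = -⁅D.e s, D.e u⁆ := by
    rw [adjointGroup_smul_lie, D.rBar_e hsu.symm (q := 2) (by simp [hp]), rBar_eq_rTor,
      D.rTor_e s one_ne_zero, lie_smul, smul_lie]
    rw [pow_one, ad_apply] at h3
    rw [h3]
    norm_num [Nat.factorial, smul_smul]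
  have h4 := D.rBar_rBar_smul u (D.e_mem s) (n := -1) (by
    rw [← D.aRoot_apply, hq]
    simp)
  simp only [wBar_cons, wBar_nil, mul_one, mul_smul]
  rw [h1, h2, smul_neg, ← h1, h4]
  norm_num

/-- The vector `r̄_s r̄_u e_s` has weight `2s + qu`, which vanishes on `h_u`. Applying `f_u` would
give weight `2s` if `q = 1`, and `2s + 2u` if `q = 3`; `r̄_s` moves the latter to `2u`. So `f_u`
kills it and `r̄_u` fixes it. The remaining squares contribute two signs that cancel. -/
theorem braid_six {p q : ℕ} (hq : D.aRoot s (D.hRoot u) = -q) (hp : D.aRoot u (D.hRoot s) = -p)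
    (h : q = 1 ∧ p = 3 ∨ q = 3 ∧ p = 1) :
    D.wBar [u, s, u, s, u] • D.e s = D.e s := by
  have h0 : D.e s ∈ rootSpace 𝔥 (D.aRoot s : 𝔥 → ℂ) := D.e_mem s
  have h1 := D.rBar_mem_rootSpace u h0
  have h2 := D.rBar_mem_rootSpace s h1
  have h3 : D.rBar u • D.rBar s • D.rBar u • D.e s = D.rBar s • D.rBar u • D.e s := by
    refine D.rBar_fix u ?_ ?_
    · have h4 := lie_mem_rootSpace (D.f_mem u) h2
      rcases h with ⟨rfl, rfl⟩ | ⟨rfl, rfl⟩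
      · refine D.eq_zero_of_mem_two s h4 ?_
        funext k
        change -D.aRoot u k + _ = 2 * D.aRoot s k
        rw [reflection_apply_apply, reflection_apply_apply, reflection_apply_apply, hq, hp,
          D.aRoot_hRoot]
        push_cast
        ring
      · have h5 := D.rBar_mem_rootSpace s (χ := -D.aRoot u + (rootSystem 𝔥).reflection s.1
          ((rootSystem 𝔥).reflection u.1 (D.aRoot s))) h4
        have h6 := D.eq_zero_of_mem_two u h5 (by
          funext k
          change _ = 2 * D.aRoot u k
          simp only [reflection_apply_apply, LinearMap.add_apply, LinearMap.neg_apply, hq, hp,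
            D.aRoot_hRoot]
          push_cast
          ring)
        exact (smul_eq_zero_iff_eq _).1 h6
    · rw [mem_rootSpace_iff.1 h2]
      simp only [reflection_apply_apply, hq, hp, D.aRoot_hRoot]
      rcases h with ⟨rfl, rfl⟩ | ⟨rfl, rfl⟩ <;> norm_num
  have hpq : (p : ℂ) * q = 3 := by
    rcases h with ⟨rfl, rfl⟩ | ⟨rfl, rfl⟩ <;> norm_num
  have h4 := D.rBar_rBar_smul s (α := (rootSystem 𝔥).reflectionPerm u.1 s.1)
    (x := D.rBar u • D.e s) (n := -1) (by
      have := (rootSystem 𝔥).root_reflectionPerm u.1 s.1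
      have h' := h1
      change _ ∈ rootSpace 𝔥 (⇑((rootSystem 𝔥).root ((rootSystem 𝔥).reflectionPerm u.1 s.1)))
      rw [this]
      exact h') (by
      change (rootSystem 𝔥).root ((rootSystem 𝔥).reflectionPerm u.1 s.1) _ = _
      rw [(rootSystem 𝔥).root_reflectionPerm u.1 s.1]
      change (rootSystem 𝔥).reflection u.1 (D.aRoot s) _ = _
      rw [reflection_apply_apply, D.aRoot_hRoot, hq, hp, neg_mul_neg, mul_comm, hpq]
      norm_num)
  have h5 := D.rBar_rBar_smul u (D.e_mem s) (n := -q) (by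
    rw [← D.aRoot_apply, hq]
    simp)
  simp only [wBar_cons, wBar_nil, mul_one, mul_smul, h3, h4]
  rw [adjointGroup_smul_smul, h5]
  rcases h with ⟨rfl, rfl⟩ | ⟨rfl, rfl⟩ <;> norm_num

end RankTwo

end Pinned

end WilsonLines

end

/-! ### The braid relations -/

noncomputable section

set_option linter.unusedSectionVars false

namespace WilsonLines

open LieAlgebra LieAlgebra.IsKilling

namespace Pinned

variable {𝔤 : Type*} [LieRing 𝔤] [LieAlgebra ℂ 𝔤] [FiniteDimensional ℂ 𝔤]
  [LieAlgebra.IsKilling ℂ 𝔤] {𝔥 : LieSubalgebra ℂ 𝔤} [𝔥.IsCartanSubalgebra] (D : Pinned 𝔥)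

/-- The coefficients of the roots that an alternating word makes out of its next letter, for a pair of
simple roots with Cartan integers `-p` and `-q`. -/
def altCoeff : ℕ → ℕ → ℕ → ℤ × ℤ
  | _, _, 0 => (1, 0)
  | p, q, k + 1 => (p * (altCoeff q p k).1 - (altCoeff q p k).2, (altCoeff q p k).1)

theorem wordMap_altWord {s u : D.base.support} {p q : ℕ} (hq : D.aRoot s (D.hRoot u) = -q)
    (hp : D.aRoot u (D.hRoot s) = -p) (k : ℕ) :
    wordMap D.base (altWord D.base s u k) (D.aRoot (altNext D.base s u k)) =
      (altCoeff p q k).1 • D.aRoot s + (altCoeff p q k).2 • D.aRoot u := by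
  induction k generalizing s u p q with
  | zero => simp [altCoeff, altWord, altNext]
  | succ k ih =>
    rw [altWord, wordMap_cons, LinearEquiv.mul_apply, altNext, ih hp hq]
    ext h
    rw [reflection_apply_apply]
    simp only [LinearMap.add_apply, LinearMap.smul_apply, hp, D.aRoot_hRoot, altCoeff, zsmul_eq_mul]
    push_cast
    ring

theorem altPositive {s u : D.base.support} {p q : ℕ} (hq : D.aRoot s (D.hRoot u) = -q)
    (hp : D.aRoot u (D.hRoot s) = -p) {m : ℕ}
    (h : ∀ k < m, 0 ≤ (altCoeff p q k).1 ∧ 0 ≤ (altCoeff p q k).2) :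
    AltPositive D.base s u m := by
  intro k hk
  obtain ⟨x, hx⟩ := Int.eq_ofNat_of_zero_le (h k hk).1
  obtain ⟨y, hy⟩ := Int.eq_ofNat_of_zero_le (h k hk).2
  refine ⟨x, y, (D.wordMap_altWord hq hp k).trans ?_⟩
  rw [hx, hy, natCast_zsmul, natCast_zsmul]
  rfl

/-- The conclusion of the braid relation from a word `v` with `v.s = r.v` in both groups. -/
theorem braid_of_conj {s r : D.base.support} {v : List D.base.support}
    (hw : wordMap D.base v (D.aRoot s) = D.aRoot r) (h : D.wBar v • D.e s = D.e r) :
    wordMap D.base (v ++ [s]) = wordMap D.base (r :: v) ∧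
      ((v ++ [s]).map D.rBar).prod = ((r :: v).map D.rBar).prod := by
  constructor
  · have := wordMap_mul_reflection D.base (l := v) (i := s.1) (j := r.1) hw
    simpa using this
  · have := D.wBar_mul_rBar hw h
    simpa [wBar] using this

/-- In a reduced crystallographic root system two non-proportional roots have only a short list of
pairings; for simple roots these are nonpositive. -/
theorem cartan_integers {s u : D.base.support} (hsu : s ≠ u) :
    ∃ p q : ℕ, D.aRoot s (D.hRoot u) = -q ∧ D.aRoot u (D.hRoot s) = -p ∧
      ((p, q) = (0, 0) ∨ (p, q) = (1, 1) ∨ (p, q) = (1, 2) ∨ (p, q) = (2, 1) ∨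
        (p, q) = (1, 3) ∨ (p, q) = (3, 1)) := by
  obtain ⟨q, hq⟩ := D.pairing_nonpos hsu
  obtain ⟨p, hp⟩ := D.pairing_nonpos hsu.symm
  refine ⟨p, q, hq, hp, ?_⟩
  have h1 : (rootSystem 𝔥).pairingIn ℤ s.1 u.1 = -q := by
    have := (rootSystem 𝔥).algebraMap_pairingIn ℤ s.1 u.1
    have h2 : (rootSystem 𝔥).pairing s.1 u.1 = -q := hq
    rw [h2, eq_intCast] at this
    exact_mod_cast this
  have h2 : (rootSystem 𝔥).pairingIn ℤ u.1 s.1 = -p := by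
    have := (rootSystem 𝔥).algebraMap_pairingIn ℤ u.1 s.1
    have h2 : (rootSystem 𝔥).pairing u.1 s.1 = -p := hp
    rw [h2, eq_intCast] at this
    exact_mod_cast this
  have h3 : (rootSystem 𝔥).root s.1 ≠ (rootSystem 𝔥).root u.1 := fun e =>
    hsu (Subtype.ext ((rootSystem 𝔥).root.injective e))
  have h4 : (rootSystem 𝔥).root s.1 ≠ -(rootSystem 𝔥).root u.1 := fun e => by
    rw [← RootPairing.reflection_apply_self, ← RootPairing.root_reflectionPerm] at e
    have h5 : D.base.height ((rootSystem 𝔥).reflectionPerm u.1 u.1) = -D.base.height u.1 :=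
      D.base.height_reflectionPerm_self u.1
    have h6 := RootPairing.Base.height_one_of_mem_support s.2
    have h7 := RootPairing.Base.height_one_of_mem_support u.2
    rw [← (rootSystem 𝔥).root.injective e] at h5
    omega
  have h5 := (rootSystem 𝔥).pairingIn_pairingIn_mem_set_of_isCrystal_of_isRed' s.1 u.1 h3 h4
  rw [h1, h2] at h5
  simp only [Set.mem_insert_iff, Set.mem_singleton_iff, Prod.mk.injEq] at h5
  simp only [Prod.mk.injEq]
  omega

/-- The braid relations. -/
theorem braid_relation (s u : D.base.support) (hsu : s ≠ u) :
    ∃ m, 0 < m ∧ AltPositive D.base s u m ∧ AltPositive D.base u s m ∧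
      wordMap D.base (altWord D.base s u m).reverse =
        wordMap D.base (altWord D.base u s m).reverse ∧
      ((altWord D.base s u m).reverse.map D.rBar).prod =
        ((altWord D.base u s m).reverse.map D.rBar).prod := by
  obtain ⟨p, q, hq, hp, h⟩ := D.cartan_integers hsu
  have key : ∀ m, 0 < m → (∀ k < m, 0 ≤ (altCoeff p q k).1 ∧ 0 ≤ (altCoeff p q k).2) →
      (∀ k < m, 0 ≤ (altCoeff q p k).1 ∧ 0 ≤ (altCoeff q p k).2) →
      (wordMap D.base (altWord D.base s u m).reverse =
        wordMap D.base (altWord D.base u s m).reverse ∧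
      ((altWord D.base s u m).reverse.map D.rBar).prod =
        ((altWord D.base u s m).reverse.map D.rBar).prod) → ∃ m, 0 < m ∧
      AltPositive D.base s u m ∧ AltPositive D.base u s m ∧
      wordMap D.base (altWord D.base s u m).reverse =
        wordMap D.base (altWord D.base u s m).reverse ∧
      ((altWord D.base s u m).reverse.map D.rBar).prod =
        ((altWord D.base u s m).reverse.map D.rBar).prod := fun m h0 h1 h2 h3 =>
    ⟨m, h0, D.altPositive hq hp h1, D.altPositive hp hq h2, h3⟩
  -- The braid relation has length `2`, `3`, `4` or `6`. Its sides are `v ++ [s]` and `r :: v`,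
  -- where `v` carries the simple root `s` to `r`: `r = u` in length `3` and `r = s` otherwise.
  rcases h with h | h | h | h | h | h <;> obtain ⟨rfl, rfl⟩ := Prod.mk.inj h
  · refine key 2 (by norm_num) (by decide) (by decide) (D.braid_of_conj (v := [u]) ?_
      (D.braid_two hsu (by simpa using hq)))
    ext h
    simp [reflection_apply_apply, hq]
  · refine key 3 (by norm_num) (by decide) (by decide) (D.braid_of_conj (v := [s, u]) ?_
      (D.braid_three hsu (by simpa using hq) (by simpa using hp)))
    ext h
    simp [reflection_apply_apply, hq, hp, D.aRoot_hRoot]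
    try ring
  · refine key 4 (by norm_num) (by decide) (by decide) (D.braid_of_conj (v := [u, s, u]) ?_
      (D.braid_four_long hsu (by simpa using hq) (by simpa using hp)))
    ext h
    simp [reflection_apply_apply, hq, hp, D.aRoot_hRoot]
    try ring
  · refine key 4 (by norm_num) (by decide) (by decide) (D.braid_of_conj (v := [u, s, u]) ?_
      (D.braid_four_short hsu (by simpa using hq) (by simpa using hp)))
    ext h
    simp [reflection_apply_apply, hq, hp, D.aRoot_hRoot]
    try ring
  · refine key 6 (by norm_num) (by decide) (by decide) (D.braid_of_conj (v := [u, s, u, s, u]) ?_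
      (D.braid_six hsu hq hp (by simp)))
    ext h
    simp [reflection_apply_apply, hq, hp, D.aRoot_hRoot]
    try ring
  · refine key 6 (by norm_num) (by decide) (by decide) (D.braid_of_conj (v := [u, s, u, s, u]) ?_
      (D.braid_six hsu hq hp (by simp)))
    ext h
    simp [reflection_apply_apply, hq, hp, D.aRoot_hRoot]
    try ring

theorem wBar_eq_of_reduced {l l' : List D.base.support} (hl : IsReducedWord D.base l)
    (hl' : IsReducedWord D.base l') (h : wordMap D.base l = wordMap D.base l') :
    D.wBar l = D.wBar l' :=
  prod_eq_of_reduced D.base D.rBar D.braid_relation hl hl' h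

end Pinned

end WilsonLines

end

/-! ### `w̄₀² = 1`, the principal grading, and simple transitivity on pinnings -/

noncomputable section

set_option linter.unusedSectionVars false

namespace WilsonLines

open LieAlgebra LieAlgebra.IsKilling

namespace Pinned

variable {𝔤 : Type*} [LieRing 𝔤] [LieAlgebra ℂ 𝔤] [FiniteDimensional ℂ 𝔤]
  [LieAlgebra.IsKilling ℂ 𝔤] {𝔥 : LieSubalgebra ℂ 𝔤} [𝔥.IsCartanSubalgebra] (D : Pinned 𝔥)

/-- This is the half sum of positive coroots. Its eigenvalues on root spaces are the root heights.
-/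
theorem exists_rho : ∃ ρ : 𝔥, ∀ s, D.aRoot s ρ = 1 := by
  let φ : Module.Dual ℂ (Module.Dual ℂ 𝔥) := D.base.toWeightBasis.constr ℂ fun _ => (1 : ℂ)
  refine ⟨(Module.evalEquiv ℂ 𝔥).symm φ, fun s => ?_⟩
  rw [Module.apply_evalEquiv_symm_apply]
  have := D.base.toWeightBasis.constr_basis ℂ (fun _ => (1 : ℂ)) s
  rw [RootPairing.Base.toWeightBasis_apply] at this
  exact this

/-- The element of the Cartan subalgebra on which all simple roots take the value `1`. -/
def rho : 𝔥 := D.exists_rho.choose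

theorem aRoot_rho (s : D.base.support) : D.aRoot s D.rho = 1 := D.exists_rho.choose_spec s

theorem root_rho (α : 𝔥.root) : (rootSystem 𝔥).root α D.rho = D.base.height α := by
  obtain ⟨f, -, -, hf⟩ := D.base.exists_root_eq_sum_int α
  rw [RootPairing.Base.height_eq_sum hf, hf, LinearMap.sum_apply]
  push_cast
  refine Finset.sum_congr rfl fun s hs => ?_
  have := D.aRoot_rho ⟨s, hs⟩
  rw [LinearMap.smul_apply]
  change f s • D.aRoot ⟨s, hs⟩ D.rho = _
  rw [this]
  simp

theorem cartan_ext {h h' : 𝔥} (e : ∀ s, D.aRoot s h = D.aRoot s h') : h = h' := by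
  have : Module.Dual.eval ℂ 𝔥 h = Module.Dual.eval ℂ 𝔥 h' := by
    refine D.base.toWeightBasis.ext fun s => ?_
    rw [RootPairing.Base.toWeightBasis_apply]
    exact e s
  exact (Module.evalEquiv ℂ 𝔥).injective this

theorem height_word (s : D.base.support) : wordMap D.base D.word (D.aRoot s) D.rho = -1 := by
  have h := sendsNeg_of_longest D.base (l := D.word) D.word_reduced D.word_longest
  obtain ⟨j, h1, -⟩ := h s
  have h2 := height_longest D.base h s h1
  change wordMap D.base D.word ((rootSystem 𝔥).root s.1) D.rho = -1
  rw [h1, root_rho, h2]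
  norm_num

theorem wordMap_word_sq : wordMap D.base D.word * wordMap D.base D.word = 1 :=
  wordMap_longest_sq D.base (sendsNeg_of_longest D.base (l := D.word) D.word_reduced D.word_longest)

/-- With one more letter in front, the product becomes its conjugate by `r̄_s` times `r̄_s²`. So `η`
changes to its reflection plus `h_s`, which is how `ρ - w ρ` changes. -/
theorem exists_isTorusExp_wBar (l : List D.base.support) : ∃ η : 𝔥,
    IsTorusExp (D.wBar l * D.wBar l.reverse) ((Real.pi * Complex.I : ℂ) • η) ∧
      ∀ χ : Module.Dual ℂ 𝔥, χ η = χ D.rho - wordMap D.base l.reverse χ D.rho := by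
  induction l with
  | nil => exact ⟨0, by simpa using IsTorusExp.one, fun χ => by simp⟩
  | cons s l ih =>
    obtain ⟨η, h1, h2⟩ := ih
    refine ⟨η - D.aRoot s η • D.hRoot s + D.hRoot s, ?_, fun χ => ?_⟩
    · have h3 := (D.mem_H_conj_rTor s one_ne_zero h1).mul (D.rBar_sq_isTorusExp s)
      rw [← rBar_eq_rTor] at h3
      convert h3 using 1
      · simp [wBar, mul_assoc]
      · rw [map_smul, smul_add, smul_sub, smul_assoc]
    · have h3 := h2 ((rootSystem 𝔥).reflection s.1 χ)
      rw [reflection_apply_apply, reflection_apply_apply, D.aRoot_rho] at h3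
      rw [List.reverse_cons, wordMap_append, LinearEquiv.mul_apply, wordMap_cons, wordMap_nil,
        mul_one, map_add, map_sub, map_smul, smul_eq_mul]
      linear_combination h3

/-- The longest element is an involution, so the reversed word is another reduced word for it and
has the same lift. Hence `w̄₀²` is the exponential of `πi (ρ - w₀ ρ) = 2πi ρ`. It acts on every
simple root vector by `exp (2πi) = 1`, and elements of the adjoint group are determined by their
action. -/
theorem w0_mul_w0 : D.w0 * D.w0 = 1 := by
  have hrev : wordMap D.base D.word.reverse = wordMap D.base D.word := by
    rw [wordMap_reverse]
    exact inv_eq_of_mul_eq_one_left D.wordMap_word_sq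
  have h1 : D.wBar D.word = D.wBar D.word.reverse := by
    refine D.wBar_eq_of_reduced D.word_reduced ?_ hrev.symm
    intro l hl
    rw [List.length_reverse]
    exact D.word_reduced l (hl.trans hrev)
  obtain ⟨η, h2, h3⟩ := D.exists_isTorusExp_wBar D.word
  rw [← h1] at h2
  refine D.eq_one_of_mem_H (g := D.wBar D.word * D.wBar D.word) h2.1 fun s => ?_
  rw [h2.2 s.1 _ (D.e_mem s)]
  have h4 := h3 (D.aRoot s)
  rw [hrev, D.height_word, D.aRoot_rho] at h4
  have h5 : s.1.1 ((Real.pi * Complex.I : ℂ) • η) = 2 * Real.pi * Complex.I := by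
    change D.aRoot s _ = _
    rw [map_smul, h4, smul_eq_mul]
    ring
  rw [h5, Complex.exp_two_pi_mul_I, one_smul]

theorem w0_inv : D.w0⁻¹ = D.w0 := inv_eq_of_mul_eq_one_right D.w0_mul_w0

theorem w0_rho : D.w0 • (D.rho : 𝔤) = -(D.rho : 𝔤) := by
  obtain ⟨h', h1, h2⟩ := D.wBar_cartan D.word D.rho
  have : h' = -D.rho := by
    refine D.cartan_ext fun s => ?_
    have h3 := h2 (wordMap D.base D.word (D.aRoot s))
    rw [← LinearEquiv.mul_apply, D.wordMap_word_sq, D.height_word] at h3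
    rw [map_neg, D.aRoot_rho]
    exact h3
  change D.wBar D.word • (D.rho : 𝔤) = _
  rw [h1, this]
  rfl

/-! ### The principal grading -/

/-- The principal grading of the Lie algebra. -/
def grade (n : ℤ) : Submodule ℂ 𝔤 := Module.End.eigenspace (ad ℂ 𝔤 (D.rho : 𝔤)) (n : ℂ)

/-- The ascending part of the filtration of the principal grading. -/
def gradeGE (a : ℤ) : Submodule ℂ 𝔤 := ⨆ n ∈ Set.Ici a, D.grade n

/-- The descending part of the filtration of the principal grading. -/
def gradeLE (a : ℤ) : Submodule ℂ 𝔤 := ⨆ n ∈ Set.Iic a, D.grade n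

theorem mem_grade {n : ℤ} {v : 𝔤} : v ∈ D.grade n ↔ ⁅(D.rho : 𝔤), v⁆ = (n : ℂ) • v :=
  Module.End.mem_eigenspace_iff

theorem grade_le_gradeGE {a n : ℤ} (h : a ≤ n) : D.grade n ≤ D.gradeGE a :=
  le_iSup₂_of_le n h le_rfl

theorem grade_le_gradeLE {a n : ℤ} (h : n ≤ a) : D.grade n ≤ D.gradeLE a :=
  le_iSup₂_of_le n h le_rfl

theorem gradeGE_anti {a a' : ℤ} (h : a ≤ a') : D.gradeGE a' ≤ D.gradeGE a :=
  iSup₂_le fun _ hn => D.grade_le_gradeGE (h.trans hn)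

theorem disjoint_gradeGE_gradeLE {a : ℤ} : Disjoint (D.gradeGE (a + 1)) (D.gradeLE a) := by
  have h1 : iSupIndep D.grade :=
    (Module.End.eigenspaces_iSupIndep (ad ℂ 𝔤 (D.rho : 𝔤))).comp (Int.cast_injective (α := ℂ))
  refine h1.disjoint_biSup_biSup ?_
  rw [Set.disjoint_left]
  intro n h2 h3
  simp only [Set.mem_Ici, Set.mem_Iic] at h2 h3
  omega

theorem forall_of_grade (p : Submodule ℂ 𝔤) (h : ∀ n, D.grade n ≤ p) (x : 𝔤) : x ∈ p := by
  refine forall_of_rootSpaces (𝔥 := 𝔥) p (fun k => h 0 ?_) (fun α y hy => h (D.base.height α) ?_) x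
  · rw [mem_grade, cartan_lie_cartan]
    simp
  · rw [mem_grade, mem_rootSpace_iff.1 hy, ← D.root_rho]
    rfl

theorem smul_mem_grade_of_mem_H {g : D.G} (hg : g ∈ D.H) {n : ℤ} {v : 𝔤} (hv : v ∈ D.grade n) :
    g • v ∈ D.grade n := by
  rw [mem_grade] at hv ⊢
  conv_lhs => rw [← D.mem_H_iff.1 hg D.rho]
  rw [← adjointGroup_smul_lie, hv, adjointGroup_smul_smul]

theorem w0_smul_mem_grade {n : ℤ} {v : 𝔤} (hv : v ∈ D.grade n) : D.w0 • v ∈ D.grade (-n) := by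
  rw [mem_grade] at hv ⊢
  have : (D.rho : 𝔤) = -(D.w0 • (D.rho : 𝔤)) := by rw [w0_rho, neg_neg]
  conv_lhs => rw [this]
  rw [neg_lie, ← adjointGroup_smul_lie, hv, adjointGroup_smul_smul]
  simp

/-- The endomorphism of the Lie algebra given by an element of the group. -/
abbrev lin (g : D.G) : Module.End ℂ 𝔤 := (g.1 : Module.End ℂ 𝔤)

theorem w0_smul_mem_gradeLE {a : ℤ} {v : 𝔤} (hv : v ∈ D.gradeGE a) : D.w0 • v ∈ D.gradeLE (-a) := by
  have : D.gradeGE a ≤ (D.gradeLE (-a)).comap (D.lin D.w0) :=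
    iSup₂_le fun n hn v hv => D.grade_le_gradeLE (neg_le_neg hn) (D.w0_smul_mem_grade hv)
  exact this hv

theorem H_smul_mem_gradeGE {g : D.G} (hg : g ∈ D.H) {a : ℤ} {v : 𝔤} (hv : v ∈ D.gradeGE a) :
    g • v ∈ D.gradeGE a := by
  have : D.gradeGE a ≤ (D.gradeGE a).comap (D.lin g) :=
    iSup₂_le fun n hn v hv => D.grade_le_gradeGE hn (D.smul_mem_grade_of_mem_H hg hv)
  exact this hv

theorem ad_mem_gradeGE {α : 𝔥.root} (hα : D.base.IsPos α) {x : 𝔤}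
    (hx : x ∈ rootSpace 𝔥 (α.1 : 𝔥 → ℂ)) {a : ℤ} {v : 𝔤} (hv : v ∈ D.gradeGE a) :
    ad ℂ 𝔤 x v ∈ D.gradeGE (a + 1) := by
  have : D.gradeGE a ≤ (D.gradeGE (a + 1)).comap (ad ℂ 𝔤 x) := by
    refine iSup₂_le fun n hn v hv => ?_
    have h1 : 0 < D.base.height α := (RootPairing.Base.isPos_iff _).1 hα
    have h2 : a ≤ n := hn
    refine D.grade_le_gradeGE (n := D.base.height α + n) (by omega) ?_
    have h3 : ⁅(D.rho : 𝔤), x⁆ = (D.base.height α : ℂ) • x := by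
      rw [mem_rootSpace_iff.1 hx, ← D.root_rho]
      rfl
    rw [mem_grade] at hv ⊢
    rw [ad_apply, leibniz_lie, h3, hv, smul_lie, lie_smul]
    push_cast
    rw [add_smul]
  exact this hv

theorem expEnd_sub_mem_gradeGE {α : 𝔥.root} (hα : D.base.IsPos α) {x : 𝔤}
    (hx : x ∈ rootSpace 𝔥 (α.1 : 𝔥 → ℂ)) {a : ℤ} {v : 𝔤} (hv : v ∈ D.gradeGE a) :
    expEnd (ad ℂ 𝔤 x) v - v ∈ D.gradeGE (a + 1) := by
  have hN := LieAlgebra.isNilpotent_ad_of_mem_rootSpace 𝔥 (root_ne_zero_aux α) hx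
  obtain ⟨n, hn⟩ := hN
  have h1 : ∀ k : ℕ, (ad ℂ 𝔤 x ^ k) v ∈ D.gradeGE a := by
    intro k
    induction k with
    | zero => simpa using hv
    | succ k ih =>
      rw [pow_succ', Module.End.mul_apply]
      exact D.gradeGE_anti (by omega) (D.ad_mem_gradeGE hα hx ih)
  rw [expEnd_apply ⟨n, hn⟩ (n := n + 1) (by rw [pow_succ, hn, zero_mul]; rfl),
    Finset.sum_range_succ']
  simp only [Nat.factorial_zero, Nat.cast_one, inv_one, pow_zero, Module.End.one_apply, one_smul,
    add_sub_cancel_right]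
  refine Submodule.sum_mem _ fun k _ => Submodule.smul_mem _ _ ?_
  rw [pow_succ', Module.End.mul_apply]
  exact D.ad_mem_gradeGE hα hx (h1 k)

/-- An injective endomorphism of a finite-dimensional subspace is onto, so stability under `g` gives
stability under its inverse. -/
theorem inv_mem_gradeGE {g : D.G} (h : ∀ a, ∀ v ∈ D.gradeGE a, g • v ∈ D.gradeGE a) {a : ℤ} {v : 𝔤}
    (hv : v ∈ D.gradeGE a) : g⁻¹ • v ∈ D.gradeGE a := by
  have h1 : Function.Injective ((D.lin g).restrict (h a)) := by
    intro x y hxy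
    have : g • (x : 𝔤) = g • (y : 𝔤) := congrArg Subtype.val hxy
    exact Subtype.ext (smul_left_cancel g this)
  obtain ⟨w, hw⟩ := (LinearMap.injective_iff_surjective.1 h1) ⟨v, hv⟩
  have : g • (w : 𝔤) = v := congrArg Subtype.val hw
  rw [← this, inv_smul_smul]
  exact w.2

/-- A positive root vector raises the degree by its height, so only the constant term of its
exponential fails to raise the filtration. The property passes to products and inverses. -/
theorem U_smul_sub_mem {g : D.G} (hg : g ∈ D.U) :
    ∀ a, ∀ v ∈ D.gradeGE a, g • v - v ∈ D.gradeGE (a + 1) := by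
  have key : ∀ {g : D.G}, (∀ a, ∀ v ∈ D.gradeGE a, g • v - v ∈ D.gradeGE (a + 1)) →
      ∀ a, ∀ v ∈ D.gradeGE a, g • v ∈ D.gradeGE a := fun {g} h a v hv => by
    have := add_mem (D.gradeGE_anti (by omega) (h a v hv)) hv
    rwa [sub_add_cancel] at this
  induction hg using Subgroup.closure_induction with
  | mem g hg =>
    obtain ⟨α, hα, x, hx, e⟩ := hg
    intro a v hv
    have := D.expEnd_sub_mem_gradeGE hα hx hv
    rw [← e] at this
    exact this
  | one => intro a v _; simp
  | mul g g' _ _ h h' =>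
    intro a v hv
    have := add_mem (h a _ (key h' a v hv)) (h' a v hv)
    rwa [sub_add_sub_cancel, ← mul_smul] at this
  | inv g _ h =>
    intro a v hv
    have h1 := D.inv_mem_gradeGE (key h) (h a v hv)
    rw [smul_sub, inv_smul_smul, ← neg_mem_iff, neg_sub] at h1
    exact h1

theorem U_smul_mem {g : D.G} (hg : g ∈ D.U) {a : ℤ} {v : 𝔤} (hv : v ∈ D.gradeGE a) :
    g • v ∈ D.gradeGE a := by
  have := add_mem (D.gradeGE_anti (by omega) (D.U_smul_sub_mem hg a v hv)) hv
  rwa [sub_add_cancel] at this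

theorem B_smul_mem {g : D.G} (hg : g ∈ D.B) {a : ℤ} {v : 𝔤} (hv : v ∈ D.gradeGE a) :
    g • v ∈ D.gradeGE a := by
  let K : Subgroup D.G :=
    { carrier := {g | ∀ a, ∀ v ∈ D.gradeGE a, g • v ∈ D.gradeGE a}
      mul_mem' := fun {g g'} h h' a v hv => by
        rw [mul_smul]
        exact h _ _ (h' _ _ hv)
      one_mem' := fun a v hv => by rwa [one_smul]
      inv_mem' := fun {g} h a v hv => D.inv_mem_gradeGE h hv }
  have : D.B ≤ K := sup_le (fun g hg a v hv => D.H_smul_mem_gradeGE hg hv)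
    (fun g hg a v hv => D.U_smul_mem hg hv)
  exact this hg a v hv

/-- The unipotent subgroup meets the opposite Borel subgroup trivially. -/
theorem eq_one_of_mem_U {g : D.G} (hg : g ∈ D.U) (h : D.w0⁻¹ * g * D.w0 ∈ D.B) : g = 1 := by
  refine adjointGroup_ext fun v => ?_
  rw [one_smul, ← sub_eq_zero]
  have : v ∈ LinearMap.ker (D.lin g - 1) := by
    refine D.forall_of_grade _ (fun n v hv => ?_) v
    -- For `v` of degree `n`, membership in `U⁺` puts `g v - v` in degrees above `n`. Since `w̄₀`
    -- reverses degrees, the hypothesis puts it in degrees at most `n`. The difference therefore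
    -- vanishes.
    have h1 := D.U_smul_sub_mem hg n v (D.grade_le_gradeGE le_rfl hv)
    have h2 := D.w0_smul_mem_gradeLE (D.B_smul_mem h
      (D.grade_le_gradeGE le_rfl (D.w0_smul_mem_grade hv)))
    rw [← mul_smul, ← mul_smul, w0_inv, mul_assoc, mul_assoc, mul_assoc, D.w0_mul_w0, mul_one,
      ← mul_assoc, D.w0_mul_w0, one_mul, neg_neg] at h2
    have h3 := sub_mem h2 (D.grade_le_gradeLE le_rfl hv)
    exact Submodule.disjoint_def.1 D.disjoint_gradeGE_gradeLE _ h1 h3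
  exact this

/-! ### Pinnings -/

theorem conj_mem_U {h u : D.G} (hh : h ∈ D.H) (hu : u ∈ D.U) : h * u * h⁻¹ ∈ D.U := by
  have : D.U ≤ D.U.comap (MulAut.conj h).toMonoidHom := by
    refine (Subgroup.closure_le _).2 ?_
    rintro g ⟨α, hα, x, hx, e⟩
    refine Subgroup.subset_closure ⟨α, hα, h • x, D.smul_mem_rootSpace_of_mem_H hh hx, ?_⟩
    ext v
    have h1 := expEnd_ad_smul h
      (LieAlgebra.isNilpotent_ad_of_mem_rootSpace 𝔥 (root_ne_zero_aux α) hx) (h⁻¹ • v)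
    rw [smul_inv_smul] at h1
    rw [h1, ← e]
    rfl
  exact this hu

/-- The Cartan subgroup preserves root spaces, hence normalizes `U⁺`, and the join of the two is
their product set. -/
theorem exists_mul_of_mem_B {g : D.G} (hg : g ∈ D.B) : ∃ h ∈ D.H, ∃ u ∈ D.U, h * u = g := by
  have h1 : D.H ≤ Subgroup.normalizer (D.U : Set D.G) := by
    intro h hh
    rw [Subgroup.mem_normalizer_iff]
    refine fun u => ⟨fun hu => D.conj_mem_U hh hu, fun hu => ?_⟩
    have := D.conj_mem_U (inv_mem hh) hu
    simpa [mul_assoc] using this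
  have h2 := Subgroup.coe_mul_of_left_le_normalizer_right _ _ h1
  have h3 : g ∈ ((D.H ⊔ D.U : Subgroup D.G) : Set D.G) := hg
  rw [h2] at h3
  obtain ⟨h, hh, u, hu, e⟩ := h3
  exact ⟨h, hh, u, hu, e⟩

theorem w0_conj_mem_H {h : D.G} (hh : h ∈ D.H) : D.w0⁻¹ * h * D.w0 ∈ D.H := by
  intro k
  obtain ⟨k', h1, -⟩ := D.wBar_cartan D.word k
  have h2 : D.w0 • (k : 𝔤) = k' := h1
  change (D.w0⁻¹ * h * D.w0) • (k : 𝔤) = k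
  rw [mul_smul, mul_smul, h2, D.mem_H_iff.1 hh, ← h2, inv_smul_smul]

theorem flag_eq_iff {a b : D.G} :
    (((a : D.G) : D.G ⧸ D.B) : D.Flag) = ((b : D.G) : D.G ⧸ D.B) ↔ a⁻¹ * b ∈ D.B := QuotientGroup.eq

/-- For existence, move the two flags to the standard pair; the decorated flag is then corrected by
an element of `H`, which fixes the flag of `B⁻`. For uniqueness, the stabilizer of the standard
pinning is `U⁺ ∩ B⁻ = 1`. -/
theorem existsUnique_smul_pStd (φ : D.Pinning) : ∃! g : D.G, g • D.pStd = φ := by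
  refine existsUnique_of_exists_of_unique ?_ ?_
  · obtain ⟨⟨A, F⟩, k, h1, h2⟩ := φ
    induction A using QuotientGroup.induction_on with
    | H a =>
    have h3 : k * a ∈ D.B := by
      have := D.flag_eq_iff.1 h1
      rw [mul_one] at this
      exact inv_mem_iff.1 this
    obtain ⟨h, hh, u, hu, e⟩ := D.exists_mul_of_mem_B h3
    refine ⟨k⁻¹ * h, Subtype.ext (Prod.ext ?_ ?_)⟩
    · refine QuotientGroup.eq.2 ?_
      have : ((k⁻¹ * h) • (1 : D.G))⁻¹ * a = u := by
        rw [smul_eq_mul, mul_one, mul_inv_rev, inv_inv, mul_assoc, ← e, inv_mul_cancel_left]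
      rw [this]
      exact hu
    · have h4 : h • D.flagMinus = D.flagMinus := by
        refine D.flag_eq_iff.2 ?_
        have := D.w0_conj_mem_H (inv_mem hh)
        change (h * D.w0)⁻¹ * D.w0 ∈ D.B
        rw [mul_inv_rev]
        exact (le_sup_left : D.H ≤ D.B) this
      change (k⁻¹ * h) • D.flagMinus = F
      rw [mul_smul, h4, inv_smul_eq_iff]
      exact h2.symm
  · intro g g' h h'
    rw [← h'] at h
    have h1 : (g'⁻¹ * g) • D.pStd = D.pStd := by rw [mul_smul, h, inv_smul_smul]
    have h2 := congrArg (fun p : D.Pinning => p.1.1) h1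
    have h3 := congrArg (fun p : D.Pinning => p.1.2) h1
    have h4 : g'⁻¹ * g ∈ D.U := by
      have : (g'⁻¹ * g * 1)⁻¹ * 1 ∈ D.U := QuotientGroup.eq.1 h2
      rw [mul_one, mul_one] at this
      exact inv_mem_iff.1 this
    have h5 : D.w0⁻¹ * (g'⁻¹ * g) * D.w0 ∈ D.B := by
      have : D.w0⁻¹ * (g'⁻¹ * g * D.w0) ∈ D.B := D.flag_eq_iff.1 h3.symm
      rwa [← mul_assoc] at this
    have := D.eq_one_of_mem_U h4 h5
    exact (inv_mul_eq_one.1 this).symm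

theorem elt_smul_pStd (φ : D.Pinning) : D.elt φ • D.pStd = φ := by
  have h := (D.existsUnique_smul_pStd φ).exists
  rw [elt, dif_pos h]
  exact h.choose_spec

theorem elt_smul (g : D.G) (φ : D.Pinning) : D.elt (g • φ) = g * D.elt φ :=
  (D.existsUnique_smul_pStd (g • φ)).unique (D.elt_smul_pStd _)
    (by rw [mul_smul, elt_smul_pStd])

theorem elt_pStd (g : D.G) : D.elt (g • D.pStd) = g :=
  (D.existsUnique_smul_pStd (g • D.pStd)).unique (D.elt_smul_pStd _) rfl

end Pinned

end WilsonLines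

end

/-! ### Points of finitely generated algebras, and the coordinate ring of a torus -/

noncomputable section

set_option linter.unusedSectionVars false

namespace WilsonLines

section CommutativeAlgebra

variable {A L : Type*} [CommRing A] [CommRing L] [Algebra ℂ A] [Algebra ℂ L]

/-- A maximal ideal of a finitely generated complex algebra is the kernel of a point. -/
theorem exists_algHom_of_isMaximal [Algebra.FiniteType ℂ A] (q : Ideal A) [q.IsMaximal] :
    ∃ ψ : A →ₐ[ℂ] ℂ, RingHom.ker ψ = q := by
  let _ : Field (A ⧸ q) := Ideal.Quotient.field q
  have : Algebra.FiniteType ℂ (A ⧸ q) := inferInstance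
  have : Module.Finite ℂ (A ⧸ q) := finite_of_finite_type_of_isJacobsonRing ℂ (A ⧸ q)
  have hb := IsAlgClosed.algebraMap_bijective_of_isIntegral (k := ℂ) (K := A ⧸ q)
  let e : ℂ ≃ₐ[ℂ] (A ⧸ q) := AlgEquiv.ofBijective (Algebra.ofId ℂ (A ⧸ q)) hb
  refine ⟨e.symm.toAlgHom.comp (Ideal.Quotient.mkₐ ℂ q), ?_⟩
  ext x
  rw [RingHom.mem_ker]
  change e.symm (Ideal.Quotient.mk q x) = 0 ↔ _
  rw [map_eq_zero_iff e.symm e.symm.injective, Ideal.Quotient.eq_zero_iff_mem]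

/-- The element `f - χ(f)` lies in the kernel of `χ`, hence in that of `χ'`. -/
theorem algHom_eq_of_ker_le {χ χ' : A →ₐ[ℂ] ℂ} (h : ∀ f, χ f = 0 → χ' f = 0) : χ' = χ := by
  ext f
  have := h (f - algebraMap ℂ A (χ f)) (by simp)
  simpa [sub_eq_zero] using this

/-- For an injective homomorphism of finitely generated domains, the points of a non-empty open set
extend. -/
theorem exists_ne_zero_extension [IsDomain A] [IsDomain L] [Algebra.FiniteType ℂ A]
    [Algebra.FiniteType ℂ L] (φ : A →ₐ[ℂ] L) (hφ : Function.Injective φ) :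
    ∃ a : A, a ≠ 0 ∧ ∀ χ : A →ₐ[ℂ] ℂ, χ a ≠ 0 → ∃ ψ : L →ₐ[ℂ] ℂ, ψ.comp φ = χ := by
  have : IsNoetherianRing A := Algebra.FiniteType.isNoetherianRing ℂ A
  have h1 : φ.toRingHom.FiniteType := by
    have : (φ.toRingHom.comp (algebraMap ℂ A)).FiniteType := by
      have e : φ.toRingHom.comp (algebraMap ℂ A) = algebraMap ℂ L := φ.comp_algebraMap
      rw [e]
      exact RingHom.finiteType_algebraMap.2 inferInstance
    exact RingHom.FiniteType.of_comp_finiteType this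
  -- Chevalley's theorem: the image on spectra is constructible, and it contains the generic point
  -- because `φ` is injective.
  have h2 := PrimeSpectrum.isConstructible_range_comap (RingHom.FinitePresentation.of_finiteType.1 h1)
  obtain ⟨T, hT⟩ := PrimeSpectrum.exists_constructibleSetData_iff.2 h2
  have h3 : (⊥ : PrimeSpectrum A) ∈ T.toSet := by
    rw [hT]
    refine ⟨⊥, ?_⟩
    ext x
    rw [PrimeSpectrum.comap_asIdeal, Ideal.mem_comap]
    change φ x = 0 ↔ x = 0
    exact map_eq_zero_iff φ hφ
  simp only [PrimeSpectrum.ConstructibleSetData.toSet, Set.mem_iUnion] at h3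
  -- The locally closed piece through the generic point has only zero equations, so it is the basic
  -- open set of `C.f`, with `C.f` nonzero.
  obtain ⟨C, hC, h4, h5⟩ := h3
  refine ⟨C.f, fun h0 => h5 (by
    rw [h0]
    simp), fun χ hχ => ?_⟩
  have hmax : (RingHom.ker χ).IsMaximal := RingHom.ker_isMaximal_of_surjective _
    (fun z => ⟨algebraMap ℂ A z, by simp⟩)
  have h6 : (⟨RingHom.ker χ, hmax.isPrime⟩ : PrimeSpectrum A) ∈ Set.range
      (PrimeSpectrum.comap φ.toRingHom) := by
    rw [← hT]
    simp only [PrimeSpectrum.ConstructibleSetData.toSet, Set.mem_iUnion]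
    refine ⟨C, hC, ?_, fun h => hχ ?_⟩
    · rintro x ⟨i, rfl⟩
      have : C.g i = 0 := h4 ⟨i, rfl⟩
      change C.g i ∈ RingHom.ker χ
      rw [this]
      exact Ideal.zero_mem _
    · exact h rfl
  obtain ⟨q, hq⟩ := h6
  -- A prime over the kernel of `χ` is enlarged to a maximal one. Its contraction still contains
  -- that kernel, which is enough by `algHom_eq_of_ker_le`.
  obtain ⟨q', h7, h8⟩ := Ideal.exists_le_maximal q.asIdeal q.2.ne_top
  obtain ⟨ψ, hψ⟩ := exists_algHom_of_isMaximal q'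
  refine ⟨ψ, algHom_eq_of_ker_le fun f hf => ?_⟩
  have h9 : f ∈ (PrimeSpectrum.comap φ.toRingHom q).asIdeal := by
    rw [hq]
    exact hf
  have h10 : φ f ∈ RingHom.ker ψ := by
    rw [hψ]
    exact h8 h9
  exact h10

end CommutativeAlgebra

section Laurent

/-- The algebra of functions on a torus generated by the coordinates and their inverses. -/
def laurent (ι : Type*) : Subalgebra ℂ ((ι → ℂˣ) → ℂ) :=
  Algebra.adjoin ℂ (Set.range (fun i t => (t i : ℂ)) ∪ Set.range (fun i t => ((t i)⁻¹ : ℂˣ)))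

variable {ι : Type*}

theorem coord_mem_laurent (i : ι) : (fun t : ι → ℂˣ => (t i : ℂ)) ∈ laurent ι :=
  Algebra.subset_adjoin (Or.inl ⟨i, rfl⟩)

theorem coord_inv_mem_laurent (i : ι) : (fun t : ι → ℂˣ => ((t i)⁻¹ : ℂˣ).1) ∈ laurent ι :=
  Algebra.subset_adjoin (Or.inr ⟨i, rfl⟩)

theorem laurent_comp {κ : Type*} (σ : κ → ι) {f : (κ → ℂˣ) → ℂ} (hf : f ∈ laurent κ) :
    (fun t : ι → ℂˣ => f fun k => t (σ k)) ∈ laurent ι := by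
  induction hf using Algebra.adjoin_induction with
  | mem f hf =>
    rcases hf with ⟨i, rfl⟩ | ⟨i, rfl⟩
    · exact coord_mem_laurent (σ i)
    · exact coord_inv_mem_laurent (σ i)
  | algebraMap r => exact (laurent ι).algebraMap_mem r
  | add f g _ _ hf hg => exact add_mem hf hg
  | mul f g _ _ hf hg => exact mul_mem hf hg

instance finiteType_laurent [Finite ι] : Algebra.FiniteType ℂ (laurent ι) := by
  rw [← Subalgebra.fg_iff_finiteType]
  exact Subalgebra.fg_def.2 ⟨_, (Set.finite_range _).union (Set.finite_range _), rfl⟩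

/-- A common power of all coordinates clears the denominators. This reduces the absence of zero
divisors to polynomials. -/
theorem exists_polynomial [Fintype ι] {f : (ι → ℂˣ) → ℂ} (hf : f ∈ laurent ι) :
    ∃ (k : ℕ) (Q : MvPolynomial ι ℂ), ∀ t : ι → ℂˣ,
      f t * MvPolynomial.eval (fun i => (t i : ℂ)) ((∏ i, MvPolynomial.X i) ^ k) =
        MvPolynomial.eval (fun i => (t i : ℂ)) Q := by
  classical
  induction hf using Algebra.adjoin_induction with
  | mem f hf =>
    rcases hf with ⟨i, rfl⟩ | ⟨i, rfl⟩
    · exact ⟨0, MvPolynomial.X i, fun t => by simp⟩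
    · refine ⟨1, ∏ j ∈ Finset.univ.erase i, MvPolynomial.X j, fun t => ?_⟩
      rw [pow_one, ← Finset.mul_prod_erase Finset.univ _ (Finset.mem_univ i), map_mul, ← mul_assoc]
      simp
  | algebraMap r => exact ⟨0, MvPolynomial.C r, fun t => by simp⟩
  | add f g _ _ hf hg =>
    obtain ⟨k, Q, h⟩ := hf
    obtain ⟨k', Q', h'⟩ := hg
    refine ⟨k + k', Q * (∏ i, MvPolynomial.X i) ^ k' + Q' * (∏ i, MvPolynomial.X i) ^ k, fun t => ?_⟩
    rw [map_add, map_mul, map_mul, ← h, ← h', pow_add, map_mul, Pi.add_apply]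
    ring
  | mul f g _ _ hf hg =>
    obtain ⟨k, Q, h⟩ := hf
    obtain ⟨k', Q', h'⟩ := hg
    refine ⟨k + k', Q * Q', fun t => ?_⟩
    rw [map_mul, ← h, ← h', pow_add, map_mul, Pi.mul_apply]
    ring

instance isDomain_laurent [Finite ι] : IsDomain (laurent ι) := by
  have := Fintype.ofFinite ι
  have hne : ∀ (t : ι → ℂˣ) (k : ℕ),
      MvPolynomial.eval (fun i => (t i : ℂ)) ((∏ i, MvPolynomial.X i) ^ k) ≠ 0 := fun t k => by
    rw [map_pow, map_prod]
    exact pow_ne_zero _ (Finset.prod_ne_zero_iff.2 fun i _ => by simp)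
  have : NoZeroDivisors (laurent ι) := by
    refine ⟨fun {f g} hfg => ?_⟩
    obtain ⟨k, Q, h⟩ := exists_polynomial f.2
    obtain ⟨k', Q', h'⟩ := exists_polynomial g.2
    -- The extra product of the coordinates makes the polynomial vanish off the torus as well.
    have h1 : Q * Q' * ∏ i, MvPolynomial.X i = 0 := by
      refine MvPolynomial.funext fun c => ?_
      rw [map_mul, map_prod, map_zero]
      by_cases hc : ∃ i, c i = 0
      · obtain ⟨i, hi⟩ := hc
        rw [Finset.prod_eq_zero (Finset.mem_univ i) (by simpa using hi), mul_zero]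
      · push Not at hc
        have h2 := h fun i => Units.mk0 (c i) (hc i)
        have h3 := h' fun i => Units.mk0 (c i) (hc i)
        have h4 : f.1 (fun i => Units.mk0 (c i) (hc i)) * g.1 (fun i => Units.mk0 (c i) (hc i)) = 0 :=
          congrFun (congrArg Subtype.val hfg) fun i => Units.mk0 (c i) (hc i)
        simp only [Units.val_mk0] at h2 h3
        rw [map_mul, ← h2, ← h3, mul_mul_mul_comm, h4, zero_mul, zero_mul]
    have key : ∀ (f : laurent ι) (k : ℕ), (∀ t : ι → ℂˣ, f.1 t *
        MvPolynomial.eval (fun i => (t i : ℂ)) ((∏ i, MvPolynomial.X i) ^ k) = 0) → f = 0 :=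
      fun f k hf => Subtype.ext (funext fun t => (mul_eq_zero.1 (hf t)).resolve_right (hne t k))
    rcases mul_eq_zero.1 h1 with h2 | h2
    · rcases mul_eq_zero.1 h2 with rfl | rfl
      · exact Or.inl (key f k fun t => by rw [h, map_zero])
      · exact Or.inr (key g k' fun t => by rw [h', map_zero])
    · exact absurd h2 (Finset.prod_ne_zero_iff.2 fun i _ => MvPolynomial.X_ne_zero i)
  exact NoZeroDivisors.to_isDomain _

/-- The points of the torus. -/
theorem exists_point_laurent (χ : laurent ι →ₐ[ℂ] ℂ) :
    ∃ t : ι → ℂˣ, ∀ f : laurent ι, χ f = f.1 t := by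
  let t : ι → ℂˣ := fun i => ⟨χ ⟨_, coord_mem_laurent i⟩, χ ⟨_, coord_inv_mem_laurent i⟩, by
    rw [← map_mul, ← map_one χ]
    congr 1
    ext t
    simp, by
    rw [← map_mul, ← map_one χ]
    congr 1
    ext t
    simp⟩
  refine ⟨t, fun f => ?_⟩
  obtain ⟨f, hf⟩ := f
  induction hf using Algebra.adjoin_induction with
  | mem f hf =>
    rcases hf with ⟨i, rfl⟩ | ⟨i, rfl⟩
    · rfl
    · rfl
  | algebraMap r => exact χ.commutes r
  | add f g hf hg h h' =>
    have := map_add χ ⟨f, hf⟩ ⟨g, hg⟩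
    rw [h, h'] at this
    exact this
  | mul f g hf hg h h' =>
    have := map_mul χ ⟨f, hf⟩ ⟨g, hg⟩
    rw [h, h'] at this
    exact this

end Laurent

end WilsonLines

end

/-! ### Regular maps to `G` and the points of its coordinate ring -/

noncomputable section

set_option linter.unusedSectionVars false

namespace WilsonLines

open LieAlgebra LieAlgebra.IsKilling

namespace Pinned

variable {𝔤 : Type*} [LieRing 𝔤] [LieAlgebra ℂ 𝔤] [FiniteDimensional ℂ 𝔤]
  [LieAlgebra.IsKilling ℂ 𝔤] {𝔥 : LieSubalgebra ℂ 𝔤} [𝔥.IsCartanSubalgebra] {D : Pinned 𝔥}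

/-- Regular maps to the group, with respect to an algebra of functions on the source. -/
def IsReg {Y : Type*} (A : Subalgebra ℂ (Y → ℂ)) (F : Y → D.G) : Prop :=
  ∀ (ℓ : Module.Dual ℂ 𝔤) (v : 𝔤), (fun y => ℓ (F y • v)) ∈ A ∧ (fun y => ℓ ((F y)⁻¹ • v)) ∈ A

theorem dual_smul_smul (g g' : D.G) (ℓ : Module.Dual ℂ 𝔤) (v : 𝔤) :
    ℓ ((g * g') • v) = ∑ i, ℓ (g • Module.finBasis ℂ 𝔤 i) *
      (Module.finBasis ℂ 𝔤).coord i (g' • v) := by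
  conv_lhs => rw [mul_smul, ← (Module.finBasis ℂ 𝔤).sum_repr (g' • v)]
  have : ∀ x, g • x = D.lin g x := fun _ => rfl
  rw [this, map_sum, map_sum]
  refine Finset.sum_congr rfl fun i _ => ?_
  rw [map_smul, map_smul, smul_eq_mul, mul_comm]
  rfl

namespace IsReg

variable {Y : Type*} {A : Subalgebra ℂ (Y → ℂ)} {F F' : Y → D.G}

theorem const (g : D.G) : IsReg A fun _ : Y => g :=
  fun _ _ => ⟨A.algebraMap_mem _, A.algebraMap_mem _⟩

theorem inv (h : IsReg A F) : IsReg A fun y => (F y)⁻¹ := fun ℓ v => by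
  refine ⟨(h ℓ v).2, ?_⟩
  simp only [inv_inv]
  exact (h ℓ v).1

theorem sum_mem_aux {n : ℕ} {f f' : Fin n → Y → ℂ} (h : ∀ i, f i ∈ A) (h' : ∀ i, f' i ∈ A) :
    (fun y => ∑ i, f i y * f' i y) ∈ A := by
  have : (fun y => ∑ i, f i y * f' i y) = ∑ i, f i * f' i := by
    ext y
    simp
  rw [this]
  exact sum_mem fun i _ => mul_mem (h i) (h' i)

theorem mul (h : IsReg A F) (h' : IsReg A F') : IsReg A fun y => F y * F' y := fun ℓ v => by
  refine ⟨?_, ?_⟩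
  · simp only [dual_smul_smul]
    exact sum_mem_aux (fun i => (h ℓ _).1) fun i => (h' _ v).1
  · simp only [mul_inv_rev, dual_smul_smul]
    exact sum_mem_aux (fun i => (h' ℓ _).2) fun i => (h _ v).2

theorem comp {X : Type*} {A' : Subalgebra ℂ (X → ℂ)} (h : IsReg A F) {σ : X → Y}
    (hσ : ∀ f ∈ A, f ∘ σ ∈ A') : IsReg A' fun x => F (σ x) :=
  fun ℓ v => ⟨hσ _ (h ℓ v).1, hσ _ (h ℓ v).2⟩

theorem list_prod {ι : Type*} {l : List ι} {F : ι → Y → D.G} (h : ∀ i, IsReg A (F i)) :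
    IsReg A fun y => (l.map fun i => F i y).prod := by
  induction l with
  | nil => exact const 1
  | cons i l ih =>
    simp only [List.map_cons, List.prod_cons]
    exact (h i).mul ih

/-- For nilpotent `ad x` the exponential of `ad (q x)` is a polynomial in `q`. -/
theorem expEnd_mem {x : 𝔤} (hx : IsNilpotent (ad ℂ 𝔤 x)) {q : Y → ℂ} (hq : q ∈ A)
    (ℓ : Module.Dual ℂ 𝔤) (v : 𝔤) : (fun y => ℓ (expEnd (ad ℂ 𝔤 (q y • x)) v)) ∈ A := by
  obtain ⟨n, hn⟩ := hx
  have h1 : ∀ y, ad ℂ 𝔤 (q y • x) ^ n = 0 := fun y => by rw [map_smul, smul_pow, hn, smul_zero]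
  have h2 : (fun y => ℓ (expEnd (ad ℂ 𝔤 (q y • x)) v)) =
      ∑ k ∈ Finset.range n, ((k.factorial : ℂ)⁻¹ * ℓ ((ad ℂ 𝔤 x ^ k) v)) • q ^ k := by
    ext y
    rw [expEnd_apply ⟨n, h1 y⟩ (n := n) (by rw [h1]; rfl), map_sum, Finset.sum_apply]
    refine Finset.sum_congr rfl fun k _ => ?_
    rw [map_smul (ad ℂ 𝔤), smul_pow, LinearMap.smul_apply, map_smul, map_smul]
    simp only [smul_eq_mul, Pi.smul_apply, Pi.pow_apply]
    ring
  rw [h2]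
  exact sum_mem fun k _ => A.smul_mem (pow_mem hq k) _

theorem of_exp {x : 𝔤} (hx : IsNilpotent (ad ℂ 𝔤 x)) {q : Y → ℂ} (hq : q ∈ A)
    (hF : ∀ y v, F y • v = expEnd (ad ℂ 𝔤 (q y • x)) v) : IsReg A F := by
  have h1 : ∀ y v, (F y)⁻¹ • v = expEnd (ad ℂ 𝔤 ((-q) y • x)) v := fun y v => by
    rw [inv_smul_eq_iff, hF]
    have := (expEnd_neg_mul_aux (isNilpotent_smul' hx (q y))).1
    rw [Pi.neg_apply, neg_smul, map_neg]
    exact (congrArg (fun f : Module.End ℂ 𝔤 => f v) this).symm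
  intro ℓ v
  simp only [hF, h1]
  exact ⟨expEnd_mem hx hq ℓ v, expEnd_mem hx (neg_mem hq) ℓ v⟩

end IsReg

section CoordAlg

variable {Y ι : Type*} {F : ι → Y → D.G}

theorem isReg_coordAlg (F : ι → Y → D.G) (i : ι) : IsReg (D.coordAlg F) (F i) := fun ℓ v =>
  ⟨Algebra.subset_adjoin ⟨i, ℓ, v, Or.inl rfl⟩, Algebra.subset_adjoin ⟨i, ℓ, v, Or.inr rfl⟩⟩

theorem coordAlg_comp {X : Type*} {A : Subalgebra ℂ (X → ℂ)} {σ : X → Y}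
    (h : ∀ i, IsReg A fun x => F i (σ x)) {f : Y → ℂ} (hf : f ∈ D.coordAlg F) : f ∘ σ ∈ A := by
  induction hf using Algebra.adjoin_induction with
  | mem f hf =>
    obtain ⟨i, ℓ, v, rfl | rfl⟩ := hf
    · exact (h i ℓ v).1
    · exact (h i ℓ v).2
  | algebraMap r => exact A.algebraMap_mem r
  | add f g _ _ hf hg => exact add_mem hf hg
  | mul f g _ _ hf hg => exact mul_mem hf hg

/-- A fixed basis suffices in place of all functionals and vectors, so a finite family of maps gives
a finitely generated algebra. -/
theorem coordAlg_eq_adjoin_entries (F : ι → Y → D.G) : D.coordAlg F = Algebra.adjoin ℂ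
    (Set.range (fun (p : ι × Fin D.dim × Fin D.dim) (y : Y) => D.entry p.2.1 p.2.2 (F p.1 y)) ∪
     Set.range (fun (p : ι × Fin D.dim × Fin D.dim) (y : Y) => D.entry p.2.1 p.2.2 (F p.1 y)⁻¹)) := by
  have key : ∀ (ℓ : Module.Dual ℂ 𝔤) (v : 𝔤) (F : Y → D.G), (fun y => ℓ (F y • v)) =
      ∑ i, ∑ j, (ℓ (Module.finBasis ℂ 𝔤 i) * (Module.finBasis ℂ 𝔤).repr v j) •
        fun y => D.entry i j (F y) := by
    intro ℓ v F
    ext y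
    have h1 : ∀ x, ℓ x = ∑ i, ℓ (Module.finBasis ℂ 𝔤 i) * (Module.finBasis ℂ 𝔤).coord i x := by
      intro x
      conv_lhs => rw [← (Module.finBasis ℂ 𝔤).sum_repr x, map_sum]
      refine Finset.sum_congr rfl fun i _ => ?_
      rw [map_smul, smul_eq_mul, mul_comm]
      rfl
    rw [h1, Finset.sum_apply]
    refine Finset.sum_congr rfl fun i _ => ?_
    have h2 : F y • v = ∑ j, (Module.finBasis ℂ 𝔤).repr v j • F y • Module.finBasis ℂ 𝔤 j := by
      conv_lhs => rw [← (Module.finBasis ℂ 𝔤).sum_repr v]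
      change D.lin (F y) _ = _
      rw [map_sum]
      refine Finset.sum_congr rfl fun j _ => ?_
      rw [map_smul]
      rfl
    rw [h2, map_sum, Finset.sum_apply, Finset.mul_sum]
    refine Finset.sum_congr rfl fun j _ => ?_
    rw [map_smul, Pi.smul_apply, smul_eq_mul, smul_eq_mul, mul_assoc]
    rfl
  refine le_antisymm (Algebra.adjoin_le ?_) (Algebra.adjoin_mono ?_)
  · rintro f ⟨i, ℓ, v, rfl | rfl⟩
    · change (fun y => ℓ (F i y • v)) ∈ _
      rw [key, SetLike.mem_coe]
      refine Subalgebra.sum_mem _ fun p _ => Subalgebra.sum_mem _ fun q _ =>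
        Subalgebra.smul_mem _ (Algebra.subset_adjoin ?_) _
      exact Or.inl ⟨⟨i, p, q⟩, rfl⟩
    · change (fun y => ℓ ((F i y)⁻¹ • v)) ∈ _
      rw [key ℓ v fun y => (F i y)⁻¹, SetLike.mem_coe]
      refine Subalgebra.sum_mem _ fun p _ => Subalgebra.sum_mem _ fun q _ =>
        Subalgebra.smul_mem _ (Algebra.subset_adjoin ?_) _
      exact Or.inr ⟨⟨i, p, q⟩, rfl⟩
  · rintro f (⟨⟨i, p, q⟩, rfl⟩ | ⟨⟨i, p, q⟩, rfl⟩)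
    · exact ⟨i, _, _, Or.inl rfl⟩
    · exact ⟨i, _, _, Or.inr rfl⟩

instance finiteType_coordAlg [Finite ι] : Algebra.FiniteType ℂ (D.coordAlg F) := by
  rw [← Subalgebra.fg_iff_finiteType, coordAlg_eq_adjoin_entries]
  exact Subalgebra.fg_def.2 ⟨_, (Set.finite_range _).union (Set.finite_range _), rfl⟩

end CoordAlg

/-! ### Points of coordinate rings -/

section Points

variable {Γ : Type*} [Group Γ] (φ : Γ →* D.G)

/-- The coordinate ring of a group with a homomorphism to `G`. -/
abbrev groupAlg : Subalgebra ℂ (Γ → ℂ) := D.coordAlg fun (_ : Unit) g => φ g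

/-- This is the comultiplication of the coordinate ring, expressed on values to avoid tensor
products of function algebras. -/
theorem exists_comul {f : Γ → ℂ} (hf : f ∈ groupAlg φ) :
    ∃ (κ : Type) (_ : Fintype κ) (a b : κ → Γ → ℂ), (∀ k, a k ∈ groupAlg φ) ∧
      (∀ k, b k ∈ groupAlg φ) ∧ ∀ x y, f (x * y) = ∑ k, a k x * b k y := by
  have hφ := isReg_coordAlg (fun (_ : Unit) g => φ g) ()
  induction hf using Algebra.adjoin_induction with
  | mem f hf =>
    obtain ⟨-, ℓ, v, rfl | rfl⟩ := hf
    · refine ⟨Fin D.dim, inferInstance, _, _, fun i => (hφ ℓ (Module.finBasis ℂ 𝔤 i)).1,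
        fun i => (hφ ((Module.finBasis ℂ 𝔤).coord i) v).1, fun x y => ?_⟩
      change ℓ (φ (x * y) • v) = _
      rw [map_mul, dual_smul_smul]
    · refine ⟨Fin D.dim, inferInstance, _, _, fun i => (hφ ((Module.finBasis ℂ 𝔤).coord i) v).2,
        fun i => (hφ ℓ (Module.finBasis ℂ 𝔤 i)).2, fun x y => ?_⟩
      change ℓ ((φ (x * y))⁻¹ • v) = _
      rw [map_mul, mul_inv_rev, dual_smul_smul]
      exact Finset.sum_congr rfl fun i _ => mul_comm _ _
  | algebraMap r =>
    exact ⟨Unit, inferInstance, fun _ => algebraMap ℂ _ r, fun _ => 1,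
      fun _ => Subalgebra.algebraMap_mem _ r, fun _ => one_mem _, fun x y => by simp⟩
  | add f g _ _ hf hg =>
    obtain ⟨κ, _, a, b, ha, hb, h⟩ := hf
    obtain ⟨κ', _, a', b', ha', hb', h'⟩ := hg
    refine ⟨κ ⊕ κ', inferInstance, Sum.elim a a', Sum.elim b b', ?_, ?_, fun x y => ?_⟩
    · rintro (k | k)
      exacts [ha k, ha' k]
    · rintro (k | k)
      exacts [hb k, hb' k]
    · rw [Fintype.sum_sum_type, Pi.add_apply, h, h']
      rfl
  | mul f g _ _ hf hg =>
    obtain ⟨κ, _, a, b, ha, hb, h⟩ := hf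
    obtain ⟨κ', _, a', b', ha', hb', h'⟩ := hg
    refine ⟨κ × κ', inferInstance, fun k => a k.1 * a' k.2, fun k => b k.1 * b' k.2,
      fun k => mul_mem (ha _) (ha' _), fun k => mul_mem (hb _) (hb' _), fun x y => ?_⟩
    rw [Pi.mul_apply, h, h', Finset.sum_mul_sum, ← Finset.sum_product']
    refine Finset.sum_congr rfl fun k _ => ?_
    simp only [Pi.mul_apply]
    ring

theorem mul_right_mem (g : Γ) {f : Γ → ℂ} (hf : f ∈ groupAlg φ) :
    (fun x => f (x * g)) ∈ groupAlg φ := by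
  refine coordAlg_comp (σ := fun x => x * g) (fun i => ?_) hf
  simp only [map_mul]
  exact (isReg_coordAlg (fun (_ : Unit) g => φ g) ()).mul (IsReg.const _)

theorem inv_mul_right_mem (g : Γ) {f : Γ → ℂ} (hf : f ∈ groupAlg φ) :
    (fun x => f (x⁻¹ * g)) ∈ groupAlg φ := by
  refine coordAlg_comp (σ := fun x => x⁻¹ * g) (fun i => ?_) hf
  simp only [map_mul, map_inv]
  exact (isReg_coordAlg (fun (_ : Unit) g => φ g) ()).inv.mul (IsReg.const _)

/-- Right translation as an automorphism of the coordinate ring. -/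
def translate (g : Γ) : groupAlg φ →ₐ[ℂ] groupAlg φ where
  toFun f := ⟨fun x => f.1 (x * g), mul_right_mem φ g f.2⟩
  map_one' := rfl
  map_mul' _ _ := rfl
  map_zero' := rfl
  map_add' _ _ := rfl
  commutes' _ := rfl

/-- An abstract point `χ` need not be an element of the group, but its translates still meet every
non-empty basic open set. If `χ` killed all translates of `a`, the comultiplication would force
every value `a(g)` to vanish. -/
theorem exists_translate_ne_zero (χ : groupAlg φ →ₐ[ℂ] ℂ) {a : groupAlg φ} (ha : a ≠ 0) :
    ∃ g, χ (translate φ g a) ≠ 0 := by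
  by_contra! hc
  apply ha
  obtain ⟨κ, _, p, q, hp, hq, h⟩ := exists_comul φ a.2
  have h1 : ∀ g, ∑ k, χ ⟨p k, hp k⟩ * q k g = 0 := fun g => by
    rw [← hc g]
    have : translate φ g a = ∑ k, q k g • (⟨p k, hp k⟩ : groupAlg φ) := by
      refine Subtype.ext (funext fun x => ?_)
      rw [AddSubmonoidClass.coe_finsetSum, Finset.sum_apply]
      refine (h x g).trans (Finset.sum_congr rfl fun k _ => ?_)
      exact mul_comm _ _
    rw [this, map_sum]
    refine Finset.sum_congr rfl fun k _ => ?_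
    rw [map_smul, smul_eq_mul, mul_comm]
  refine Subtype.ext (funext fun g => ?_)
  -- The value `a(g) = a(x · x⁻¹ g)` is constant in `x`. Expanding it by the comultiplication and
  -- applying `χ` leaves `χ` of a function that vanishes identically by `h1`.
  have h2 : algebraMap ℂ (groupAlg φ) (a.1 g) =
      ∑ k, (⟨p k, hp k⟩ : groupAlg φ) * ⟨_, inv_mul_right_mem φ g (hq k)⟩ := by
    refine Subtype.ext (funext fun x => ?_)
    rw [AddSubmonoidClass.coe_finsetSum, Finset.sum_apply]
    have := h x (x⁻¹ * g)
    rw [mul_inv_cancel_left] at this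
    exact this
  have h3 : χ (algebraMap ℂ (groupAlg φ) (a.1 g)) = a.1 g := by simp
  have h4 : ∑ k, χ ⟨p k, hp k⟩ • (⟨_, inv_mul_right_mem φ g (hq k)⟩ : groupAlg φ) = 0 := by
    refine Subtype.ext (funext fun x => ?_)
    rw [AddSubmonoidClass.coe_finsetSum, Finset.sum_apply]
    exact h1 (x⁻¹ * g)
  change a.1 g = 0
  rw [← h3, h2, map_sum]
  simp only [map_mul]
  have h5 := congrArg χ h4
  rw [map_sum, map_zero] at h5
  simpa only [map_smul, smul_eq_mul] using h5

/-- A family of elements that is parametrized by a torus and contains the neutral element. -/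
structure TorusFamily where
  n : ℕ
  map : (Fin n → ℂˣ) → Γ
  map_one : map 1 = 1
  regular : IsReg (laurent (Fin n)) fun t => φ (map t)

namespace TorusFamily

variable {φ}

/-- The product of two families. -/
def mul (P Q : TorusFamily φ) : TorusFamily φ where
  n := P.n + Q.n
  map t := P.map (fun i => t (Fin.castAdd _ i)) * Q.map fun i => t (Fin.natAdd _ i)
  map_one := by
    have h1 := P.map_one
    have h2 := Q.map_one
    exact (congrArg₂ (· * ·) h1 h2).trans (mul_one 1)
  regular := by
    simp only [map_mul]
    exact (P.regular.comp (σ := fun (t : Fin (P.n + Q.n) → ℂˣ) i => t (Fin.castAdd _ i)) fun f hf =>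
      laurent_comp (Fin.castAdd Q.n) hf).mul
      (Q.regular.comp (σ := fun (t : Fin (P.n + Q.n) → ℂˣ) i => t (Fin.natAdd _ i)) fun f hf =>
        laurent_comp (Fin.natAdd P.n) hf)

/-- The pullback of functions to a family. -/
def pullback (P : TorusFamily φ) : groupAlg φ →ₐ[ℂ] laurent (Fin P.n) where
  toFun f := ⟨fun t => f.1 (P.map t), coordAlg_comp (fun _ => P.regular) f.2⟩
  map_one' := rfl
  map_mul' _ _ := rfl
  map_zero' := rfl
  map_add' _ _ := rfl
  commutes' _ := rfl

/-- The functions which vanish on a family. -/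
def ker (P : TorusFamily φ) : Ideal (groupAlg φ) := RingHom.ker P.pullback

theorem mem_ker {P : TorusFamily φ} {f : groupAlg φ} : f ∈ P.ker ↔ ∀ t, f.1 (P.map t) = 0 := by
  rw [ker, RingHom.mem_ker]
  exact ⟨fun h t => congrFun (congrArg Subtype.val h) t, fun h => Subtype.ext (funext h)⟩

instance (P : TorusFamily φ) : P.ker.IsPrime := RingHom.ker_isPrime _

/-- A product family contains each factor, as the other one passes through the neutral element. This
is the role of `map_one`. -/
theorem ker_mul_le_left (P Q : TorusFamily φ) : (P.mul Q).ker ≤ P.ker := fun f hf => by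
  rw [mem_ker] at hf ⊢
  intro t
  have := hf (Fin.append t 1)
  have e : (P.mul Q).map (Fin.append t 1) = P.map t := by
    simp only [mul, Fin.append_left, Fin.append_right]
    have h2 := Q.map_one
    exact (congrArg₂ (· * ·) rfl h2).trans (mul_one _)
  rwa [e] at this

theorem ker_mul_le_right (P Q : TorusFamily φ) : (P.mul Q).ker ≤ Q.ker := fun f hf => by
  rw [mem_ker] at hf ⊢
  intro t
  have := hf (Fin.append 1 t)
  have e : (P.mul Q).map (Fin.append 1 t) = Q.map t := by
    simp only [mul, Fin.append_left, Fin.append_right]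
    have h2 := P.map_one
    exact (congrArg₂ (· * ·) h2 rfl).trans (one_mul _)
  rwa [e] at this

end TorusFamily

/-- The points of the coordinate ring of a group that is generated by torus families. -/
theorem exists_point (h : ∀ g : Γ, ∃ P : TorusFamily φ, g ∈ Set.range P.map)
    (χ : groupAlg φ →ₐ[ℂ] ℂ) : ∃ g : Γ, ∀ f : groupAlg φ, χ f = f.1 g := by
  have : IsNoetherianRing (groupAlg φ) := Algebra.FiniteType.isNoetherianRing ℂ _
  obtain ⟨P₀, -⟩ := h 1
  have : Nonempty (TorusFamily φ) := ⟨P₀⟩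
  -- Primes of a Noetherian ring have finite height and a strict inclusion changes it. So a family
  -- whose kernel has minimal height is not enlarged, up to closure, by multiplication with another
  -- family. Its kernel then lies in all other kernels, and it is zero because the families cover
  -- the group.
  let P := Function.argmin fun P : TorusFamily φ => P.ker.height
  have hP : ∀ Q : TorusFamily φ, P.ker ≤ Q.ker := by
    intro Q
    have h1 : (P.mul Q).ker = P.ker := by
      by_contra hne
      have h2 := Ideal.height_strict_mono_of_isPrime ((P.ker_mul_le_left Q).lt_of_ne hne)
      exact absurd h2 (not_lt.2 (Function.argmin_le (fun P : TorusFamily φ => P.ker.height) _))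
    rw [← h1]
    exact P.ker_mul_le_right Q
  have hinj : Function.Injective P.pullback := by
    rw [injective_iff_map_eq_zero]
    intro f hf
    refine Subtype.ext (funext fun g => ?_)
    obtain ⟨Q, t, rfl⟩ := h g
    exact TorusFamily.mem_ker.1 (hP Q hf) t
  have : IsDomain (groupAlg φ) := hinj.isDomain P.pullback.toRingHom
  obtain ⟨a, ha, h1⟩ := exists_ne_zero_extension P.pullback hinj
  -- The pullback to `P` is injective, so the points with `a ≠ 0` lift to the torus. A translate of
  -- `χ` is moved into that set, lifted, and moved back.
  obtain ⟨g, hg⟩ := exists_translate_ne_zero φ χ ha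
  obtain ⟨ψ, hψ⟩ := h1 (χ.comp (translate φ g)) hg
  obtain ⟨t, ht⟩ := exists_point_laurent ψ
  refine ⟨P.map t * g⁻¹, fun f => ?_⟩
  have h2 : χ (translate φ g (translate φ g⁻¹ f)) = ψ (P.pullback (translate φ g⁻¹ f)) :=
    (congrArg (fun F : groupAlg φ →ₐ[ℂ] ℂ => F (translate φ g⁻¹ f)) hψ).symm
  have h3 : translate φ g (translate φ g⁻¹ f) = f :=
    Subtype.ext (funext fun x => congrArg f.1 (mul_inv_cancel_right x g))
  rw [h3, ht] at h2
  exact h2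

end Points

end Pinned

end WilsonLines

end

/-! ### `G` and `B⁺` are covered by torus families -/

noncomputable section

set_option linter.unusedSectionVars false

namespace WilsonLines

open LieAlgebra LieAlgebra.IsKilling

namespace Pinned

variable {𝔤 : Type*} [LieRing 𝔤] [LieAlgebra ℂ 𝔤] [FiniteDimensional ℂ 𝔤]
  [LieAlgebra.IsKilling ℂ 𝔤] {𝔥 : LieSubalgebra ℂ 𝔤} [𝔥.IsCartanSubalgebra] {D : Pinned 𝔥}

section Points

variable {Γ : Type*} [Group Γ] (φ : Γ →* D.G)

/-- The elements that lie in torus families. -/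
def reach : Subgroup Γ where
  carrier := {g | ∃ P : TorusFamily φ, g ∈ Set.range P.map}
  mul_mem' := by
    rintro _ _ ⟨P, t, rfl⟩ ⟨Q, t', rfl⟩
    refine ⟨P.mul Q, Fin.append t t', ?_⟩
    simp only [TorusFamily.mul, Fin.append_left, Fin.append_right]
  one_mem' := ⟨⟨0, fun _ => 1, rfl, by simpa using IsReg.const (1 : D.G)⟩, 1, rfl⟩
  inv_mem' := by
    rintro _ ⟨P, t, rfl⟩
    exact ⟨⟨P.n, fun t => (P.map t)⁻¹, by rw [P.map_one, inv_one],
      by simpa using P.regular.inv⟩, t, rfl⟩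

variable {φ}

theorem mem_reach_of_curve {p : ℂˣ → Γ} (h1 : p 1 = 1)
    (h : IsReg (laurent (Fin 1)) fun t => φ (p (t 0))) (t : ℂˣ) : p t ∈ reach φ :=
  ⟨⟨1, fun t => p (t 0), h1, h⟩, fun _ => t, rfl⟩

theorem sub_one_mem_laurent : (fun t : Fin 1 → ℂˣ => (t 0 : ℂ) - 1) ∈ laurent (Fin 1) :=
  sub_mem (coord_mem_laurent 0) (one_mem _)

end Points

variable (D)

theorem reach_id_eq_top (g : D.G) : g ∈ reach (MonoidHom.id D.G) := by
  have : adjointGroup 𝔥 ≤ (reach (MonoidHom.id D.G)).map (adjointGroup 𝔥).subtype := by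
    refine (Subgroup.closure_le _).2 ?_
    rintro g ⟨α, x, hx, e⟩
    -- A torus family starts at `t = 1`, hence the shift to `(t - 1) x`. The given element is its
    -- value at `t = 2`.
    let p : ℂˣ → D.G := fun t => rootExp (Submodule.smul_mem _ ((t : ℂ) - 1) hx)
    have hp : ∀ t v, p t • v = expEnd (ad ℂ 𝔤 (((t : ℂ) - 1) • x)) v := fun t v => rfl
    refine ⟨p (Units.mk0 2 two_ne_zero), mem_reach_of_curve ?_ ?_ _, ?_⟩
    · refine adjointGroup_ext fun v => ?_
      rw [hp, Units.val_one, sub_self, zero_smul, map_zero, expEnd_zero, one_smul]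
      rfl
    · exact IsReg.of_exp (LieAlgebra.isNilpotent_ad_of_mem_rootSpace 𝔥 (root_ne_zero_aux α) hx)
        sub_one_mem_laurent fun t v => hp (t 0) v
    · refine Units.ext (LinearMap.ext fun v => ?_)
      rw [e]
      refine (hp _ v).trans ?_
      rw [Units.val_mk0]
      norm_num
  obtain ⟨k, hk, e⟩ := this g.2
  rwa [← Subtype.ext e]

theorem isReg_xRoot (s : D.base.support) {Y : Type*} {A : Subalgebra ℂ (Y → ℂ)} {q : Y → ℂ}
    (hq : q ∈ A) : IsReg A fun y => D.xRoot s (q y) :=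
  IsReg.of_exp (D.nil_e s) hq fun y v => D.xRoot_smul s (q y) v

theorem isReg_yRoot (s : D.base.support) {Y : Type*} {A : Subalgebra ℂ (Y → ℂ)} {q : Y → ℂ}
    (hq : q ∈ A) : IsReg A fun y => D.yRoot s (q y) :=
  IsReg.of_exp (D.nil_f s) hq fun y v => D.yRoot_smul s (q y) v

/-- The group `B⁺` is generated by positive root subgroups and by `H`, and `H` by its simple
cocharacters, which are Laurent polynomial in `t` and trivial at `t = 1`. -/
theorem reach_subtype_eq_top (g : D.B) : g ∈ reach D.B.subtype := by
  have : D.B ≤ (reach D.B.subtype).map D.B.subtype := by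
    refine sup_le (fun g hg => ?_) ((Subgroup.closure_le _).2 ?_)
    · refine (Subgroup.closure_le _).2 ?_ (D.mem_closure_hTor hg)
      rintro _ ⟨s, t, ht, rfl⟩
      let p : ℂˣ → D.B := fun t =>
        ⟨D.hTor s t, (le_sup_left : D.H ≤ D.B) (D.hTor_mem_H s t.ne_zero)⟩
      refine ⟨p (Units.mk0 t ht), mem_reach_of_curve ?_ ?_ _, rfl⟩
      · refine Subtype.ext ?_
        change (D.rBar s)⁻¹ * D.rTor s ((1 : ℂˣ) : ℂ) = 1
        rw [Units.val_one, ← rBar_eq_rTor, inv_mul_cancel]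
      · have h1 : (fun t : Fin 1 → ℂˣ => -(t 0 : ℂ)) ∈ laurent (Fin 1) :=
          neg_mem (coord_mem_laurent 0)
        have h2 : (fun t : Fin 1 → ℂˣ => (t 0 : ℂ)⁻¹) ∈ laurent (Fin 1) := by
          simpa using coord_inv_mem_laurent (0 : Fin 1)
        exact (IsReg.const _).mul (((D.isReg_xRoot s h1).mul (D.isReg_yRoot s h2)).mul
          (D.isReg_xRoot s h1))
    · rintro g ⟨α, hα, x, hx, e⟩
      let p : ℂˣ → D.B := fun t => ⟨rootExp (Submodule.smul_mem _ ((t : ℂ) - 1) hx),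
        (le_sup_right : D.U ≤ D.B) (Subgroup.subset_closure
          ⟨α, hα, _, Submodule.smul_mem _ ((t : ℂ) - 1) hx, rfl⟩)⟩
      have hp : ∀ t v, (p t).1 • v = expEnd (ad ℂ 𝔤 (((t : ℂ) - 1) • x)) v := fun t v => rfl
      refine ⟨p (Units.mk0 2 two_ne_zero), mem_reach_of_curve ?_ ?_ _, ?_⟩
      · refine Subtype.ext (adjointGroup_ext fun v => ?_)
        rw [hp, Units.val_one, sub_self, zero_smul, map_zero, expEnd_zero]
        exact (one_smul _ v).symm
      · exact IsReg.of_exp (LieAlgebra.isNilpotent_ad_of_mem_rootSpace 𝔥 (root_ne_zero_aux α) hx)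
          sub_one_mem_laurent fun t v => hp (t 0) v
      · refine adjointGroup_ext fun v => ?_
        refine (hp _ v).trans ?_
        rw [Units.val_mk0]
        norm_num
        exact (congrArg (fun f : Module.End ℂ 𝔤 => f v) e).symm
  obtain ⟨k, hk, e⟩ := this g.2
  rwa [← Subtype.ext e]

/-- The points of `𝒪(G)`. -/
theorem exists_point_OG (χ : D.OG →ₐ[ℂ] ℂ) : ∃ g : D.G, ∀ f : D.OG, χ f = f.1 g :=
  exists_point (MonoidHom.id D.G) D.reach_id_eq_top χ

/-- The points of `𝒪(B⁺)`. -/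
theorem exists_point_OB (χ : D.OB →ₐ[ℂ] ℂ) : ∃ g : D.B, ∀ f : D.OB, χ f = f.1 g :=
  exists_point D.B.subtype D.reach_subtype_eq_top χ

end Pinned

end WilsonLines

end

/-! ### Homotopy classes of arcs and the loops of boundary arcs -/

noncomputable section

set_option linter.unusedSectionVars false

namespace WilsonLines

section Arcs

variable {S : Type*} [TopologicalSpace S]

open Path.Homotopic (Quotient)

theorem toLoop_surjective {x : S} (γ : LoopGroup x) : ∃ p, toLoop p = γ := ⟨γ.unop, rfl⟩

namespace PathClass

open Path.Homotopic.Quotient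

variable {x a b d : S}

theorem eq_trans_of_triangle {e₀ : Path.Homotopic.Quotient x a} {p : Path.Homotopic.Quotient a b}
    {q : Path.Homotopic.Quotient b d} {r : Path.Homotopic.Quotient a d}
    {e₁ : Path.Homotopic.Quotient x b} {e₂ : Path.Homotopic.Quotient x d}
    {s : Path.Homotopic.Quotient d b} (h1 : e₀.trans p = e₁) (h2 : p.trans q = r)
    (h3 : e₂.symm.trans e₁ = s) (h4 : s.trans q = Path.Homotopic.Quotient.refl _) : e₀.trans r = e₂ := by
  rw [← h2, ← trans_assoc, h1]
  rw [← h3, trans_assoc] at h4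
  rw [← refl_trans (e₁.trans q), ← trans_symm e₂, trans_assoc, h4, trans_refl]

theorem trans_trans_symm_eq_refl {e₁ : Path.Homotopic.Quotient x a}
    {e₂ : Path.Homotopic.Quotient x b} {p : Path.Homotopic.Quotient a b}
    (h : p = e₁.symm.trans e₂) : (e₁.trans p).trans e₂.symm = Path.Homotopic.Quotient.refl x := by
  rw [h, ← trans_assoc, trans_symm, refl_trans, trans_symm]

theorem eq_refl_of_idem {p : Path.Homotopic.Quotient a a} (h : p.trans p = p) : p = Path.Homotopic.Quotient.refl a := by
  rw [← refl_trans p, ← symm_trans p, trans_assoc, h]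

theorem loop_trans_eq_refl {a' b' : S} {e : Path.Homotopic.Quotient x a}
    {r : Path.Homotopic.Quotient a a'} (ha : a = a') {q : Path.Homotopic.Quotient a b'} (hb : b = b')
    {e₂ : Path.Homotopic.Quotient x b} (h : e.trans (r.trans (q.cast ha.symm hb)) = e₂) :
    ((e.trans (r.cast rfl ha)).trans e.symm).trans ((e.trans (q.cast rfl hb)).trans e₂.symm) =
      Path.Homotopic.Quotient.refl x := by
  subst ha hb
  rw [cast_rfl_rfl] at h
  rw [cast_rfl_rfl, cast_rfl_rfl, ← h]
  have : ((e.trans r).trans e.symm).trans ((e.trans q).trans (e.trans (r.trans q)).symm) =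
      ((e.trans (r.trans q))).trans (e.trans (r.trans q)).symm := by
    simp only [trans_assoc]
    rw [← trans_assoc e.symm, symm_trans, refl_trans]
  rw [this, trans_symm]

end PathClass

namespace MarkedSurface

variable [ChartedSpace (EuclideanHalfSpace 2) S] (Sig : MarkedSurface S)

/-- Arcs are images of paths in the real line, and the line is simply connected. -/
theorem arc_trans (k : Fin Sig.b) (s t u : ℝ) :
    (Sig.arc k s t).trans (Sig.arc k t u) = Sig.arc k s u := by
  let line : ∀ s t : ℝ, Path s t := fun s t =>
    { toFun := fun u => s + (u : ℝ) * (t - s)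
      continuous_toFun := by fun_prop
      source' := by simp
      target' := by simp }
  have h : ∀ s t, Sig.arc k s t = (Path.Homotopic.Quotient.mk (line s t)).map
    ⟨Sig.C k, Sig.continuous_C k⟩ := fun s t => rfl
  have h1 : (Path.Homotopic.Quotient.mk (line s t)).trans (Path.Homotopic.Quotient.mk (line t u)) =
      Path.Homotopic.Quotient.mk (line s u) := Subsingleton.elim _ _
  rw [h s u, ← h1]
  exact (congrArg Path.Homotopic.Quotient.mk
    (Path.map_trans (line s t) (line t u) (Sig.continuous_C k))).symm

theorem arc_self (k : Fin Sig.b) (s : ℝ) : Sig.arc k s s = Path.Homotopic.Quotient.refl _ :=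
  PathClass.eq_refl_of_idem (Sig.arc_trans k s s s)

theorem arc_shift (k : Fin Sig.b) {s t t' : ℝ} (ht : t' = t + 1) :
    Sig.arc k (s + 1) t' = (Sig.arc k s t).cast (Sig.periodic_C k s)
      ((congrArg (Sig.C k) ht).trans (Sig.periodic_C k t)) := by
  subst ht
  refine congrArg Path.Homotopic.Quotient.mk (Path.ext (funext fun u => ?_))
  change Sig.C k (s + 1 + (u : ℝ) * (t + 1 - (s + 1))) = Sig.C k (s + (u : ℝ) * (t - s))
  rw [← Sig.periodic_C k (s + (u : ℝ) * (t - s))]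
  congr 1
  ring

end MarkedSurface

namespace CurveSystem

open Path.Homotopic.Quotient

variable [ChartedSpace (EuclideanHalfSpace 2) S] {Sig : MarkedSurface S} {x : S}
  (c : CurveSystem Sig x)

/-- The relations between consecutive intervals chain together: within one turn, every `ε` is that
of the first interval followed by the boundary path. -/
theorem ε_trans_arc (k : Fin Sig.b) (j : ℕ) (h : j < Sig.N k) :
    (c.ε (Sig.firstIval k)).trans (Sig.arc k (c.pos (Sig.firstIval k)) (c.pos ⟨k, ⟨j, h⟩⟩)) =
      c.ε ⟨k, ⟨j, h⟩⟩ := by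
  induction j with
  | zero => exact (congrArg _ (Sig.arc_self k _)).trans (trans_refl _)
  | succ j ih =>
    exact PathClass.eq_trans_of_triangle (ih (Nat.lt_of_succ_lt h)) (Sig.arc_trans k _ _ _)
      (c.ε_succ k j h) ((Sig.arc_trans k _ _ _).trans (Sig.arc_self k _))

theorem loopOfArc_bdryArc_succ (k : Fin Sig.b) (j : ℕ) (h : j + 1 < Sig.N k) :
    c.loopOfArc (c.bdryArc ⟨k, ⟨j + 1, h⟩⟩) = 1 :=
  congrArg toLoop (PathClass.trans_trans_symm_eq_refl
    (((cast_rfl_rfl _).trans (c.ε_succ k j h).symm : _)))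

/-- The arc from the first interval runs backwards to the last one. Preceded by one full turn, it
becomes the forward arc inside that turn, which is `ε_1⁻¹ ε_N`. So its loop, multiplied by `δ_k`, is
trivial. -/
theorem loopOfArc_bdryArc_zero (k : Fin Sig.b) :
    c.loopOfArc (c.bdryArc (Sig.firstIval k)) = (c.δ k)⁻¹ := by
  refine eq_inv_of_mul_eq_one_right ?_
  rw [c.δ_eq]
  refine congrArg toLoop (PathClass.loop_trans_eq_refl (Sig.periodic_C k _).symm
    (c.predPos_aux (Sig.firstIval k)) ?_)
  have h0 : c.pos (Sig.lastIval k) = c.pos (Sig.lastIval k) - 1 + 1 := by ring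
  refine Eq.trans (congrArg (fun p => (c.ε (Sig.firstIval k)).trans
    ((Sig.arc k (c.pos (Sig.firstIval k)) (c.pos (Sig.firstIval k) + 1)).trans p))
    (Sig.arc_shift k (s := c.pos (Sig.firstIval k)) h0).symm) ?_
  refine Eq.trans (congrArg (fun p => (c.ε (Sig.firstIval k)).trans p)
    (Sig.arc_trans k (c.pos (Sig.firstIval k)) (c.pos (Sig.firstIval k) + 1)
      (c.pos (Sig.lastIval k)))) ?_
  exact c.ε_trans_arc k (Sig.N k - 1) (Nat.sub_lt (Sig.N_pos k) Nat.one_pos)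

theorem loopOfArc_arcEps (E E' : Sig.Ival) : c.loopOfArc (c.arcEps E E') = 1 :=
  congrArg toLoop (PathClass.trans_trans_symm_eq_refl rfl)

/-- Every element of the fundamental group comes from an arc. -/
theorem exists_arc (E E' : Sig.Ival) (γ : LoopGroup x) : ∃ a : c.ArcClass E E', c.loopOfArc a = γ := by
  obtain ⟨p, rfl⟩ := toLoop_surjective γ
  refine ⟨((c.ε E).symm.trans p).trans (c.ε E'), congrArg toLoop ?_⟩
  rw [← trans_assoc, ← trans_assoc, trans_symm, refl_trans, trans_assoc, trans_symm, trans_refl]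

end CurveSystem

end Arcs

end WilsonLines

end

/-! ### Comparison of quotient and subvariety structures -/

noncomputable section

set_option linter.unusedSectionVars false

namespace WilsonLines

namespace FunctionSpace

section Affine

variable {T T' : Type*} {A : Subalgebra ℂ (T → ℂ)} {A' : Subalgebra ℂ (T' → ℂ)}

theorem isOpen_affine {h : T → ℂ} (hh : h ∈ A) : IsOpen[(affine A).top] {x | h x ≠ 0} :=
  TopologicalSpace.isOpen_generateFrom_of_mem ⟨h, hh, rfl⟩

theorem isClosed_affine {h : T → ℂ} (hh : h ∈ A) : IsClosed[(affine A).top] {x | h x = 0} := by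
  rw [← @isOpen_compl_iff]
  exact isOpen_affine hh

/-- A map that pulls back the coordinate ring into the coordinate ring is a morphism. -/
theorem continuous_affine {j : T → T'} (hj : ∀ h ∈ A', h ∘ j ∈ A) :
    @Continuous _ _ (affine A).top (affine A').top j := by
  refine continuous_generateFrom_iff.2 ?_
  rintro _ ⟨h, hh, rfl⟩
  exact isOpen_affine (hj h hh)

theorem regular_affine_comp {j : T → T'} (hj : ∀ h ∈ A', h ∘ j ∈ A) {W : Set T'} {F : T' → ℂ}
    (hF : F ∈ (affine A').regular W) : F ∘ j ∈ (affine A).regular (j ⁻¹' W) := by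
  intro x hx
  obtain ⟨p, hp, h, hh, h0, e⟩ := hF (j x) hx
  exact ⟨p ∘ j, hj p hp, h ∘ j, hj h hh, h0, fun y hy hy0 => e (j y) hy hy0⟩

theorem div_mem_regular {p h : T → ℂ} (hp : p ∈ A) (hh : h ∈ A) {W : Set T} (hW : W ⊆ {x | h x ≠ 0}) :
    (fun x => p x / h x) ∈ (affine A).regular W :=
  fun _ hx => ⟨p, hp, h, hh, hW hx, fun _ _ _ => rfl⟩

end Affine

section Compare

variable {C M X T : Type*} {AC : Subalgebra ℂ (C → ℂ)} {AT : Subalgebra ℂ (T → ℂ)}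
  {q : C → M} {i : X → M} {φ : X → T} {s : X → C}

/-- Comparison of a subvariety of a quotient with a subvariety of an affine variety. -/
theorem top_coinduced_induced_eq (hs : ∀ x, q (s x) = i x)
    (h1 : ∀ h ∈ AT, ∃ k : M → ℂ, k ∘ q ∈ AC ∧ k ∘ i = h ∘ φ)
    (h2 : ∀ h ∈ AC, ∃ k ∈ AT, k ∘ φ = h ∘ s) :
    (((affine AC).coinduced q).induced i).top = ((affine AT).induced φ).top := by
  refine le_antisymm ?_ ?_
  · refine continuous_iff_le_induced.1 ?_
    refine continuous_generateFrom_iff.2 ?_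
    rintro _ ⟨h, hh, rfl⟩
    obtain ⟨k, hk, e⟩ := h1 h hh
    refine ⟨{y | k y ≠ 0}, ?_, ?_⟩
    · exact isOpen_affine hk
    · ext x
      exact not_congr (iff_of_eq (congrArg (· = 0) (congrFun e x)))
  · rintro U ⟨V, hV, rfl⟩
    have hc : @Continuous _ _ ((affine AT).induced φ).top (affine AC).top s := by
      refine continuous_generateFrom_iff.2 ?_
      rintro _ ⟨h, hh, rfl⟩
      obtain ⟨k, hk, e⟩ := h2 h hh
      refine ⟨{y | k y ≠ 0}, isOpen_affine hk, ?_⟩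
      ext x
      exact not_congr (iff_of_eq (congrArg (· = 0) (congrFun e x)))
    have h3 := @Continuous.isOpen_preimage _ _ ((affine AT).induced φ).top (affine AC).top s hc _ hV
    have e : i ⁻¹' V = s ⁻¹' (q ⁻¹' V) := by
      ext x
      change i x ∈ V ↔ q (s x) ∈ V
      rw [hs]
    rw [e]
    exact h3

/-- On either side a regular function is locally a fraction. The hypotheses `h1` and `h2` transport
numerator and denominator to the other side, and `top_coinduced_induced_eq` transports the open set.
-/
theorem regular_coinduced_induced_eq (hs : ∀ x, q (s x) = i x)
    (h1 : ∀ h ∈ AT, ∃ k : M → ℂ, k ∘ q ∈ AC ∧ k ∘ i = h ∘ φ)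
    (h2 : ∀ h ∈ AC, ∃ k ∈ AT, k ∘ φ = h ∘ s) (U : Set X) :
    (((affine AC).coinduced q).induced i).regular U = ((affine AT).induced φ).regular U := by
  have htop := top_coinduced_induced_eq hs h1 h2
  ext f
  constructor
  · intro hf x hx
    obtain ⟨V, hV, hxV, F, hF, e⟩ := hf x hx
    have hF' : F ∘ q ∈ (affine AC).regular (q ⁻¹' V) := hF
    obtain ⟨p, hp, h, hh, h0, e'⟩ := hF' (s x) (by
      change q (s x) ∈ V
      rwa [hs])
    obtain ⟨p', hp', ep⟩ := h2 p hp
    obtain ⟨h', hh', eh⟩ := h2 h hh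
    have hopen : IsOpen[((affine AT).induced φ).top] (i ⁻¹' V) := by
      rw [← htop]
      exact ⟨V, hV, rfl⟩
    obtain ⟨W, hW, eW⟩ := hopen
    have hiW : ∀ z, φ z ∈ W ↔ i z ∈ V := fun z => iff_of_eq (congrArg (z ∈ ·) eW)
    refine ⟨W ∩ {t | h' t ≠ 0}, @IsOpen.inter _ (affine AT).top _ _ hW (isOpen_affine hh'),
      ⟨(hiW x).2 hxV, ?_⟩, _, div_mem_regular hp' hh' Set.inter_subset_right, ?_⟩
    · change (h' ∘ φ) x ≠ 0
      rw [eh]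
      exact h0
    · intro z hz hzW
      have hzV := (hiW z).1 hzW.1
      have hz0 : (h' ∘ φ) z ≠ 0 := hzW.2
      rw [eh] at hz0
      rw [e z hz hzV]
      change F (i z) = (p' ∘ φ) z / (h' ∘ φ) z
      rw [ep, eh, ← hs]
      exact e' (s z) (by
        change q (s z) ∈ V
        rwa [hs]) hz0
  · intro hf x hx
    obtain ⟨V, hV, hxV, F, hF, e⟩ := hf x hx
    obtain ⟨p, hp, h, hh, h0, e'⟩ := hF (φ x) hxV
    obtain ⟨p', hp', ep⟩ := h1 p hp
    obtain ⟨h', hh', eh⟩ := h1 h hh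
    have hopen : IsOpen[(((affine AC).coinduced q).induced i).top] (φ ⁻¹' V) := by
      rw [htop]
      exact ⟨V, hV, rfl⟩
    obtain ⟨W, hW, eW⟩ := hopen
    have hiW : ∀ z, i z ∈ W ↔ φ z ∈ V := fun z => iff_of_eq (congrArg (z ∈ ·) eW)
    have hO : IsOpen[((affine AC).coinduced q).top] {t | h' t ≠ 0} := isOpen_affine hh'
    refine ⟨W ∩ {t | h' t ≠ 0}, @IsOpen.inter _ ((affine AC).coinduced q).top _ _ hW hO,
      ⟨(hiW x).2 hxV, ?_⟩, fun y => p' y / h' y, ?_, ?_⟩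
    · change (h' ∘ i) x ≠ 0
      rw [eh]
      exact h0
    · exact div_mem_regular (p := p' ∘ q) (h := h' ∘ q) hp' hh' fun y hy => hy.2
    · intro z hz hzW
      have hzV := (hiW z).1 hzW.1
      have hz0 : (h' ∘ i) z ≠ 0 := hzW.2
      rw [eh] at hz0
      rw [e z hz hzV]
      change F (φ z) = (p' ∘ i) z / (h' ∘ i) z
      rw [ep, eh]
      exact e' (φ z) hzV hz0

end Compare

section Quotient

variable {X P T T' : Type*} {𝒳 : FunctionSpace X} {A : Subalgebra ℂ (T → ℂ)}
  {A' : Subalgebra ℂ (T' → ℂ)} {φ' : X → T'} {φ : P → T} {π : X → P} {t : P → X}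
  {j : T → T'} {r : T' → T}

/-- Comparison of the quotient of a subvariety of an affine variety along a projection with a
section. -/
theorem top_coinduced_eq (h𝒳 : 𝒳.top = ((affine A').induced φ').top) (ht : ∀ p, π (t p) = p)
    (hr : ∀ x, r (φ' x) = φ (π x)) (hj : ∀ p, φ' (t p) = j (φ p))
    (h1 : ∀ h ∈ A', h ∘ j ∈ A) (h2 : ∀ h ∈ A, h ∘ r ∈ A') :
    (𝒳.coinduced π).top = (affine A).top.induced φ := by
  have key : ∀ V : Set P, IsOpen[(𝒳.coinduced π).top] V ↔ IsOpen[(affine A).top.induced φ] V := by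
    intro V
    change IsOpen[𝒳.top] (π ⁻¹' V) ↔ _
    rw [h𝒳]
    constructor
    · rintro ⟨W, hW, e⟩
      refine ⟨j ⁻¹' W, @Continuous.isOpen_preimage _ _ (affine A).top (affine A').top j
        (continuous_affine h1) _ hW, ?_⟩
      ext p
      have : φ' (t p) ∈ W ↔ π (t p) ∈ V := iff_of_eq (congrArg (t p ∈ ·) e)
      rw [ht, hj] at this
      exact this
    · rintro ⟨W, hW, rfl⟩
      refine ⟨r ⁻¹' W, @Continuous.isOpen_preimage _ _ (affine A').top (affine A).top r
        (continuous_affine h2) _ hW, ?_⟩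
      ext x
      change r (φ' x) ∈ W ↔ φ (π x) ∈ W
      rw [hr]
  refine le_antisymm (fun V hV => (key V).2 hV) (fun V hV => (key V).1 hV)

/-- Regular functions are carried to the quotient through the section `j` and back through the
retraction `r`, both of which pull coordinate rings into coordinate rings. -/
theorem regular_coinduced_eq {V : Set P}
    (h𝒳 : 𝒳.regular (π ⁻¹' V) = ((affine A').induced φ').regular (π ⁻¹' V)) (ht : ∀ p, π (t p) = p)
    (hr : ∀ x, r (φ' x) = φ (π x)) (hj : ∀ p, φ' (t p) = j (φ p))
    (h1 : ∀ h ∈ A', h ∘ j ∈ A) (h2 : ∀ h ∈ A, h ∘ r ∈ A') :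
    (𝒳.coinduced π).regular V = ((affine A).induced φ).regular V := by
  ext F
  change F ∘ π ∈ 𝒳.regular (π ⁻¹' V) ↔ _
  rw [h𝒳]
  constructor
  · intro hF p hp
    obtain ⟨W, hW, hpW, K, hK, e⟩ := hF (t p) (by
      change π (t p) ∈ V
      rwa [ht])
    refine ⟨j ⁻¹' W, @Continuous.isOpen_preimage _ _ (affine A).top (affine A').top j
      (continuous_affine h1) _ hW, ?_, K ∘ j, regular_affine_comp h1 hK, fun z hz hzW => ?_⟩
    · change j (φ p) ∈ W
      rwa [← hj]
    · have := e (t z) (by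
        change π (t z) ∈ V
        rwa [ht]) (by rwa [hj])
      rw [hj] at this
      change F (π (t z)) = _ at this
      rwa [ht] at this
  · intro hF x hx
    obtain ⟨W, hW, hpW, K, hK, e⟩ := hF (π x) hx
    refine ⟨r ⁻¹' W, @Continuous.isOpen_preimage _ _ (affine A').top (affine A).top r
      (continuous_affine h2) _ hW, ?_, K ∘ r, regular_affine_comp h2 hK, fun z hz hzW => ?_⟩
    · change r (φ' x) ∈ W
      rwa [hr]
    · change F (π z) = K (r (φ' z))
      rw [hr]
      exact e (π z) hz (by
        rw [← hr]
        exact hzW)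

end Quotient

end FunctionSpace

end WilsonLines

end

/-! ### Wilson lines, reconstruction of the frames, and the image -/

noncomputable section

set_option linter.unusedSectionVars false

namespace WilsonLines

section Words

/-- The product `a_n ⋯ a_2 a_1`. -/
def descProd {M : Type*} [Monoid M] (a : ℕ → M) : ℕ → M
  | 0 => 1
  | n + 1 => a (n + 1) * descProd a n

theorem prod_reverse_ofFn {M : Type*} [Monoid M] (a : ℕ → M) (n : ℕ) :
    (List.ofFn fun j : Fin n => a (j + 1)).reverse.prod = descProd a n := by
  induction n with
  | zero => rfl
  | succ n ih =>
    rw [List.ofFn_succ', List.concat_eq_append, List.reverse_append, List.reverse_singleton,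
      List.singleton_append, List.prod_cons, descProd, ← ih]
    rfl

/-- Indices start at `0`, so `a 0` is the factor at the first marked point. It is split off because
its arc alone involves `ρ(δ_k)`. -/
theorem bdryWord_eq {M : Type*} [Monoid M] {N : ℕ} (hN : 0 < N) (w : M) (u : Fin N → M) (a : ℕ → M)
    (ha : ∀ j (h : j < N), a j = u ⟨j, h⟩ * w) : bdryWord w u = descProd a (N - 1) * a 0 := by
  obtain ⟨n, rfl⟩ : ∃ n, N = n + 1 := ⟨N - 1, by omega⟩
  have : (fun j => u j * w) = fun j : Fin (n + 1) => a j := funext fun j => (ha j j.2).symm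
  rw [bdryWord, this, List.ofFn_succ, List.reverse_cons, List.prod_append, Nat.add_sub_cancel,
    ← prod_reverse_ofFn]
  simp

theorem bdryWordFirst_eq {M : Type*} [Monoid M] {N : ℕ} (hN : 0 < N) (w : M) (u : Fin N → M)
    (a : ℕ → M) (ha : ∀ j (h : j < N), a j = u ⟨j, h⟩ * w) :
    bdryWordFirst w u = a 0 * descProd a (N - 1) := by
  obtain ⟨n, rfl⟩ : ∃ n, N = n + 1 := ⟨N - 1, by omega⟩
  have : (fun j => u j * w) = fun j : Fin (n + 1) => a j := funext fun j => (ha j j.2).symm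
  rw [bdryWordFirst, this, List.ofFn_succ, List.rotate_cons_succ, List.rotate_zero,
    List.reverse_append, List.prod_append, Nat.add_sub_cancel, ← prod_reverse_ofFn]
  simp

theorem map_monodromyWord {M M' : Type*} [Monoid M] [Monoid M'] (f : M →* M') {g b : ℕ}
    (a a' β β' : Fin g → M) (d : Fin b → M) :
    f (monodromyWord a a' β β' d) = monodromyWord (fun i => f (a i)) (fun i => f (a' i))
      (fun i => f (β i)) (fun i => f (β' i)) fun k => f (d k) := by
  simp only [monodromyWord, map_mul, map_list_prod, List.map_ofFn, Function.comp_def]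

end Words

section Wilson

variable {𝔤 : Type*} [LieRing 𝔤] [LieAlgebra ℂ 𝔤] [FiniteDimensional ℂ 𝔤]
  [LieAlgebra.IsKilling ℂ 𝔤] {𝔥 : LieSubalgebra ℂ 𝔤} [𝔥.IsCartanSubalgebra] {D : Pinned 𝔥}
  {S : Type*} [TopologicalSpace S] [ChartedSpace (EuclideanHalfSpace 2) S]
  {Sig : MarkedSurface S} {x : S} {c : CurveSystem Sig x}

theorem gE_smul_pStd (y : Atlas D c) (E : Sig.Ival) : gE y E • D.pStd = y.1.2.2 E :=
  D.elt_smul_pStd _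

theorem gE_smul (h : D.G) (y : Atlas D c) (E : Sig.Ival) : gE (h • y) E = h * gE y E :=
  D.elt_smul _ _

theorem smul_rho (h : D.G) (y : Atlas D c) (γ : LoopGroup x) :
    (h • y).1.1 γ = h * y.1.1 γ * h⁻¹ := rfl

theorem wilsonLine_smul {E E' : Sig.Ival} (a : c.ArcClass E E') (h : D.G) (y : Atlas D c) :
    wilsonLine a (h • y) = wilsonLine a y := by
  simp only [wilsonLine, gE_smul, smul_rho]
  group

theorem monodromy_smul (γ : LoopGroup x) (h : D.G) (y : Atlas D c) :
    monodromy γ (h • y) = monodromy γ y := by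
  simp only [monodromy, gE_smul, smul_rho]
  group

theorem phiTuple_smul (h : D.G) (y : Atlas D c) : phiTuple (h • y) = phiTuple y := by
  -- The third component contains a membership test whose decision procedure depends on the group
  -- element, so plain rewriting does not apply.
  have key : ∀ w w' : D.G, w = w' → ∀ [Decidable (w ∈ D.B)] [Decidable (w' ∈ D.B)],
      (if h : w ∈ D.B then (⟨w, h⟩ : D.B) else 1) = if h : w' ∈ D.B then ⟨w', h⟩ else 1 := by
    rintro w _ rfl _ _
    congr
  refine Prod.ext (funext fun i => monodromy_smul _ h y) (Prod.ext
    (funext fun k => wilsonLine_smul _ h y) (funext fun E => ?_))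
  classical exact key _ _ (wilsonLine_smul (c.bdryArc E) h y)

theorem phiTilde_smul (h : D.G) (y : Atlas D c) :
    phiTilde (h • y) = ((phiTilde y).1, h * (phiTilde y).2) := by
  simp only [phiTilde, phiTuple_smul, gE_smul]

theorem phi_toModuli (y : Atlas D c) : phi D c (toModuli D c y) = phiTuple y := by
  have h : (MulAction.orbitRel D.G (Atlas D c)) (Quotient.out (toModuli D c y)) y :=
    Quotient.mk_out y
  obtain ⟨g, hg⟩ := h
  rw [phi, ← hg]
  exact phiTuple_smul g y

theorem piPlus_smul_pStd (g : D.G) : D.piPlus (g • D.pStd) = ((g : D.G) : D.G ⧸ D.B) := by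
  change (((g * 1 : D.G) : D.G ⧸ D.B) : D.Flag) = _
  rw [mul_one]

theorem piMinus_smul_pStd (g : D.G) : D.piMinus (g • D.pStd) = ((g * D.w0 : D.G) : D.G ⧸ D.B) := rfl

theorem flag_eq (y : Atlas D c) (E : Sig.Ival) : y.1.2.1 E = ((gE y E : D.G) : D.G ⧸ D.B) := by
  rw [← (y.2 E).1, ← gE_smul_pStd, piPlus_smul_pStd]

theorem wilsonLine_bdryArc_succ (y : Atlas D c) (k : Fin Sig.b) (j : ℕ) (h : j + 1 < Sig.N k) :
    wilsonLine (c.bdryArc ⟨k, ⟨j + 1, h⟩⟩) y =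
      (gE y ⟨k, ⟨j + 1, h⟩⟩)⁻¹ * gE y ⟨k, ⟨j, Nat.lt_of_succ_lt h⟩⟩ * D.w0 := by
  rw [wilsonLine, c.loopOfArc_bdryArc_succ, map_one, mul_one]
  rfl

theorem wilsonLine_bdryArc_first (y : Atlas D c) (k : Fin Sig.b) :
    wilsonLine (c.bdryArc (Sig.firstIval k)) y =
      (gE y (Sig.firstIval k))⁻¹ * (y.1.1 (c.δ k))⁻¹ * gE y (Sig.lastIval k) * D.w0 := by
  rw [wilsonLine, c.loopOfArc_bdryArc_zero, map_inv]
  rfl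

theorem wilsonLine_arcEps (y : Atlas D c) (E E' : Sig.Ival) :
    wilsonLine (c.arcEps E E') y = (gE y E)⁻¹ * gE y E' * D.w0 := by
  rw [wilsonLine, c.loopOfArc_arcEps, map_one, mul_one]

/-- The marked point at the start of `E` carries the flag `g_E.B⁺`, and `π₋` of the preceding
pinning is `g_{E'} w̄₀.B⁺`. Their equality, with `ρ(δ_k)` inserted at the last interval, says that
this Wilson line fixes the flag of `B⁺`. -/
theorem wilsonLine_bdryArc_mem (E : Sig.Ival) (y : Atlas D c) : wilsonLine (c.bdryArc E) y ∈ D.B := by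
  obtain ⟨k, ⟨_ | j, h⟩⟩ := E
  · change wilsonLine (c.bdryArc (Sig.firstIval k)) y ∈ D.B
    rw [wilsonLine_bdryArc_first]
    have h1 := (y.2 (Sig.lastIval k)).2
    have h2 : ¬ (((Sig.lastIval k).2 : ℕ) + 1 < Sig.N (Sig.lastIval k).1) := by
      change ¬ (Sig.N k - 1 + 1 < Sig.N k)
      omega
    rw [dif_neg h2, ← gE_smul_pStd, piMinus_smul_pStd, flag_eq] at h1
    have h3 := D.flag_eq_iff.1 h1.symm
    have h4 : (y.1.1 (c.δ k) * gE y (Sig.firstIval k))⁻¹ * (gE y (Sig.lastIval k) * D.w0) ∈ D.B := h3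
    rw [mul_inv_rev] at h4
    simpa only [mul_assoc] using h4
  · rw [wilsonLine_bdryArc_succ]
    have h1 := (y.2 ⟨k, ⟨j, Nat.lt_of_succ_lt h⟩⟩).2
    rw [dif_pos h, ← gE_smul_pStd, piMinus_smul_pStd, flag_eq] at h1
    have h3 := D.flag_eq_iff.1 h1.symm
    simpa only [mul_assoc] using h3

theorem phiTuple_ival (y : Atlas D c) (E : Sig.Ival) :
    ((phiTuple y).2.2 E).1 = wilsonLine (c.bdryArc E) y := by
  simp only [phiTuple]
  rw [dif_pos (wilsonLine_bdryArc_mem E y)]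

/-! ### Reconstruction of the frames -/

/-- The factors `g_{j,j-1} w̄₀` of the boundary word. -/
def bdryStep (z : Target D c) (k : Fin Sig.b) (j : ℕ) : D.G :=
  if h : j < Sig.N k then (z.2.2 ⟨k, ⟨j, h⟩⟩).1 * D.w0 else 1

theorem bdryStep_of_lt (z : Target D c) (k : Fin Sig.b) (j : ℕ) (h : j < Sig.N k) :
    bdryStep z k j = (z.2.2 ⟨k, ⟨j, h⟩⟩).1 * D.w0 := dif_pos h

/-- The frame at the first boundary interval of a boundary component. -/
def frameFirst (z : Target D c) (g : D.G) (k : Fin Sig.b) : D.G :=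
  if h : k = Sig.k0 then g
  else g * (z.2.1 ⟨k, h⟩ * D.w0) * descProd (bdryStep z k) (Sig.N k - 1)

/-- The frames at the boundary intervals. -/
def frame (z : Target D c) (g : D.G) (E : Sig.Ival) : D.G :=
  frameFirst z g E.1 * (descProd (bdryStep z E.1) E.2)⁻¹

/-- The relation `w̄₀² = 1` makes each factor `g_{j,j-1} w̄₀` equal to `g_j⁻¹ g_{j-1}`, and the
product telescopes. -/
theorem gE_eq_mul_descProd (y : Atlas D c) (k : Fin Sig.b) (j : ℕ) (h : j < Sig.N k) :
    gE y ⟨k, ⟨j, h⟩⟩ = gE y (Sig.firstIval k) * (descProd (bdryStep (phiTuple y) k) j)⁻¹ := by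
  induction j with
  | zero =>
    rw [descProd, inv_one, mul_one]
    rfl
  | succ j ih =>
    rw [descProd, bdryStep_of_lt _ _ _ h, phiTuple_ival, wilsonLine_bdryArc_succ,
      mul_assoc _ D.w0 D.w0, D.w0_mul_w0, mul_one, mul_inv_rev, mul_inv_rev, inv_inv, ← mul_assoc,
      ← ih (Nat.lt_of_succ_lt h)]
    group

/-- On a component other than the first, `g^{(k)} w̄₀` is `g_0⁻¹ g_N`, which places the last
interval. The telescoping product then leads back to the first one. -/
theorem gE_eq_frame (y : Atlas D c) (E : Sig.Ival) :
    gE y E = frame (phiTuple y) (gE y Sig.E0) E := by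
  obtain ⟨k, ⟨j, h⟩⟩ := E
  rw [gE_eq_mul_descProd, frame]
  congr 1
  by_cases hk : k = Sig.k0
  · subst hk
    rw [frameFirst, dif_pos rfl]
    rfl
  · rw [frameFirst, dif_neg hk]
    have h1 : (phiTuple y).2.1 ⟨k, hk⟩ = wilsonLine (c.arcEps Sig.E0 (Sig.lastIval k)) y := rfl
    rw [h1, wilsonLine_arcEps, mul_assoc _ D.w0 D.w0, D.w0_mul_w0, mul_one, mul_inv_cancel_left,
      MarkedSurface.lastIval, gE_eq_mul_descProd y k (Sig.N k - 1), inv_mul_cancel_right]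

theorem rho_eq (y : Atlas D c) (γ : LoopGroup x) :
    y.1.1 γ = gE y Sig.E0 * monodromy γ y * (gE y Sig.E0)⁻¹ := by
  rw [monodromy]
  group

theorem closure_genLoop : Subgroup.closure (Set.range (genLoop c)) = ⊤ := by
  exact FreeGroup.lift_surjective_iff_closure_range_eq_top.1 c.generate

/-- The tuple and `g_0` determine the frames, and these the flags and pinnings. The monodromies,
conjugated back by `g_0`, determine `ρ` on generators. -/
theorem phiTilde_injective : Function.Injective (phiTilde : Atlas D c → _) := by
  intro y y' h
  have h1 : phiTuple y = phiTuple y' := congrArg Prod.fst h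
  have h2 : gE y Sig.E0 = gE y' Sig.E0 := congrArg Prod.snd h
  have h3 : ∀ E, gE y E = gE y' E := fun E => by rw [gE_eq_frame, gE_eq_frame y', h1, h2]
  have h4 : y.1.1 = y'.1.1 := by
    refine MonoidHom.eq_of_eqOn_dense (closure_genLoop (c := c)) ?_
    rintro _ ⟨i, rfl⟩
    have : monodromy (genLoop c i) y = monodromy (genLoop c i) y' := congrFun (congrArg Prod.fst h1) i
    rw [rho_eq, rho_eq y', this, h2]
  refine Subtype.ext (Prod.ext h4 (Prod.ext (funext fun E => ?_) (funext fun E => ?_)))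
  · rw [flag_eq, flag_eq, h3]
  · rw [← gE_smul_pStd, ← gE_smul_pStd, h3]

/-! ### The image -/

theorem monodromyWord_loops :
    monodromyWord c.α (fun i => (c.α i)⁻¹) c.β (fun i => (c.β i)⁻¹) c.δ = 1 := by
  have h1 : monodromyWord (fun i : Fin c.genus => (FreeGroup.of (Sum.inl i) :
      FreeGroup (Fin c.genus ⊕ Fin c.genus ⊕ Fin Sig.b)))
      (fun i => (FreeGroup.of (Sum.inl i))⁻¹) (fun i => FreeGroup.of (Sum.inr (Sum.inl i)))
      (fun i => (FreeGroup.of (Sum.inr (Sum.inl i)))⁻¹)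
      (fun k : Fin Sig.b => FreeGroup.of (Sum.inr (Sum.inr k))) ∈
      (FreeGroup.lift (Sum.elim c.α (Sum.elim c.β c.δ))).ker := by
    rw [c.relations]
    exact Subgroup.subset_normalClosure rfl
  rw [MonoidHom.mem_ker, map_monodromyWord] at h1
  simpa using h1

/-- The product of the boundary factors once around `∂_k` telescopes. What is left is `ρ(δ_k)⁻¹`,
conjugated by the frame at which the product starts: `g_1` on the first component and `g_N` on the
others, whence the conjugation by `g^{(k)} w̄₀`. -/
theorem phiTuple_mem_relationLocus (y : Atlas D c) : phiTuple y ∈ relationLocus D c := by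
  refine ⟨?_, ?_, fun k => ?_⟩
  · let θ : LoopGroup x →* D.G := (MulAut.conj (gE y Sig.E0)⁻¹).toMonoidHom.comp y.1.1
    have hθ : ∀ γ, θ γ = monodromy γ y := fun γ => by
      change (gE y Sig.E0)⁻¹ * y.1.1 γ * ((gE y Sig.E0)⁻¹)⁻¹ = _
      rw [inv_inv, monodromy]
    have := map_monodromyWord θ c.α (fun i => (c.α i)⁻¹) c.β (fun i => (c.β i)⁻¹) c.δ
    rw [monodromyWord_loops, map_one] at this
    simp only [map_inv] at this
    simp only [hθ] at this
    exact this.symm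
  · rw [bdryWordFirst_eq (Sig.N_pos _) _ _ _ (bdryStep_of_lt (phiTuple y) Sig.k0)]
    have h1 := gE_eq_mul_descProd y Sig.k0 (Sig.N Sig.k0 - 1)
      (Nat.sub_lt (Sig.N_pos _) Nat.one_pos)
    have h2 : bdryStep (phiTuple y) Sig.k0 0 = (gE y (Sig.firstIval Sig.k0))⁻¹ *
        (y.1.1 (c.δ Sig.k0))⁻¹ * gE y (Sig.lastIval Sig.k0) := by
      rw [bdryStep_of_lt _ _ _ (Sig.N_pos _), phiTuple_ival]
      refine (congrArg (· * D.w0) (wilsonLine_bdryArc_first y Sig.k0)).trans ?_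
      rw [mul_assoc _ D.w0 D.w0, D.w0_mul_w0, mul_one]
    have h3 : (phiTuple y).1 (Sum.inr (Sum.inr Sig.k0)) = monodromy (c.δ Sig.k0) y := rfl
    rw [h2, h3, MarkedSurface.lastIval, h1, monodromy]
    simp only [MarkedSurface.E0]
    group
  · rw [bdryWord_eq (Sig.N_pos _) _ _ _ (bdryStep_of_lt (phiTuple y) k.1)]
    have h1 := gE_eq_mul_descProd y k.1 (Sig.N k.1 - 1) (Nat.sub_lt (Sig.N_pos _) Nat.one_pos)
    have h2 : bdryStep (phiTuple y) k.1 0 = (gE y (Sig.firstIval k.1))⁻¹ *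
        (y.1.1 (c.δ k.1))⁻¹ * gE y (Sig.lastIval k.1) := by
      rw [bdryStep_of_lt _ _ _ (Sig.N_pos _), phiTuple_ival]
      refine (congrArg (· * D.w0) (wilsonLine_bdryArc_first y k.1)).trans ?_
      rw [mul_assoc _ D.w0 D.w0, D.w0_mul_w0, mul_one]
    have h3 : (phiTuple y).1 (Sum.inr (Sum.inr k.1)) = monodromy (c.δ k.1) y := rfl
    have h4 : (phiTuple y).2.1 k = wilsonLine (c.arcEps Sig.E0 (Sig.lastIval k.1)) y := rfl
    rw [h2, h3, h4, wilsonLine_arcEps, mul_assoc _ D.w0 D.w0, D.w0_mul_w0, mul_one,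
      MarkedSurface.lastIval, h1, monodromy]
    group

/-- The monodromy relation kills the single defining relator, so the assignment on generators
descends from the free group. -/
theorem exists_hom {z : Target D c} (hz : z ∈ relationLocus D c) :
    ∃ θ : LoopGroup x →* D.G, ∀ i, θ (genLoop c i) = z.1 i := by
  have hker : (FreeGroup.lift (Sum.elim c.α (Sum.elim c.β c.δ)) :
      FreeGroup (Fin c.genus ⊕ Fin c.genus ⊕ Fin Sig.b) →* LoopGroup x).ker ≤
      (FreeGroup.lift z.1).ker := by
    rw [c.relations]
    refine Subgroup.normalClosure_le_normal ?_
    rintro _ rfl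
    have h1 := map_monodromyWord (FreeGroup.lift z.1) (fun i => FreeGroup.of (Sum.inl i))
      (fun i => (FreeGroup.of (Sum.inl i))⁻¹) (fun i => FreeGroup.of (Sum.inr (Sum.inl i)))
      (fun i => (FreeGroup.of (Sum.inr (Sum.inl i)))⁻¹)
      (fun k : Fin Sig.b => FreeGroup.of (Sum.inr (Sum.inr k)))
    simp only [map_inv, FreeGroup.lift_apply_of, hz.1] at h1
    exact h1
  refine ⟨MonoidHom.liftOfSurjective _ c.generate ⟨FreeGroup.lift z.1, hker⟩, fun i => ?_⟩
  have h1 : genLoop c i = FreeGroup.lift (Sum.elim c.α (Sum.elim c.β c.δ)) (FreeGroup.of i) := by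
    rw [FreeGroup.lift_apply_of]
    rfl
  rw [h1]
  refine (MonoidHom.liftOfRightInverse_comp_apply _ _ _ _ _).trans ?_
  rw [FreeGroup.lift_apply_of]

theorem frame_first (z : Target D c) (g : D.G) (k : Fin Sig.b) :
    frame z g (Sig.firstIval k) = frameFirst z g k := by
  change frameFirst z g k * (1 : D.G)⁻¹ = _
  rw [inv_one, mul_one]

theorem frame_succ (z : Target D c) (g : D.G) (k : Fin Sig.b) (j : ℕ) (h : j + 1 < Sig.N k) :
    frame z g ⟨k, ⟨j + 1, h⟩⟩ * (z.2.2 ⟨k, ⟨j + 1, h⟩⟩).1 =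
      frame z g ⟨k, ⟨j, Nat.lt_of_succ_lt h⟩⟩ * D.w0 := by
  simp only [frame, descProd, bdryStep_of_lt z k (j + 1) h, mul_inv_rev, D.w0_inv]
  group

/-- The frames along `∂_k` are built by steps that never use the first marked point. That they close
up there is exactly the boundary relation. -/
theorem frame_last {z : Target D c} (hz : z ∈ relationLocus D c) (g : D.G) (k : Fin Sig.b) :
    g * z.1 (Sum.inr (Sum.inr k)) * g⁻¹ * frame z g (Sig.firstIval k) *
      (z.2.2 (Sig.firstIval k)).1 = frame z g (Sig.lastIval k) * D.w0 := by
  have h1 : (z.2.2 (Sig.firstIval k)).1 = bdryStep z k 0 * D.w0 := by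
    rw [bdryStep_of_lt z k 0 (Sig.N_pos k), mul_assoc, D.w0_mul_w0, mul_one]
    rfl
  rw [h1, ← mul_assoc]
  congr 1
  rw [frame_first]
  change _ = frameFirst z g k * (descProd (bdryStep z k) (Sig.N k - 1))⁻¹
  by_cases hk : k = Sig.k0
  · subst hk
    have h2 := hz.2.1
    rw [bdryWordFirst_eq (Sig.N_pos _) _ _ _ (bdryStep_of_lt z Sig.k0)] at h2
    rw [frameFirst, dif_pos rfl, ← inv_inv (z.1 _), ← h2]
    group
  · have h2 := hz.2.2 ⟨k, hk⟩
    rw [bdryWord_eq (Sig.N_pos _) _ _ _ (bdryStep_of_lt z k)] at h2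
    rw [frameFirst, dif_neg hk, ← inv_inv (z.1 _), ← h2]
    group

/-- The homomorphism is that of the tuple conjugated by `g`, and flags and pinnings come from the
frames. The incidence conditions reduce to `frame_succ` and `frame_last`, as the given boundary
elements lie in `B⁺`. -/
theorem exists_of_mem_relationLocus {z : Target D c} (hz : z ∈ relationLocus D c) (g : D.G) :
    ∃ y : Atlas D c, phiTilde y = (z, g) := by
  obtain ⟨θ, hθ⟩ := exists_hom hz
  let ρ : LoopGroup x →* D.G := (MulAut.conj g).toMonoidHom.comp θ
  have hρ : ∀ i, ρ (genLoop c i) = g * z.1 i * g⁻¹ := fun i => by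
    change g * θ (genLoop c i) * g⁻¹ = _
    rw [hθ]
  let Y : Ambient D c := (ρ, fun E => ((frame z g E : D.G) : D.G ⧸ D.B),
    fun E => frame z g E • D.pStd)
  have hY : Y ∈ atlasSet D c := by
    rintro ⟨k, ⟨j, h⟩⟩
    refine ⟨piPlus_smul_pStd _, ?_⟩
    change D.piMinus (frame z g ⟨k, ⟨j, h⟩⟩ • D.pStd) = _
    rw [piMinus_smul_pStd]
    split_ifs with hj
    · refine (D.flag_eq_iff.2 ?_).symm
      rw [← frame_succ z g k j hj, inv_mul_cancel_left]
      exact (z.2.2 _).2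
    · have hj' : j = Sig.N k - 1 := by
        change ¬ (j + 1 < Sig.N k) at hj
        omega
      subst hj'
      have h1 := frame_last hz g k
      refine (D.flag_eq_iff (a := ρ (c.δ k) * frame z g (Sig.firstIval k)).2 ?_).symm
      have h2 : ρ (c.δ k) = g * z.1 (Sum.inr (Sum.inr k)) * g⁻¹ := hρ (Sum.inr (Sum.inr k))
      rw [h2]
      have h3 : frame z g ⟨k, ⟨Sig.N k - 1, h⟩⟩ * D.w0 = _ := h1.symm
      rw [h3, inv_mul_cancel_left]
      exact (z.2.2 _).2
  have hgE : ∀ E, gE (⟨Y, hY⟩ : Atlas D c) E = frame z g E := fun E => D.elt_pStd _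
  have h0 : gE (⟨Y, hY⟩ : Atlas D c) Sig.E0 = g := by
    rw [hgE]
    refine (frame_first z g Sig.k0).trans ?_
    rw [frameFirst, dif_pos rfl]
  refine ⟨⟨Y, hY⟩, Prod.ext (Prod.ext (funext fun i => ?_) (Prod.ext (funext fun k => ?_)
    (funext fun E => Subtype.ext ?_))) h0⟩
  · change (gE (⟨Y, hY⟩ : Atlas D c) Sig.E0)⁻¹ * ρ (genLoop c i) * gE ⟨Y, hY⟩ Sig.E0 = z.1 i
    rw [h0, hρ]
    group
  · change wilsonLine (c.arcEps Sig.E0 (Sig.lastIval k.1)) (⟨Y, hY⟩ : Atlas D c) = z.2.1 k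
    rw [wilsonLine_arcEps, h0, hgE]
    change g⁻¹ * (frameFirst z g k.1 * (descProd (bdryStep z k.1) (Sig.N k.1 - 1))⁻¹) * D.w0 = _
    rw [frameFirst, dif_neg k.2, mul_inv_cancel_right, inv_mul_cancel_left, mul_assoc,
      D.w0_mul_w0, mul_one]
  · refine (phiTuple_ival _ E).trans ?_
    obtain ⟨k, ⟨_ | j, h⟩⟩ := E
    · refine (wilsonLine_bdryArc_first (⟨Y, hY⟩ : Atlas D c) k).trans ?_
      have h1 := frame_last hz g k
      rw [hgE, hgE, mul_assoc, ← h1]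
      change _ * (ρ (c.δ k))⁻¹ * _ = _
      have h2 : ρ (c.δ k) = g * z.1 (Sum.inr (Sum.inr k)) * g⁻¹ := hρ (Sum.inr (Sum.inr k))
      rw [h2]
      simp only [MarkedSurface.firstIval]
      group
    · rw [wilsonLine_bdryArc_succ, hgE, hgE, mul_assoc, ← frame_succ z g k j h, inv_mul_cancel_left]

theorem range_phiTilde :
    Set.range (phiTilde : Atlas D c → _) = relationLocus D c ×ˢ Set.univ := by
  ext ⟨z, g⟩
  constructor
  · rintro ⟨y, e⟩
    refine ⟨?_, trivial⟩
    have : phiTuple y = z := congrArg Prod.fst e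
    rw [← this]
    exact phiTuple_mem_relationLocus y
  · rintro ⟨hz, -⟩
    exact exists_of_mem_relationLocus hz g

theorem range_phi : Set.range (phi D c) = relationLocus D c := by
  ext z
  constructor
  · rintro ⟨P, rfl⟩
    exact phiTuple_mem_relationLocus _
  · intro hz
    obtain ⟨y, e⟩ := exists_of_mem_relationLocus hz 1
    exact ⟨toModuli D c y, (phi_toModuli y).trans (congrArg Prod.fst e)⟩

/-- The section of the projection to the moduli space with `g_0 = 1`. -/
def normalize (P : Moduli D c) : Atlas D c := (gE (Quotient.out P) Sig.E0)⁻¹ • Quotient.out P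

theorem toModuli_normalize (P : Moduli D c) : toModuli D c (normalize P) = P := by
  conv_rhs => rw [← Quotient.out_eq P]
  exact Quotient.sound ⟨(gE (Quotient.out P) Sig.E0)⁻¹, rfl⟩

theorem phiTilde_normalize (P : Moduli D c) : phiTilde (normalize P) = (phi D c P, 1) := by
  rw [normalize, phiTilde_smul, phiTilde, inv_mul_cancel]
  rfl

theorem phi_injective : Function.Injective (phi D c) := by
  intro P P' h
  rw [← toModuli_normalize P, ← toModuli_normalize P']
  congr 1
  refine phiTilde_injective ?_
  rw [phiTilde_normalize, phiTilde_normalize, h]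

end Wilson

end WilsonLines

end

/-! ### The closed embeddings -/

noncomputable section

set_option linter.unusedSectionVars false

namespace WilsonLines

open FunctionSpace Pinned

section Regular

variable {𝔤 : Type*} [LieRing 𝔤] [LieAlgebra ℂ 𝔤] [FiniteDimensional ℂ 𝔤]
  [LieAlgebra.IsKilling ℂ 𝔤] {𝔥 : LieSubalgebra ℂ 𝔤} [𝔥.IsCartanSubalgebra] {D : Pinned 𝔥}
  {S : Type*} [TopologicalSpace S] [ChartedSpace (EuclideanHalfSpace 2) S]
  {Sig : MarkedSurface S} {x : S} {c : CurveSystem Sig x}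

theorem isReg_of_eq {Y ι : Type*} {A : Subalgebra ℂ (Y → ℂ)} {F : ι → Y → D.G} {F' : Y → D.G}
    (i : ι) (hA : A = D.coordAlg F) (hF : ∀ y, F i y = F' y) : IsReg A F' := by
  rw [hA, ← show F i = F' from funext hF]
  exact isReg_coordAlg F i

theorem isClosed_isReg_eq {Y : Type*} {A : Subalgebra ℂ (Y → ℂ)} {F F' : Y → D.G}
    (h : IsReg A F) (h' : IsReg A F') : IsClosed[(affine A).top] {y | F y = F' y} := by
  have : {y | F y = F' y} = ⋂ (ℓ : Module.Dual ℂ 𝔤) (v : 𝔤),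
      {y | ((fun y => ℓ (F y • v)) - fun y => ℓ (F' y • v)) y = 0} := by
    ext y
    simp only [Set.mem_ofPred_eq, Set.mem_iInter, Pi.sub_apply, sub_eq_zero]
    constructor
    · intro e ℓ v
      rw [e]
    · intro e
      refine Subtype.ext (Units.ext (LinearMap.ext fun v => ?_))
      refine sub_eq_zero.1 ((Module.forall_dual_apply_eq_zero_iff ℂ _).1 fun ℓ => ?_)
      rw [map_sub, sub_eq_zero]
      exact e ℓ v
  rw [this]
  exact @isClosed_iInter _ _ (affine A).top _ fun ℓ => @isClosed_iInter _ _ (affine A).top _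
    fun v => isClosed_affine (sub_mem (h ℓ v).1 (h' ℓ v).1)

section Words

variable {Y : Type*} {A : Subalgebra ℂ (Y → ℂ)}

theorem isReg_monodromyWord {g b : ℕ} {a a' β β' : Fin g → Y → D.G} {d : Fin b → Y → D.G}
    (ha : ∀ i, IsReg A (a i)) (ha' : ∀ i, IsReg A (a' i)) (hβ : ∀ i, IsReg A (β i))
    (hβ' : ∀ i, IsReg A (β' i)) (hd : ∀ i, IsReg A (d i)) :
    IsReg A fun y => monodromyWord (fun i => a i y) (fun i => a' i y) (fun i => β i y)
      (fun i => β' i y) fun k => d k y := by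
  simp only [monodromyWord, List.ofFn_eq_map]
  exact (IsReg.list_prod fun i => (((ha i).mul (hβ i)).mul (ha' i)).mul (hβ' i)).mul
    (IsReg.list_prod hd)

theorem isReg_bdryWord {N : ℕ} (w : D.G) {u : Fin N → Y → D.G} (hu : ∀ i, IsReg A (u i)) :
    IsReg A fun y => bdryWord w fun j => u j y := by
  simp only [bdryWord, List.ofFn_eq_map, ← List.map_reverse]
  exact IsReg.list_prod fun i => (hu i).mul (IsReg.const w)

theorem isReg_bdryWordFirst {N : ℕ} (w : D.G) {u : Fin N → Y → D.G} (hu : ∀ i, IsReg A (u i)) :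
    IsReg A fun y => bdryWordFirst w fun j => u j y := by
  simp only [bdryWordFirst, List.ofFn_eq_map, ← List.map_rotate, ← List.map_reverse]
  exact IsReg.list_prod fun i => (hu i).mul (IsReg.const w)

theorem isReg_descProd {a : ℕ → Y → D.G} (ha : ∀ j, IsReg A (a j)) (n : ℕ) :
    IsReg A fun y => descProd (fun j => a j y) n := by
  induction n with
  | zero => exact IsReg.const 1
  | succ n ih => exact (ha (n + 1)).mul ih

end Words

/-- Regular maps to the target. -/
def IsRegTarget {Y : Type*} (A : Subalgebra ℂ (Y → ℂ)) (σ : Y → Target D c) : Prop :=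
  (∀ i, IsReg A fun y => (σ y).1 i) ∧ (∀ k, IsReg A fun y => (σ y).2.1 k) ∧
    ∀ E, IsReg A fun y => ((σ y).2.2 E).1

section Target

variable {Y : Type*} {A : Subalgebra ℂ (Y → ℂ)} {σ : Y → Target D c}

theorem isRegTarget_id : IsRegTarget (targetAlg D c) fun z => z :=
  ⟨fun i => isReg_of_eq (Sum.inl i) rfl fun _ => rfl, fun k => isReg_of_eq (Sum.inr (Sum.inl k)) rfl fun _ => rfl,
    fun E => isReg_of_eq (Sum.inr (Sum.inr E)) rfl fun _ => rfl⟩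

theorem isRegTarget_fst : IsRegTarget (targetProdAlg D c) Prod.fst :=
  ⟨fun i => isReg_of_eq (Sum.inl (Sum.inl i)) rfl fun _ => rfl, fun k => isReg_of_eq (Sum.inl (Sum.inr (Sum.inl k))) rfl fun _ => rfl,
    fun E => isReg_of_eq (Sum.inl (Sum.inr (Sum.inr E))) rfl fun _ => rfl⟩

theorem isReg_snd : IsReg (targetProdAlg D c) (Prod.snd : Target D c × D.G → D.G) :=
  isReg_of_eq (Sum.inr ()) rfl fun _ => rfl

namespace IsRegTarget

theorem comp_mem (h : IsRegTarget A σ) {f : Target D c → ℂ} (hf : f ∈ targetAlg D c) :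
    f ∘ σ ∈ A := by
  refine coordAlg_comp ?_ hf
  rintro (i | k | E)
  · exact h.1 i
  · exact h.2.1 k
  · exact h.2.2 E

theorem comp_prod_mem (h : IsRegTarget A σ) {g : Y → D.G} (hg : IsReg A g)
    {f : Target D c × D.G → ℂ} (hf : f ∈ targetProdAlg D c) : (f ∘ fun y => (σ y, g y)) ∈ A := by
  refine coordAlg_comp ?_ hf
  rintro ((i | k | E) | _)
  · exact h.1 i
  · exact h.2.1 k
  · exact h.2.2 E
  · exact hg

theorem comp {X : Type*} {A' : Subalgebra ℂ (X → ℂ)} (h : IsRegTarget A σ) {τ : X → Y}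
    (hτ : ∀ f ∈ A, f ∘ τ ∈ A') : IsRegTarget A' fun x => σ (τ x) :=
  ⟨fun i => (h.1 i).comp hτ, fun k => (h.2.1 k).comp hτ, fun E => (h.2.2 E).comp hτ⟩

theorem isClosed_preimage (h : IsRegTarget A σ) :
    IsClosed[(affine A).top] {y | σ y ∈ relationLocus D c} := by
  have e : {y | σ y ∈ relationLocus D c} =
      {y | monodromyWord (fun i => (σ y).1 (.inl i)) (fun i => ((σ y).1 (.inl i))⁻¹)
        (fun i => (σ y).1 (.inr (.inl i))) (fun i => ((σ y).1 (.inr (.inl i)))⁻¹)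
        (fun k => (σ y).1 (.inr (.inr k))) = 1} ∩
      ({y | bdryWordFirst D.w0 (fun j => ((σ y).2.2 ⟨Sig.k0, j⟩).1) =
        ((σ y).1 (.inr (.inr Sig.k0)))⁻¹} ∩
      ⋂ k : OtherIndex c, {y |
        ((σ y).2.1 k * D.w0) * bdryWord D.w0 (fun j => ((σ y).2.2 ⟨k.1, j⟩).1) *
          ((σ y).2.1 k * D.w0)⁻¹ = ((σ y).1 (.inr (.inr k.1)))⁻¹}) := by
    ext y
    simp only [Set.mem_inter_iff, Set.mem_iInter]
    rfl
  rw [e]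
  let _ := (affine A).top
  refine IsClosed.inter ?_ (IsClosed.inter ?_ (isClosed_iInter fun k => ?_))
  · exact isClosed_isReg_eq (isReg_monodromyWord (fun i => h.1 _) (fun i => (h.1 _).inv)
      (fun i => h.1 _) (fun i => (h.1 _).inv) fun k => h.1 _) (IsReg.const 1)
  · exact isClosed_isReg_eq (isReg_bdryWordFirst _ fun j => h.2.2 _) (h.1 _).inv
  · have hk := (h.2.1 k).mul (IsReg.const (A := A) D.w0)
    exact isClosed_isReg_eq ((hk.mul (isReg_bdryWord _ fun j => h.2.2 _)).mul hk.inv) (h.1 _).inv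

theorem isReg_bdryStep (h : IsRegTarget A σ) (k : Fin Sig.b) (j : ℕ) :
    IsReg A fun y => bdryStep (σ y) k j := by
  unfold bdryStep
  split_ifs with hj
  · exact (h.2.2 _).mul (IsReg.const _)
  · exact IsReg.const 1

theorem isReg_frame (h : IsRegTarget A σ) {g : Y → D.G} (hg : IsReg A g) (E : Sig.Ival) :
    IsReg A fun y => frame (σ y) (g y) E := by
  refine IsReg.mul ?_ (isReg_descProd (h.isReg_bdryStep _) _).inv
  unfold frameFirst
  split_ifs with hk
  · exact hg
  · exact (hg.mul ((h.2.1 _).mul (IsReg.const _))).mul (isReg_descProd (h.isReg_bdryStep _) _)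

end IsRegTarget

end Target

/-- Functions on the atlas that pull back to regular functions on the cover. -/
def atlasAlg (D : Pinned 𝔥) (c : CurveSystem Sig x) : Subalgebra ℂ (Atlas D c → ℂ) where
  carrier := {f | ∃ k : Ambient D c → ℂ, k ∘ coverMap D c ∈ coverAlg D c ∧ k ∘ Subtype.val = f}
  mul_mem' := by
    rintro _ _ ⟨k, hk, rfl⟩ ⟨k', hk', rfl⟩
    exact ⟨k * k', mul_mem hk hk', rfl⟩
  add_mem' := by
    rintro _ _ ⟨k, hk, rfl⟩ ⟨k', hk', rfl⟩
    exact ⟨k + k', add_mem hk hk', rfl⟩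
  algebraMap_mem' := fun r => ⟨fun _ => r, (coverAlg D c).algebraMap_mem r, rfl⟩

theorem isReg_rho (γ : LoopGroup x) :
    IsReg (atlasAlg D c) fun y : Atlas D c => y.1.1 γ := fun ℓ v => by
  have h : IsReg (coverAlg D c) fun y => y.1 γ := isReg_of_eq (Sum.inl γ) rfl fun _ => rfl
  exact ⟨⟨fun a => ℓ (a.1 γ • v), (h ℓ v).1, rfl⟩, ⟨fun a => ℓ ((a.1 γ)⁻¹ • v), (h ℓ v).2, rfl⟩⟩

/-- Pulled back to the cover, the element of a pinning `g.p_std` is the coordinate `g` itself, so it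
is regular for the quotient structure. -/
theorem isReg_gE (E : Sig.Ival) :
    IsReg (atlasAlg D c) fun y : Atlas D c => gE y E := fun ℓ v => by
  have h : IsReg (coverAlg D c) fun y => D.elt ((coverMap D c y).2.2 E) :=
    isReg_of_eq (Sum.inr (Sum.inr E)) rfl fun y => (D.elt_pStd _).symm
  exact ⟨⟨fun a => ℓ (D.elt (a.2.2 E) • v), (h ℓ v).1, rfl⟩,
    ⟨fun a => ℓ ((D.elt (a.2.2 E))⁻¹ • v), (h ℓ v).2, rfl⟩⟩

theorem isReg_wilsonLine {E E' : Sig.Ival} (a : c.ArcClass E E') :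
    IsReg (atlasAlg D c) (wilsonLine a) :=
  (((isReg_gE E).inv.mul (isReg_rho _)).mul (isReg_gE E')).mul (IsReg.const _)

theorem isReg_monodromy (γ : LoopGroup x) : IsReg (atlasAlg D c) (monodromy γ) :=
  ((isReg_gE _).inv.mul (isReg_rho γ)).mul (isReg_gE _)

theorem isRegTarget_phiTuple : IsRegTarget (atlasAlg D c) phiTuple := by
  refine ⟨fun i => isReg_monodromy _, fun k => isReg_wilsonLine _, fun E => ?_⟩
  simp only [phiTuple_ival]
  exact isReg_wilsonLine _

/-- Functions on the atlas that are pulled back from the target. -/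
def pulledAlg (D : Pinned 𝔥) (c : CurveSystem Sig x) : Subalgebra ℂ (Atlas D c → ℂ) where
  carrier := {f | ∃ k ∈ targetProdAlg D c, k ∘ phiTilde = f}
  mul_mem' := by
    rintro _ _ ⟨k, hk, rfl⟩ ⟨k', hk', rfl⟩
    exact ⟨k * k', mul_mem hk hk', rfl⟩
  add_mem' := by
    rintro _ _ ⟨k, hk, rfl⟩ ⟨k', hk', rfl⟩
    exact ⟨k + k', add_mem hk hk', rfl⟩
  algebraMap_mem' := fun r => ⟨fun _ => r, (targetProdAlg D c).algebraMap_mem r, rfl⟩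

theorem comp_phiTilde_mem {f : Target D c × D.G → ℂ} (hf : f ∈ targetProdAlg D c) :
    f ∘ phiTilde ∈ pulledAlg D c := ⟨f, hf, rfl⟩

theorem pulled_gE (E : Sig.Ival) : IsReg (pulledAlg D c) fun y : Atlas D c => gE y E := by
  have h : IsReg (pulledAlg D c) fun y => frame (phiTilde y).1 (phiTilde y).2 E :=
    (isRegTarget_fst.isReg_frame isReg_snd E).comp fun _ => comp_phiTilde_mem
  have e : (fun y : Atlas D c => gE y E) = fun y => frame (phiTilde y).1 (phiTilde y).2 E :=
    funext fun y => gE_eq_frame y E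
  rw [e]
  exact h

theorem pulled_genLoop (i : GenIndex c) : IsReg (pulledAlg D c) fun y : Atlas D c => y.1.1 (genLoop c i) := by
  have h : IsReg (pulledAlg D c) (monodromy (genLoop c i)) :=
    (isRegTarget_fst.1 i).comp fun _ => comp_phiTilde_mem
  simp only [rho_eq]
  exact ((pulled_gE _).mul h).mul (pulled_gE _).inv

/-- The target records `ρ` only on generators. An arbitrary loop is a word in them, and products of
regular maps are regular. -/
theorem pulled_rho (γ : LoopGroup x) : IsReg (pulledAlg D c) fun y : Atlas D c => y.1.1 γ := by
  have hγ : γ ∈ Subgroup.closure (Set.range (genLoop c)) := by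
    rw [closure_genLoop]
    trivial
  induction hγ using Subgroup.closure_induction with
  | mem γ h =>
    obtain ⟨i, rfl⟩ := h
    exact pulled_genLoop i
  | one =>
    simp only [map_one]
    exact IsReg.const 1
  | mul γ γ' _ _ h h' =>
    simp only [map_mul]
    exact h.mul h'
  | inv γ _ h =>
    simp only [map_inv]
    exact h.inv

/-- The lift of the atlas to the cover given by the frames. -/
def liftCover (y : Atlas D c) : AmbientCover D c := (y.1.1, gE y, gE y)

theorem coverMap_liftCover (y : Atlas D c) : coverMap D c (liftCover y) = y.1 :=
  Prod.ext rfl (Prod.ext (funext fun E => (flag_eq y E).symm) (funext fun E => gE_smul_pStd y E))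

theorem exists_cover {h : Target D c × D.G → ℂ} (hh : h ∈ targetProdAlg D c) :
    ∃ k : Ambient D c → ℂ, k ∘ coverMap D c ∈ coverAlg D c ∧ k ∘ Subtype.val = h ∘ phiTilde :=
  isRegTarget_phiTuple.comp_prod_mem (isReg_gE _) hh

/-- Along the lift of the atlas to the cover, every coordinate is a value of `ρ` or a frame, and
both are regular in the tuple and `g_0`. -/
theorem exists_target {h : AmbientCover D c → ℂ} (hh : h ∈ coverAlg D c) :
    ∃ k ∈ targetProdAlg D c, k ∘ phiTilde = h ∘ liftCover := by
  refine coordAlg_comp (A := pulledAlg D c) (σ := liftCover) ?_ hh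
  rintro (γ | E | E)
  · exact pulled_rho γ
  · exact pulled_gE E
  · exact pulled_gE E

theorem top_atlasSpace :
    (atlasSpace D c).top = ((affine (targetProdAlg D c)).induced phiTilde).top :=
  top_coinduced_induced_eq coverMap_liftCover (fun _ => exists_cover) fun _ => exists_target

theorem regular_atlasSpace (U : Set (Atlas D c)) :
    (atlasSpace D c).regular U = ((affine (targetProdAlg D c)).induced phiTilde).regular U :=
  regular_coinduced_induced_eq coverMap_liftCover (fun _ => exists_cover) (fun _ => exists_target) U

theorem isClosedEmbedding_phiTilde :
    (atlasSpace D c).IsClosedEmbedding (.affine (targetProdAlg D c)) phiTilde := by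
  refine ⟨phiTilde_injective, ?_, top_atlasSpace, fun U _ => regular_atlasSpace U⟩
  rw [range_phiTilde, Set.prod_univ]
  exact isRegTarget_fst.isClosed_preimage

theorem comp_mk_one_mem {h : Target D c × D.G → ℂ} (hh : h ∈ targetProdAlg D c) :
    (h ∘ fun z => (z, 1)) ∈ targetAlg D c :=
  isRegTarget_id.comp_prod_mem (IsReg.const 1) hh

/-- In the affine models the projection to the moduli space is the first projection of `Z × G`, and
the section `normalize` is `z ↦ (z, 1)`. -/
theorem top_moduliSpace :
    (moduliSpace D c).top = (affine (targetAlg D c)).top.induced (phi D c) :=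
  top_coinduced_eq (r := Prod.fst) top_atlasSpace toModuli_normalize
    (fun y => (phi_toModuli y).symm) phiTilde_normalize (fun _ => comp_mk_one_mem)
    fun _ => isRegTarget_fst.comp_mem

theorem regular_moduliSpace (U : Set (Moduli D c)) :
    (moduliSpace D c).regular U = ((affine (targetAlg D c)).induced (phi D c)).regular U :=
  regular_coinduced_eq (r := Prod.fst) (regular_atlasSpace _) toModuli_normalize
    (fun y => (phi_toModuli y).symm) phiTilde_normalize (fun _ => comp_mk_one_mem)
    fun _ => isRegTarget_fst.comp_mem

theorem isClosedEmbedding_phi :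
    (moduliSpace D c).IsClosedEmbedding (.affine (targetAlg D c)) (phi D c) := by
  refine ⟨phi_injective, ?_, top_moduliSpace, fun U _ => regular_moduliSpace U⟩
  rw [range_phi]
  exact isRegTarget_id.isClosed_preimage

end Regular

end WilsonLines

end

/-! ### Points of the tensor product algebra -/

noncomputable section

set_option linter.unusedSectionVars false

namespace WilsonLines

open FunctionSpace Pinned

section General

variable {A : Type*} [CommRing A] [Algebra ℂ A]

/-- The Nullstellensatz for a finitely generated complex algebra. -/
theorem mem_radical_iff [Algebra.FiniteType ℂ A] {I : Ideal A} {t : A} :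
    t ∈ I.radical ↔ ∀ ψ : A →ₐ[ℂ] ℂ, I ≤ RingHom.ker ψ → ψ t = 0 := by
  have : IsJacobsonRing A := isJacobsonRing_of_finiteType (A := ℂ)
  constructor
  · rintro ⟨n, hn⟩ ψ h
    have := h hn
    rw [RingHom.mem_ker, map_pow] at this
    exact eq_zero_of_pow_eq_zero this
  · intro h
    rw [← isJacobsonRing_iff.1 this I.radical (Ideal.radical_isRadical I), Ideal.jacobson,
      Ideal.mem_sInf]
    rintro q ⟨hq, hmax⟩
    obtain ⟨ψ, rfl⟩ := exists_algHom_of_isMaximal q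
    exact h ψ (Ideal.le_radical.trans hq)

/-- The product of the values at a family of points. -/
def evalMultilinear {ι : Type*} [Fintype ι] (χ : ι → A →ₐ[ℂ] ℂ) :
    MultilinearMap ℂ (fun _ : ι => A) ℂ :=
  (MultilinearMap.mkPiAlgebra ℂ ι ℂ).compLinearMap fun i => (χ i).toLinearMap

theorem evalMultilinear_apply {ι : Type*} [Fintype ι] (χ : ι → A →ₐ[ℂ] ℂ) (f : ι → A) :
    evalMultilinear χ f = ∏ i, χ i (f i) := rfl

/-- The algebra homomorphism from a tensor power to the scalars given by a family of points. -/
def piEval {ι : Type*} [Fintype ι] (χ : ι → A →ₐ[ℂ] ℂ) : (⨂[ℂ] _ : ι, A) →ₐ[ℂ] ℂ :=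
  PiTensorProduct.liftAlgHom (evalMultilinear χ) (by simp [evalMultilinear_apply])
    (by simp [evalMultilinear_apply, Finset.prod_mul_distrib])

theorem piEval_single {ι : Type*} [Fintype ι] [DecidableEq ι] (χ : ι → A →ₐ[ℂ] ℂ) (i : ι) (a : A) :
    piEval χ (PiTensorProduct.singleAlgHom (R := ℂ) (A := fun _ : ι => A) i a) = χ i a := by
  refine (PiTensorProduct.lift.tprod (Pi.mulSingle i a : ι → A)).trans ?_
  rw [evalMultilinear_apply, Finset.prod_eq_single i]
  · rw [Pi.mulSingle_eq_same]
  · intro j _ hj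
    rw [Pi.mulSingle_eq_of_ne hj, map_one]
  · simp

theorem piTensor_induction {ι : Type*} [Finite ι] [DecidableEq ι] {B : Type*} [CommRing B]
    [Algebra ℂ B] (φ : (⨂[ℂ] _ : ι, A) →ₐ[ℂ] B) (T : Subalgebra ℂ B)
    (h : ∀ i a, φ (PiTensorProduct.singleAlgHom (R := ℂ) (A := fun _ : ι => A) i a) ∈ T)
    (t : ⨂[ℂ] _ : ι, A) : φ t ∈ T := by
  have := Fintype.ofFinite ι
  induction t using PiTensorProduct.induction_on with
  | smul_tprod r f =>
    rw [map_smul]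
    refine T.smul_mem ?_ r
    have : PiTensorProduct.tprod ℂ f =
        ∏ i, PiTensorProduct.singleAlgHom (R := ℂ) (A := fun _ : ι => A) i (f i) := by
      conv_lhs => rw [← Finset.univ_prod_mulSingle f, PiTensorProduct.tprod_prod]
      rfl
    rw [this, map_prod]
    exact prod_mem fun i _ => h i (f i)
  | add a b ha hb =>
    rw [map_add]
    exact add_mem ha hb

end General

section Tensor

variable {𝔤 : Type*} [LieRing 𝔤] [LieAlgebra ℂ 𝔤] [FiniteDimensional ℂ 𝔤]
  [LieAlgebra.IsKilling ℂ 𝔤] {𝔥 : LieSubalgebra ℂ 𝔤} [𝔥.IsCartanSubalgebra] {D : Pinned 𝔥}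
  {S : Type*} [TopologicalSpace S] [ChartedSpace (EuclideanHalfSpace 2) S]
  {Sig : MarkedSurface S} {x : S} {c : CurveSystem Sig x}

/-- Evaluation of functions at a point. -/
def evalAt {Y : Type*} (A : Subalgebra ℂ (Y → ℂ)) (y : Y) : A →ₐ[ℂ] ℂ :=
  (Pi.evalAlgHom ℂ (fun _ : Y => ℂ) y).comp A.val

/-- Evaluation of an element of the tensor product at a point of the target. -/
def evalTensor (z : Target D c) : TensorAlg D c →ₐ[ℂ] ℂ :=
  Algebra.TensorProduct.productMap
    (Algebra.TensorProduct.productMap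
      (show GenTensor D c →ₐ[ℂ] ℂ from piEval fun i => evalAt D.OG (z.1 i))
      (show OtherTensor D c →ₐ[ℂ] ℂ from piEval fun k => evalAt D.OG (z.2.1 k)))
    (show IvalTensor D c →ₐ[ℂ] ℂ from piEval fun E => evalAt D.OB (z.2.2 E))

theorem evalTensor_inclGen (z : Target D c) (i : GenIndex c) (m : D.OG) :
    evalTensor z (inclGen D c i m) = m.1 (z.1 i) := by
  refine (Algebra.TensorProduct.productMap_left_apply _ _ _).trans
    ((Algebra.TensorProduct.productMap_left_apply _ _ _).trans ?_)
  exact piEval_single (fun i => evalAt D.OG (z.1 i)) i m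

theorem evalTensor_inclOther (z : Target D c) (k : OtherIndex c) (m : D.OG) :
    evalTensor z (inclOther D c k m) = m.1 (z.2.1 k) := by
  refine (Algebra.TensorProduct.productMap_left_apply _ _ _).trans
    ((Algebra.TensorProduct.productMap_right_apply _ _ _).trans ?_)
  exact piEval_single (fun k => evalAt D.OG (z.2.1 k)) k m

theorem evalTensor_inclIval (z : Target D c) (E : Sig.Ival) (m : D.OB) :
    evalTensor z (inclIval D c E m) = m.1 (z.2.2 E) := by
  refine (Algebra.TensorProduct.productMap_right_apply _ _ _).trans ?_
  exact piEval_single (fun E => evalAt D.OB (z.2.2 E)) E m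

theorem tensor_induction (T : Subalgebra ℂ (TensorAlg D c)) (h1 : ∀ i m, inclGen D c i m ∈ T)
    (h2 : ∀ k m, inclOther D c k m ∈ T) (h3 : ∀ E m, inclIval D c E m ∈ T) (t : TensorAlg D c) :
    t ∈ T := by
  have k1 : ∀ a : GenTensor D c,
      (Algebra.TensorProduct.includeLeft.comp Algebra.TensorProduct.includeLeft :
        GenTensor D c →ₐ[ℂ] TensorAlg D c) a ∈ T := fun a =>
    piTensor_induction (ι := GenIndex c) (A := D.OG) _ T h1 a
  have k2 : ∀ a : OtherTensor D c,
      (Algebra.TensorProduct.includeLeft.comp Algebra.TensorProduct.includeRight :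
        OtherTensor D c →ₐ[ℂ] TensorAlg D c) a ∈ T := fun a =>
    piTensor_induction (ι := OtherIndex c) (A := D.OG) _ T h2 a
  have k3 : ∀ a : IvalTensor D c,
      (Algebra.TensorProduct.includeRight : IvalTensor D c →ₐ[ℂ] TensorAlg D c) a ∈ T := fun a =>
    piTensor_induction (ι := Sig.Ival) (A := D.OB) _ T h3 a
  have k4 : ∀ a : GenTensor D c ⊗[ℂ] OtherTensor D c,
      (Algebra.TensorProduct.includeLeft :
        GenTensor D c ⊗[ℂ] OtherTensor D c →ₐ[ℂ] TensorAlg D c) a ∈ T := by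
    intro a
    induction a using TensorProduct.induction_on with
    | zero =>
      rw [map_zero]
      exact zero_mem _
    | add a b ha hb =>
      rw [map_add]
      exact add_mem ha hb
    | tmul a b =>
      have : a ⊗ₜ[ℂ] b = Algebra.TensorProduct.includeLeft (S := ℂ) a *
          Algebra.TensorProduct.includeRight (R := ℂ) b := by simp
      rw [this, map_mul]
      exact mul_mem (k1 a) (k2 b)
  induction t using TensorProduct.induction_on with
  | zero => exact zero_mem _
  | add a b ha hb => exact add_mem ha hb
  | tmul a b =>
    have : a ⊗ₜ[ℂ] b = Algebra.TensorProduct.includeLeft (S := ℂ) a *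
        Algebra.TensorProduct.includeRight (R := ℂ) b := by simp
    rw [this]
    exact mul_mem (k4 a) (k3 b)

/-- A point of the tensor product restricts to a point of each factor, which comes from a group
element. The factors generate, so these elements determine the point. -/
theorem exists_evalTensor_eq (χ : TensorAlg D c →ₐ[ℂ] ℂ) : ∃ z : Target D c, χ = evalTensor z := by
  choose z1 h1 using fun i => D.exists_point_OG (χ.comp (inclGen D c i))
  choose z2 h2 using fun k => D.exists_point_OG (χ.comp (inclOther D c k))
  choose z3 h3 using fun E => D.exists_point_OB (χ.comp (inclIval D c E))
  refine ⟨(z1, z2, z3), AlgHom.ext fun t =>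
    tensor_induction (AlgHom.equalizer χ (evalTensor (z1, z2, z3))) ?_ ?_ ?_ t⟩
  · intro i m
    exact (h1 i m).trans (evalTensor_inclGen (z1, z2, z3) i m).symm
  · intro k m
    exact (h2 k m).trans (evalTensor_inclOther (z1, z2, z3) k m).symm
  · intro E m
    exact (h3 E m).trans (evalTensor_inclIval (z1, z2, z3) E m).symm

theorem mem_of_adjoin_eq_top {A B : Type*} [CommRing A] [Algebra ℂ A] [CommRing B] [Algebra ℂ B]
    {s : Set A} (hs : Algebra.adjoin ℂ s = ⊤) (φ : A →ₐ[ℂ] B) {T : Subalgebra ℂ B}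
    (h : ∀ a ∈ s, φ a ∈ T) (a : A) : φ a ∈ T := by
  have : Algebra.adjoin ℂ s ≤ T.comap φ := Algebra.adjoin_le h
  rw [hs] at this
  exact this trivial

instance finiteType_tensorAlg : Algebra.FiniteType ℂ (TensorAlg D c) := by
  obtain ⟨s, hs⟩ := (inferInstance : Algebra.FiniteType ℂ D.OG).out
  obtain ⟨s', hs'⟩ := (inferInstance : Algebra.FiniteType ℂ D.OB).out
  refine ⟨Subalgebra.fg_def.2 ⟨(⋃ i, inclGen D c i '' s) ∪ ((⋃ k, inclOther D c k '' s) ∪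
    ⋃ E, inclIval D c E '' s'), ?_, ?_⟩⟩
  · exact (Set.finite_iUnion fun i => s.finite_toSet.image _).union
      ((Set.finite_iUnion fun k => s.finite_toSet.image _).union
        (Set.finite_iUnion fun E => s'.finite_toSet.image _))
  · refine eq_top_iff.2 fun t _ => tensor_induction _ ?_ ?_ ?_ t
    · refine fun i => mem_of_adjoin_eq_top hs _ fun a ha => Algebra.subset_adjoin ?_
      exact Or.inl (Set.mem_iUnion.2 ⟨i, a, ha, rfl⟩)
    · refine fun k => mem_of_adjoin_eq_top hs _ fun a ha => Algebra.subset_adjoin ?_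
      exact Or.inr (Or.inl (Set.mem_iUnion.2 ⟨k, a, ha, rfl⟩))
    · refine fun E => mem_of_adjoin_eq_top hs' _ fun a ha => Algebra.subset_adjoin ?_
      exact Or.inr (Or.inr (Set.mem_iUnion.2 ⟨E, a, ha, rfl⟩))

end Tensor

end WilsonLines

end

/-! ### The algebra of functions on the moduli space -/

noncomputable section

set_option linter.unusedSectionVars false

namespace WilsonLines

open FunctionSpace Pinned

section Words

variable {M M' : Type*} [Monoid M] [Monoid M'] (f : M →* M') {N : ℕ} (w : M) (u : Fin N → M)

theorem map_bdryWord : f (bdryWord w u) = bdryWord (f w) fun j => f (u j) := by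
  simp only [bdryWord, map_list_prod, List.map_reverse, List.map_ofFn, Function.comp_def, map_mul]

theorem map_bdryWordFirst : f (bdryWordFirst w u) = bdryWordFirst (f w) fun j => f (u j) := by
  simp only [bdryWordFirst, map_list_prod, List.map_reverse, List.map_rotate, List.map_ofFn,
    Function.comp_def, map_mul]

end Words

section Functions

variable {𝔤 : Type*} [LieRing 𝔤] [LieAlgebra ℂ 𝔤] [FiniteDimensional ℂ 𝔤]
  [LieAlgebra.IsKilling ℂ 𝔤] {𝔥 : LieSubalgebra ℂ 𝔤} [𝔥.IsCartanSubalgebra] {D : Pinned 𝔥}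
  {S : Type*} [TopologicalSpace S] [ChartedSpace (EuclideanHalfSpace 2) S]
  {Sig : MarkedSurface S} {x : S} {c : CurveSystem Sig x}

/-- The matrix of an element of the group. -/
def matHom (D : Pinned 𝔥) : D.G →* Matrix (Fin D.dim) (Fin D.dim) ℂ :=
  ((LinearMap.toMatrixAlgEquiv (Module.finBasis ℂ 𝔤)).toMonoidHom.comp
    (Units.coeHom (Module.End ℂ 𝔤))).comp (adjointGroup 𝔥).subtype

theorem matHom_apply (g : D.G) (p q : Fin D.dim) : matHom D g p q = D.entry p q g :=
  LinearMap.toMatrixAlgEquiv_apply _ _ _ _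

theorem matHom_injective : Function.Injective (matHom D) := fun _ _ h =>
  Subtype.ext (Units.ext ((LinearMap.toMatrixAlgEquiv (Module.finBasis ℂ 𝔤)).injective h))

theorem sub_entries_eq_zero_iff {g h : D.G} :
    (∀ p q, (matHom D g - matHom D h) p q = 0) ↔ g = h := by
  constructor
  · intro e
    refine matHom_injective (sub_eq_zero.1 ?_)
    ext p q
    exact e p q
  · rintro rfl p q
    rw [sub_self]
    rfl

/-- Evaluation of matrices over the tensor product. -/
def evalMat (z : Target D c) : TMat D c →+* Matrix (Fin D.dim) (Fin D.dim) ℂ :=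
  (evalTensor z : TensorAlg D c →+* ℂ).mapMatrix

theorem evalMat_uGen (z : Target D c) (i : GenIndex c) :
    evalMat z (uGen D c i) = matHom D (z.1 i) := by
  ext p q
  exact (evalTensor_inclGen z i _).trans (matHom_apply _ _ _).symm

theorem evalMat_uGenInv (z : Target D c) (i : GenIndex c) :
    evalMat z (uGenInv D c i) = matHom D (z.1 i)⁻¹ := by
  ext p q
  exact (evalTensor_inclGen z i _).trans (matHom_apply _ _ _).symm

theorem evalMat_uOther (z : Target D c) (k : OtherIndex c) :
    evalMat z (uOther D c k) = matHom D (z.2.1 k) := by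
  ext p q
  exact (evalTensor_inclOther z k _).trans (matHom_apply _ _ _).symm

theorem evalMat_uOtherInv (z : Target D c) (k : OtherIndex c) :
    evalMat z (uOtherInv D c k) = matHom D (z.2.1 k)⁻¹ := by
  ext p q
  exact (evalTensor_inclOther z k _).trans (matHom_apply _ _ _).symm

theorem evalMat_uIval (z : Target D c) (E : Sig.Ival) :
    evalMat z (uIval D c E) = matHom D (z.2.2 E).1 := by
  ext p q
  exact (evalTensor_inclIval z E _).trans (matHom_apply _ _ _).symm

theorem evalMat_constMat (z : Target D c) (g : D.G) :
    evalMat z (constMat D c g) = matHom D g := by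
  ext p q
  exact ((evalTensor z).commutes _).trans (matHom_apply _ _ _).symm

theorem evalMat_monodromyWord (z : Target D c) :
    evalMat z (monodromyWord (fun i => uGen D c (.inl i)) (fun i => uGenInv D c (.inl i))
      (fun i => uGen D c (.inr (.inl i))) (fun i => uGenInv D c (.inr (.inl i)))
      (fun k => uGen D c (.inr (.inr k))) - 1) =
    matHom D (monodromyWord (fun i => z.1 (.inl i)) (fun i => (z.1 (.inl i))⁻¹)
      (fun i => z.1 (.inr (.inl i))) (fun i => (z.1 (.inr (.inl i)))⁻¹)
      (fun k => z.1 (.inr (.inr k)))) - matHom D 1 := by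
  rw [map_sub, map_one, map_one]
  congr 1
  refine (map_monodromyWord (evalMat z).toMonoidHom _ _ _ _ _).trans ?_
  rw [map_monodromyWord]
  simp only [RingHom.toMonoidHom_eq_coe, MonoidHom.coe_coe, evalMat_uGen, evalMat_uGenInv]

theorem evalMat_bdryWordFirst (z : Target D c) :
    evalMat z (bdryWordFirst (constMat D c D.w0) (fun j => uIval D c ⟨Sig.k0, j⟩) -
      uGenInv D c (.inr (.inr Sig.k0))) =
    matHom D (bdryWordFirst D.w0 (fun j => (z.2.2 ⟨Sig.k0, j⟩).1)) -
      matHom D (z.1 (.inr (.inr Sig.k0)))⁻¹ := by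
  rw [map_sub, evalMat_uGenInv, map_bdryWordFirst]
  congr 1
  refine (map_bdryWordFirst (evalMat z).toMonoidHom _ _).trans ?_
  simp only [RingHom.toMonoidHom_eq_coe, MonoidHom.coe_coe, evalMat_uIval, evalMat_constMat]

theorem evalMat_bdryWord (z : Target D c) (k : OtherIndex c) :
    evalMat z ((uOther D c k * constMat D c D.w0) *
      bdryWord (constMat D c D.w0) (fun j => uIval D c ⟨k.1, j⟩) *
      (constMat D c D.w0⁻¹ * uOtherInv D c k) - uGenInv D c (.inr (.inr k.1))) =
    matHom D ((z.2.1 k * D.w0) * bdryWord D.w0 (fun j => (z.2.2 ⟨k.1, j⟩).1) *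
      (z.2.1 k * D.w0)⁻¹) - matHom D (z.1 (.inr (.inr k.1)))⁻¹ := by
  have h : evalMat z (bdryWord (constMat D c D.w0) (fun j => uIval D c ⟨k.1, j⟩)) =
      matHom D (bdryWord D.w0 (fun j => (z.2.2 ⟨k.1, j⟩).1)) := by
    rw [map_bdryWord]
    refine (map_bdryWord (evalMat z).toMonoidHom _ _).trans ?_
    simp only [RingHom.toMonoidHom_eq_coe, MonoidHom.coe_coe, evalMat_uIval, evalMat_constMat]
  rw [map_sub, evalMat_uGenInv, map_mul, map_mul, map_mul, map_mul, h, evalMat_uOther,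
    evalMat_uOtherInv, evalMat_constMat, evalMat_constMat, mul_inv_rev]
  simp only [map_mul]

theorem relationIdeal_le_ker_iff (z : Target D c) :
    relationIdeal D c ≤ RingHom.ker (evalTensor z) ↔ z ∈ relationLocus D c := by
  rw [relationIdeal, Ideal.span_le, Set.union_subset_iff, Set.union_subset_iff, and_assoc]
  refine and_congr ?_ (and_congr ?_ ?_)
  · rw [← sub_entries_eq_zero_iff, ← evalMat_monodromyWord]
    constructor
    · exact fun h p q => h ⟨p, q, rfl⟩
    · rintro h _ ⟨p, q, rfl⟩
      exact h p q
  · rw [← sub_entries_eq_zero_iff, ← evalMat_bdryWordFirst]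
    constructor
    · exact fun h p q => h ⟨p, q, rfl⟩
    · rintro h _ ⟨p, q, rfl⟩
      exact h p q
  · simp only [← sub_entries_eq_zero_iff, ← evalMat_bdryWord]
    constructor
    · exact fun h k p q => h ⟨k, p, q, rfl⟩
    · rintro h _ ⟨k, p, q, rfl⟩
      exact h k p q

/-- By the Nullstellensatz the radical is tested on points of the tensor product. The points over
the ideal are those of the relation locus, which is the image of the moduli space. -/
theorem mem_radical_relationIdeal {t : TensorAlg D c} :
    t ∈ (relationIdeal D c).radical ↔ ∀ P : Moduli D c, evalTensor (phi D c P) t = 0 := by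
  rw [mem_radical_iff]
  constructor
  · intro h P
    refine h _ ((relationIdeal_le_ker_iff _).2 ?_)
    rw [← range_phi]
    exact ⟨P, rfl⟩
  · intro h ψ hψ
    obtain ⟨z, rfl⟩ := exists_evalTensor_eq ψ
    rw [relationIdeal_le_ker_iff, ← range_phi] at hψ
    obtain ⟨P, rfl⟩ := hψ
    exact h P

/-- An element of the tensor product as a function on the target. -/
def tensorFun : TensorAlg D c →ₐ[ℂ] (Target D c → ℂ) := AlgHom.pi evalTensor

theorem tensorFun_inclGen (i : GenIndex c) (m : D.OG) :
    tensorFun (inclGen D c i m) = m.1 ∘ fun z => z.1 i :=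
  funext fun z => evalTensor_inclGen z i m

theorem tensorFun_inclOther (k : OtherIndex c) (m : D.OG) :
    tensorFun (inclOther D c k m) = m.1 ∘ fun z => z.2.1 k :=
  funext fun z => evalTensor_inclOther z k m

theorem tensorFun_inclIval (E : Sig.Ival) (m : D.OB) :
    tensorFun (inclIval D c E m) = m.1 ∘ fun z => z.2.2 E :=
  funext fun z => evalTensor_inclIval z E m

theorem range_tensorFun : (tensorFun : TensorAlg D c →ₐ[ℂ] _).range = targetAlg D c := by
  refine le_antisymm ?_ (Algebra.adjoin_le ?_)
  · rintro _ ⟨t, rfl⟩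
    refine tensor_induction ((targetAlg D c).comap tensorFun) (fun i m => ?_) (fun k m => ?_)
      (fun E m => ?_) t
    · rw [Subalgebra.mem_comap, tensorFun_inclGen]
      exact coordAlg_comp (fun _ => isRegTarget_id.1 i) m.2
    · rw [Subalgebra.mem_comap, tensorFun_inclOther]
      exact coordAlg_comp (fun _ => isRegTarget_id.2.1 k) m.2
    · rw [Subalgebra.mem_comap, tensorFun_inclIval]
      exact coordAlg_comp (fun _ => isRegTarget_id.2.2 E) m.2
  · have hG : IsReg D.OG fun g => g := isReg_coordAlg _ ()
    have hB : IsReg D.OB fun g => g.1 := isReg_coordAlg _ ()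
    rintro _ ⟨i | k | E, ℓ, v, rfl | rfl⟩
    · exact ⟨inclGen D c i ⟨_, (hG ℓ v).1⟩, tensorFun_inclGen _ _⟩
    · exact ⟨inclGen D c i ⟨_, (hG ℓ v).2⟩, tensorFun_inclGen _ _⟩
    · exact ⟨inclOther D c k ⟨_, (hG ℓ v).1⟩, tensorFun_inclOther _ _⟩
    · exact ⟨inclOther D c k ⟨_, (hG ℓ v).2⟩, tensorFun_inclOther _ _⟩
    · exact ⟨inclIval D c E ⟨_, (hB ℓ v).1⟩, tensorFun_inclIval _ _⟩
    · exact ⟨inclIval D c E ⟨_, (hB ℓ v).2⟩, tensorFun_inclIval _ _⟩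

/-- The basic open sets form a basis of the Zariski topology. -/
theorem exists_basic_open {Y : Type*} {A : Subalgebra ℂ (Y → ℂ)} {V : Set Y}
    (hV : IsOpen[(affine A).top] V) {y : Y} (hy : y ∈ V) :
    ∃ h ∈ A, h y ≠ 0 ∧ ∀ z, h z ≠ 0 → z ∈ V := by
  induction hV with
  | basic V hV =>
    obtain ⟨h, hh, rfl⟩ := hV
    exact ⟨h, hh, hy, fun _ hz => hz⟩
  | univ => exact ⟨1, one_mem _, one_ne_zero, fun _ _ => trivial⟩
  | inter V W _ _ ih ih' =>
    obtain ⟨h, hh, h0, e⟩ := ih hy.1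
    obtain ⟨h', hh', h0', e'⟩ := ih' hy.2
    exact ⟨h * h', mul_mem hh hh', mul_ne_zero h0 h0',
      fun z hz => ⟨e z (left_ne_zero_of_mul hz), e' z (right_ne_zero_of_mul hz)⟩⟩
  | sUnion 𝒱 _ ih =>
    obtain ⟨V, hV, hyV⟩ := hy
    obtain ⟨h, hh, h0, e⟩ := ih V hV hyV
    exact ⟨h, hh, h0, fun z hz => ⟨V, hV, e z hz⟩⟩

theorem comp_phi_mem {f : Target D c → ℂ} (hf : f ∈ targetAlg D c) :
    f ∘ phi D c ∈ (moduliSpace D c).functionAlgebra := by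
  rw [functionAlgebra, regular_moduliSpace]
  intro P _
  exact ⟨Set.univ, @isOpen_univ _ (affine (targetAlg D c)).top, trivial, f,
    fun z _ => ⟨f, hf, 1, one_mem _, one_ne_zero, fun y _ _ => (div_one _).symm⟩,
    fun _ _ _ => rfl⟩

/-- The multipliers of `F` into the functions from the tensor product. -/
def denominators (F : Moduli D c → ℂ) : Ideal (TensorAlg D c) where
  carrier := {t | ∃ t', ∀ P, F P * evalTensor (phi D c P) t = evalTensor (phi D c P) t'}
  add_mem' := by
    rintro a b ⟨a', ha⟩ ⟨b', hb⟩
    exact ⟨a' + b', fun P => by rw [map_add, map_add, mul_add, ha, hb]⟩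
  zero_mem' := ⟨0, fun P => by rw [map_zero, mul_zero]⟩
  smul_mem' := by
    rintro s a ⟨a', ha⟩
    exact ⟨s * a', fun P => by rw [smul_eq_mul, map_mul, map_mul, ← ha]; ring⟩

theorem exists_mem_denominators {F : Moduli D c → ℂ} (hF : F ∈ (moduliSpace D c).functionAlgebra)
    (P : Moduli D c) : ∃ t ∈ denominators F, evalTensor (phi D c P) t ≠ 0 := by
  rw [functionAlgebra, regular_moduliSpace] at hF
  obtain ⟨V, hV, hPV, F', hF', e⟩ := hF P trivial
  obtain ⟨p, hp, h, hh, h0, e'⟩ := hF' _ hPV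
  obtain ⟨q, hq, q0, eq⟩ := exists_basic_open hV hPV
  rw [← range_tensorFun] at hp hh hq
  obtain ⟨p, rfl⟩ := hp
  obtain ⟨h, rfl⟩ := hh
  obtain ⟨q, rfl⟩ := hq
  have h0' : evalTensor (phi D c P) h ≠ 0 := h0
  have q0' : evalTensor (phi D c P) q ≠ 0 := q0
  -- The factor `q` kills both sides wherever `F = p / h` is not known. The second factor `h` makes
  -- the numerator vanish together with the denominator where `h = 0`.
  refine ⟨h * h * q, ⟨p * h * q, fun Q => ?_⟩, ?_⟩
  · simp only [map_mul]
    by_cases hq : evalTensor (phi D c Q) q = 0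
    · rw [hq, mul_zero, mul_zero, mul_zero]
    by_cases hh : evalTensor (phi D c Q) h = 0
    · rw [hh]
      ring
    have hV := eq _ hq
    rw [e Q trivial hV, e' _ hV hh]
    change evalTensor (phi D c Q) p / evalTensor (phi D c Q) h * _ = _
    field_simp
  · simp only [map_mul]
    exact mul_ne_zero (mul_ne_zero h0' h0') q0'

/-- A maximal ideal containing all denominators would be a point of the target. It would lie in the
relation locus, hence come from a point of the moduli space, but at each such point some denominator
is nonzero. So `1` is a denominator. -/
theorem exists_tensor_eq {F : Moduli D c → ℂ} (hF : F ∈ (moduliSpace D c).functionAlgebra) :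
    ∃ t : TensorAlg D c, ∀ P, F P = evalTensor (phi D c P) t := by
  have h1 : denominators F = ⊤ := by
    by_contra hne
    obtain ⟨q, hq, hle⟩ := Ideal.exists_le_maximal _ hne
    obtain ⟨ψ, rfl⟩ := exists_algHom_of_isMaximal q
    obtain ⟨z, rfl⟩ := exists_evalTensor_eq ψ
    -- Elements of the relation ideal vanish on the moduli space, so they are denominators with
    -- numerator `0`.
    have hz : z ∈ relationLocus D c := by
      refine (relationIdeal_le_ker_iff z).1 (le_trans (fun t ht => ?_) hle)
      refine ⟨0, fun P => ?_⟩
      rw [mem_radical_relationIdeal.1 (Ideal.le_radical ht) P, mul_zero, map_zero]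
    rw [← range_phi] at hz
    obtain ⟨P, rfl⟩ := hz
    obtain ⟨t, ht, ht0⟩ := exists_mem_denominators hF P
    exact ht0 (hle ht)
  obtain ⟨t, ht⟩ : (1 : TensorAlg D c) ∈ denominators F := h1 ▸ Submodule.mem_top
  refine ⟨t, fun P => ?_⟩
  rw [← ht P, map_one, mul_one]

theorem mem_functionAlgebra_iff {F : Moduli D c → ℂ} :
    F ∈ (moduliSpace D c).functionAlgebra ↔ ∃ f ∈ targetAlg D c, F = f ∘ phi D c := by
  constructor
  · intro hF
    obtain ⟨t, ht⟩ := exists_tensor_eq hF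
    exact ⟨tensorFun t, range_tensorFun (D := D) (c := c) ▸ ⟨t, rfl⟩, funext ht⟩
  · rintro ⟨f, hf, rfl⟩
    exact comp_phi_mem hf

/-- The homomorphism from the tensor product to the regular functions on the moduli space. -/
def tensorToFunction (D : Pinned 𝔥) (c : CurveSystem Sig x) :
    TensorAlg D c →ₐ[ℂ] (moduliSpace D c).functionAlgebra :=
  (AlgHom.pi fun P => evalTensor (phi D c P)).codRestrict _ fun t =>
    mem_functionAlgebra_iff.2 ⟨tensorFun t, range_tensorFun (D := D) (c := c) ▸ ⟨t, rfl⟩, rfl⟩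

theorem tensorToFunction_apply (t : TensorAlg D c) (P : Moduli D c) :
    (tensorToFunction D c t).1 P = evalTensor (phi D c P) t := rfl

theorem tensorToFunction_surjective : Function.Surjective (tensorToFunction D c) := by
  rintro ⟨F, hF⟩
  obtain ⟨t, ht⟩ := exists_tensor_eq hF
  exact ⟨t, Subtype.ext (funext fun P => (ht P).symm)⟩

theorem ker_tensorToFunction : RingHom.ker (tensorToFunction D c) = (relationIdeal D c).radical := by
  ext t
  rw [mem_radical_relationIdeal, RingHom.mem_ker]
  constructor
  · intro h P
    rw [← tensorToFunction_apply, h]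
    rfl
  · intro h
    exact Subtype.ext (funext h)

theorem exists_tensor_equiv :
    ∃ Ψ : (TensorAlg D c ⧸ (relationIdeal D c).radical) ≃ₐ[ℂ] (moduliSpace D c).functionAlgebra,
      ∀ t P, (Ψ (Ideal.Quotient.mk _ t)).1 P = evalTensor (phi D c P) t := by
  refine ⟨(Ideal.quotientEquivAlgOfEq ℂ ker_tensorToFunction.symm).trans
    (Ideal.quotientKerAlgEquivOfSurjective tensorToFunction_surjective), fun t P => ?_⟩
  rfl

end Functions

end WilsonLines

end

/-! ### Generation by matrix coefficients of Wilson lines -/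

noncomputable section

set_option linter.unusedSectionVars false

namespace WilsonLines

open FunctionSpace Pinned

section Generation

variable {𝔤 : Type*} [LieRing 𝔤] [LieAlgebra ℂ 𝔤] [FiniteDimensional ℂ 𝔤]
  [LieAlgebra.IsKilling ℂ 𝔤] {𝔥 : LieSubalgebra ℂ 𝔤} [𝔥.IsCartanSubalgebra] {D : Pinned 𝔥}
  {S : Type*} [TopologicalSpace S] [ChartedSpace (EuclideanHalfSpace 2) S]
  {Sig : MarkedSurface S} {x : S} {c : CurveSystem Sig x}

theorem dual_smul_eq_dotProduct (ℓ : Module.Dual ℂ 𝔤) (v : 𝔤) (g : D.G) :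
    ℓ (g • v) = dotProduct (fun i => ℓ (Module.finBasis ℂ 𝔤 i))
      ((matHom D g).mulVec ((Module.finBasis ℂ 𝔤).repr v)) := by
  have h : (matHom D g).mulVec ((Module.finBasis ℂ 𝔤).repr v) =
      (Module.finBasis ℂ 𝔤).repr (g • v) :=
    LinearMap.toMatrix_mulVec_repr (Module.finBasis ℂ 𝔤) (Module.finBasis ℂ 𝔤) (D.lin g) v
  rw [h]
  conv_lhs => rw [← (Module.finBasis ℂ 𝔤).sum_repr (g • v), map_sum]
  refine Finset.sum_congr rfl fun i _ => ?_
  rw [map_smul, smul_eq_mul, mul_comm]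

theorem isMatrixCoefficient_smul (ℓ : Module.Dual ℂ 𝔤) (v : 𝔤) :
    D.IsMatrixCoefficient fun g => ℓ (g • v) := by
  refine ⟨D.dim, matHom D, _, _, fun i j => ?_, funext (dual_smul_eq_dotProduct ℓ v)⟩
  simp only [matHom_apply]
  exact (D.entryG i j).2

/-- These are matrix coefficients of the dual representation, the inverse transpose. -/
theorem isMatrixCoefficient_inv_smul (ℓ : Module.Dual ℂ 𝔤) (v : 𝔤) :
    D.IsMatrixCoefficient fun g => ℓ (g⁻¹ • v) := by
  let π : D.G →* Matrix (Fin D.dim) (Fin D.dim) ℂ :=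
    { toFun := fun g => (matHom D g⁻¹).transpose
      map_one' := by rw [inv_one, map_one, Matrix.transpose_one]
      map_mul' := fun g h => by rw [mul_inv_rev, map_mul, Matrix.transpose_mul] }
  refine ⟨D.dim, π, (Module.finBasis ℂ 𝔤).repr v, fun i => ℓ (Module.finBasis ℂ 𝔤 i),
    fun i j => ?_, funext fun g => ?_⟩
  · change (fun g => matHom D g⁻¹ j i) ∈ _
    simp only [matHom_apply]
    exact (D.entryInvG j i).2
  · rw [dual_smul_eq_dotProduct]
    change _ = dotProduct _ ((matHom D g⁻¹).transpose.mulVec _)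
    rw [Matrix.mulVec_transpose, Matrix.dotProduct_mulVec, dotProduct_comm]

theorem IsMatrixCoefficient.mem {m : D.G → ℂ} (h : D.IsMatrixCoefficient m) : m ∈ D.OG := by
  obtain ⟨n, π, f, v, hπ, rfl⟩ := h
  have : (fun g => dotProduct f ((π g).mulVec v)) = ∑ i, ∑ j, (f i * v j) • fun g => π g i j := by
    ext g
    simp only [dotProduct, Matrix.mulVec, Finset.mul_sum, Finset.sum_apply, Pi.smul_apply,
      smul_eq_mul]
    exact Finset.sum_congr rfl fun i _ => Finset.sum_congr rfl fun j _ => by ring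
  rw [this]
  exact sum_mem fun i _ => sum_mem fun j _ => D.OG.smul_mem (hπ i j) _

theorem isReg_of_matrixCoefficients {Y : Type*} {A : Subalgebra ℂ (Y → ℂ)} {F : Y → D.G}
    (h : ∀ m, D.IsMatrixCoefficient m → (fun y => m (F y)) ∈ A) : IsReg A F := fun ℓ v =>
  ⟨h _ (isMatrixCoefficient_smul ℓ v), h _ (isMatrixCoefficient_inv_smul ℓ v)⟩

theorem IsReg.matrixCoefficient_mem {Y : Type*} {A : Subalgebra ℂ (Y → ℂ)} {F : Y → D.G}
    (h : IsReg A F) {m : D.G → ℂ} (hm : D.IsMatrixCoefficient m) : (fun y => m (F y)) ∈ A :=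
  coordAlg_comp (σ := F) (F := fun (_ : Unit) g => g) (fun _ => h) (IsMatrixCoefficient.mem hm)

theorem isRegTarget_phi : IsRegTarget (moduliSpace D c).functionAlgebra (phi D c) :=
  isRegTarget_id.comp fun _ => comp_phi_mem

/-- All regular functions are pullbacks of coordinate functions, so it suffices that `Φ` is regular
with respect to the generated subalgebra. -/
theorem adjoin_eq_of_isRegTarget {s : Set (Moduli D c → ℂ)}
    (hs : s ⊆ (moduliSpace D c).functionAlgebra) (h : IsRegTarget (Algebra.adjoin ℂ s) (phi D c)) :
    Algebra.adjoin ℂ s = (moduliSpace D c).functionAlgebra := by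
  refine le_antisymm (Algebra.adjoin_le hs) fun F hF => ?_
  obtain ⟨f, hf, rfl⟩ := mem_functionAlgebra_iff.1 hF
  exact h.comp_mem hf

theorem adjoin_phiCoefficients :
    Algebra.adjoin ℂ (phiCoefficients D c) = (moduliSpace D c).functionAlgebra := by
  refine adjoin_eq_of_isRegTarget ?_ ⟨fun i => ?_, fun k => ?_, fun E => ?_⟩
  · rintro _ ⟨m, hm, ⟨i, rfl⟩ | ⟨k, rfl⟩ | ⟨E, rfl⟩⟩
    · exact IsReg.matrixCoefficient_mem (isRegTarget_phi.1 i) hm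
    · exact IsReg.matrixCoefficient_mem (isRegTarget_phi.2.1 k) hm
    · exact IsReg.matrixCoefficient_mem (isRegTarget_phi.2.2 E) hm
  · exact isReg_of_matrixCoefficients fun m hm =>
      Algebra.subset_adjoin ⟨m, hm, Or.inl ⟨i, rfl⟩⟩
  · exact isReg_of_matrixCoefficients fun m hm =>
      Algebra.subset_adjoin ⟨m, hm, Or.inr (Or.inl ⟨k, rfl⟩)⟩
  · exact isReg_of_matrixCoefficients fun m hm =>
      Algebra.subset_adjoin ⟨m, hm, Or.inr (Or.inr ⟨E, rfl⟩)⟩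

theorem comp_normalize_mem {f : Atlas D c → ℂ} (hf : f ∈ pulledAlg D c) :
    f ∘ normalize ∈ (moduliSpace D c).functionAlgebra := by
  obtain ⟨k, hk, rfl⟩ := hf
  have : (k ∘ phiTilde) ∘ normalize = (k ∘ fun z => (z, 1)) ∘ phi D c :=
    funext fun P => congrArg k (phiTilde_normalize P)
  rw [this]
  exact comp_phi_mem (comp_mk_one_mem hk)

theorem isReg_wilsonLine_out {E E' : Sig.Ival} (a : c.ArcClass E E') :
    IsReg (moduliSpace D c).functionAlgebra fun P => wilsonLine a (Quotient.out P) := by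
  have h : IsReg (pulledAlg D c) (wilsonLine a) :=
    (((pulled_gE E).inv.mul (pulled_rho _)).mul (pulled_gE E')).mul (IsReg.const _)
  have e : (fun P : Moduli D c => wilsonLine a (Quotient.out P)) =
      fun P => wilsonLine a (normalize P) := funext fun P => (wilsonLine_smul a _ _).symm
  -- By invariance the chosen representative may be replaced by the one with `g_0 = 1`, where the
  -- Wilson line is regular in the tuple.
  rw [e]
  exact h.comp fun _ => comp_normalize_mem

theorem adjoin_wilsonCoefficients :
    Algebra.adjoin ℂ (wilsonCoefficients D c) = (moduliSpace D c).functionAlgebra := by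
  have h : ∀ {E E' : Sig.Ival} (a : c.ArcClass E E'),
      IsReg (Algebra.adjoin ℂ (wilsonCoefficients D c)) fun P => wilsonLine a (Quotient.out P) :=
    fun a => isReg_of_matrixCoefficients fun m hm => Algebra.subset_adjoin ⟨_, _, a, m, hm, rfl⟩
  refine adjoin_eq_of_isRegTarget ?_ ⟨fun i => ?_, fun k => h _, fun E => ?_⟩
  · rintro _ ⟨E, E', a, m, hm, rfl⟩
    exact IsReg.matrixCoefficient_mem (isReg_wilsonLine_out a) hm
  -- Each monodromy is the Wilson line of a closed arc at `E_0` times the constant `w̄₀`.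
  · obtain ⟨a, ha⟩ := c.exists_arc Sig.E0 Sig.E0 (genLoop c i)
    have e : (fun P : Moduli D c => (phi D c P).1 i) =
        fun P => wilsonLine a (Quotient.out P) * D.w0 := by
      ext1 P
      rw [wilsonLine, ha, mul_assoc _ D.w0 D.w0, D.w0_mul_w0, mul_one]
      rfl
    rw [e]
    exact (h a).mul (IsReg.const _)
  · have e : (fun P : Moduli D c => ((phi D c P).2.2 E).1) =
        fun P => wilsonLine (c.bdryArc E) (Quotient.out P) := funext fun P => phiTuple_ival _ E
    rw [e]
    exact h _

end Generation

end WilsonLines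

end

/-! ### The theorem -/

open WilsonLines in
theorem theorem3p8
    {𝔤 : Type*} [LieRing 𝔤] [LieAlgebra ℂ 𝔤] [FiniteDimensional ℂ 𝔤] [LieAlgebra.IsKilling ℂ 𝔤]
    {𝔥 : LieSubalgebra ℂ 𝔤} [𝔥.IsCartanSubalgebra] (D : Pinned 𝔥)
    {S : Type*} [TopologicalSpace S] [ChartedSpace (EuclideanHalfSpace 2) S]
    [T2Space S] [CompactSpace S] [ConnectedSpace S]
    (Sig : MarkedSurface S) (x : S) (c : CurveSystem Sig x)
    -- `-3 χ + 2 |𝕊| > 0`, with the Euler characteristic `χ = 2 - 2 g - b`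
    (hn : 0 < -3 * (2 - 2 * (c.genus : ℤ) - Sig.b) + 2 * ∑ k, (Sig.N k : ℤ))
    -- not a disk with one or two special points
    (hd : ¬ (c.genus = 0 ∧ Sig.b = 1 ∧ ∑ k, Sig.N k ≤ 2)) :
    -- `𝒫_G` is a principal homogeneous space, so that `g_E` is well defined
    (∀ φ : D.Pinning, ∃! g : D.G, g • D.pStd = φ) ∧
    -- the Wilson lines are invariant, and the boundary Wilson lines take values in `B⁺`
    (∀ (E E' : Sig.Ival) (a : c.ArcClass E E') (h : D.G) (y : Atlas D c),
      wilsonLine a (h • y) = wilsonLine a y) ∧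
    (∀ (E : Sig.Ival) (y : Atlas D c), wilsonLine (c.bdryArc E) y ∈ D.B) ∧
    -- the presentation `Φ̃` is an equivariant closed embedding, and its image is `locus × G`
    (∀ (h : D.G) (y : Atlas D c), phiTilde (h • y) = ((phiTilde y).1, h * (phiTilde y).2)) ∧
    (atlasSpace D c).IsClosedEmbedding (.affine (targetProdAlg D c)) phiTilde ∧
    Set.range (phiTilde : Atlas D c → _) = relationLocus D c ×ˢ Set.univ ∧
    -- `Φ` is a closed embedding of the moduli space, and its image is the locus of the relations
    (∀ y : Atlas D c, phi D c (toModuli D c y) = phiTuple y) ∧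
    (moduliSpace D c).IsClosedEmbedding (.affine (targetAlg D c)) (phi D c) ∧
    Set.range (phi D c) = relationLocus D c ∧
    -- the function algebra of the moduli space, identified through `Φ`
    (∃ Ψ : (TensorAlg D c ⧸ (relationIdeal D c).radical) ≃ₐ[ℂ] (moduliSpace D c).functionAlgebra,
      (∀ (i : GenIndex c) (m : D.OG) (P : Moduli D c),
        (Ψ (Ideal.Quotient.mk _ (inclGen D c i m))).1 P = m.1 ((phi D c P).1 i)) ∧
      (∀ (k : OtherIndex c) (m : D.OG) (P : Moduli D c),
        (Ψ (Ideal.Quotient.mk _ (inclOther D c k m))).1 P = m.1 ((phi D c P).2.1 k)) ∧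
      (∀ (E : Sig.Ival) (m : D.OB) (P : Moduli D c),
        (Ψ (Ideal.Quotient.mk _ (inclIval D c E m))).1 P = m.1 ((phi D c P).2.2 E))) ∧
    -- it is generated by the matrix coefficients of Wilson lines, already by those occurring in `Φ`
    Algebra.adjoin ℂ (phiCoefficients D c) = (moduliSpace D c).functionAlgebra ∧
    Algebra.adjoin ℂ (wilsonCoefficients D c) = (moduliSpace D c).functionAlgebra := by
  refine ⟨D.existsUnique_smul_pStd, fun _ _ => wilsonLine_smul, wilsonLine_bdryArc_mem,
    phiTilde_smul, isClosedEmbedding_phiTilde, range_phiTilde, phi_toModuli, isClosedEmbedding_phi,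
    range_phi, ?_, adjoin_phiCoefficients, adjoin_wilsonCoefficients⟩
  obtain ⟨Ψ, hΨ⟩ := exists_tensor_equiv (D := D) (c := c)
  exact ⟨Ψ, fun i m P => (hΨ _ P).trans (evalTensor_inclGen _ i m),
    fun k m P => (hΨ _ P).trans (evalTensor_inclOther _ k m),
    fun E m P => (hΨ _ P).trans (evalTensor_inclIval _ E m)⟩
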